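/- Let $\mathcal S_0\subset\mathbb R^2$ be closed, bounded, nonempty, connected and simply connected with smooth boundary, let $\mathcal F_0=\mathbb R^2\setminus\mathcal S_0$, and let $m>0$, $\mathcal J>0$, $\alpha\ge 0$. Write $x^\perp=(-x_2,x_1)$. Let $$\mathcal H=\{\phi\in L^2(\mathbb R^2;\mathbb R^2):\ \operatorname{div}\phi=0\text{ in }\mathbb R^2,\ D(\phi)=0\text{ in }\mathcal S_0\},$$ where $D(\phi)$ is the symmetric gradient and the equations hold in the sense of distributions ($D(\phi)=0$ in the interior of $\mathcal S_0$). Each $\phi\in\mathcal H$ satisfies $\phi(x)=\ell_\phi+r_\phi x^\perp$ on $\mathcal S_0$ for a unique $(\ell_\phi,r_\phi)\in\mathbb R^2\times\mathbb R$; put $\phi_{\mathcal S}(x)=\ell_\phi+r_\phi x^\perp$ for all $x$, and $$\|\phi\|_{\mathcal H}^2=\int_{\mathcal F_0}|\phi|^2\,dx+m|\ell_\phi|^2+\mathcal J r_\phi^2 .$$ With $\nabla\phi$ the weak gradient of $\phi$ in $\mathcal F_0$, let \begin{align*} \underline{\mathcal V}&=\Big\{\phi\in\mathcal H:\int_{\mathcal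 F_0}|\nabla\phi|^2<\infty\Big\}, & \|\phi\|_{\underline{\mathcal V}}&=\|\phi\|_{\mathcal H}+\Big(\int_{\mathcal F_0}|\nabla\phi|^2\Big)^{1/2},\\ \mathcal V&=\Big\{\phi\in\mathcal H:\int_{\mathcal F_0}|\nabla\phi(y)|^2(1+|y|^2)\,dy<\infty\Big\}, & \|\phi\|_{\mathcal V}&=\|\phi\|_{\mathcal H}+\Big(\int_{\mathcal F_0}|\nabla\phi(y)|^2(1+|y|^2)\,dy\Big)^{1/2},\\ \widehat{\mathcal V}&=\{\phi\in\mathcal V:\ \phi|_{\mathcal F_0}\in\mathrm{Lip}(\overline{\mathcal F_0})\}, & \|\phi\|_{\widehat{\mathcal V}}&=\|\phi\|_{\mathcal V}+\|\phi\|_{\mathrm{Lip}(\overline{\mathcal F_0})}, \end{align*} where $\|\cdot\|_{\mathrm{Lip}}$ is the supremum norm plus the best Lipschitz constant. For a measurable set $A\subset\mathcal F_0$ put $$b_A(u,v,w)=\int_{A}\Big([(u-u_{\mathcal S})\cdot\nabla w]\cdot v-r_u\,v^\perp\cdot w\Big)dx-m\,r_u\,\ell_v^\perp\cdot\ell_w,\qquad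 b=b_{\mathcal F_0},$$ $$a(u,v)=-\alpha\int_{\partial\mathcal S_0}(u-u_{\mathcal S})\cdot(v-v_{\mathcal S})\,ds-\int_{\mathcal F_0}D(u):D(v)\,dx,$$ where on $\partial\mathcal S_0$ the fields $u,v$ are understood as the $L^2(\partial\mathcal S_0)$ traces of $u|_{\mathcal F_0},v|_{\mathcal F_0}$. Then: (i) For $(u,v,w)\in\underline{\mathcal V}\times\underline{\mathcal V}\times\mathcal V$ the integrand of $b(u,v,w)$ is integrable on $\mathcal F_0$, $b$ is trilinear on $\underline{\mathcal V}\times\underline{\mathcal V}\times\mathcal V$, and there is a constant $C>0$ with $$|b(u,v,w)|\le C\|u\|_{\underline{\mathcal V}}\|v\|_{\underline{\mathcal V}}\|w\|_{\mathcal V}\quad\text{on }\underline{\mathcal V}\times\underline{\mathcal V}\times\mathcal V.$$ For $u,v\in\underline{\mathcal V}$ one has $b(u,v,v)=0$, in the following sense: the integrand of $b(u,v,v)$ is integrable on $\mathcal F_0\cap B(0,R)$ for every $R$, $b_{\mathcal F_0\cap B(0,R)}(u,v,v)\to 0$ as $R\to\infty$, and $b(u,v,v)=0$ whenever the integrand is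 integrable on $\mathcal F_0$ (so in particular for $v\in\mathcal V$). For $u\in\underline{\mathcal V}$ and $v,w\in\mathcal V$ one has $b(u,v,w)=-b(u,w,v)$. (ii) For $(u,v,w)\in\mathcal H\times\mathcal H\times\widehat{\mathcal V}$ the integrand of $b(u,v,w)$ is integrable on $\mathcal F_0$ as well; thus the same formula extends $b$ to $\mathcal H\times\mathcal H\times\widehat{\mathcal V}$. This extension is trilinear, and there is a constant $C>0$ with $$|b(u,v,w)|\le C\|u\|_{\mathcal H}\|v\|_{\mathcal H}\|w\|_{\widehat{\mathcal V}}\quad\text{on }\mathcal H\times\mathcal H\times\widehat{\mathcal V}.$$ (iii) Every $u\in\underline{\mathcal V}$ has a trace in $L^2(\partial\mathcal S_0)$ from the side of $\mathcal F_0$, both integrands of $a(u,v)$ are integrable for $u,v\in\underline{\mathcal V}$, $a$ is bilinear on $\underline{\mathcal V}\times\underline{\mathcal V}$, and there is a constant $C>0$ with $$|a(u,v)|\le C\|u\|_{\underline{\mathcal V}}\|v\|_{\underline{\mathcal V}}\quad\text{on }\underline{\mathcal V}\times\underline{\mathcal V}.$$ -/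

import Mathlib

open MeasureTheory Set Filter Topology
open scoped ENNReal NNReal ContDiff

namespace FluidBody

/-- The Euclidean plane. -/
abbrev Plane : Type := EuclideanSpace ℝ (Fin 2)

/-- Square integrable planar vector fields (classes modulo almost everywhere equality). -/
abbrev L2 : Type := Lp Plane 2 (volume : Measure Plane)

/-- `x^⊥ = (-x₂, x₁)`. -/
noncomputable def perp (x : Plane) : Plane := !₂[-(x 1), x 0]

/-- The rigid velocity field `x ↦ ℓ + r x^⊥`. -/
noncomputable def rigidField (p : Plane × ℝ) (x : Plane) : Plane := p.1 + p.2 • perp x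

/-- The boundary of `S` is smooth and `S` lies locally on one side of it: near each boundary point,
in suitable orthonormal coordinates, `S` is the subgraph of a smooth function. -/
def HasSmoothBoundary (S : Set Plane) : Prop :=
  ∀ p ∈ frontier S, ∃ (L : Plane ≃ₗᵢ[ℝ] Plane) (γ : ℝ → ℝ) (ρ : ℝ),
    ContDiff ℝ ∞ γ ∧ 0 < ρ ∧ ∀ x ∈ Metric.ball p ρ, x ∈ S ↔ (L x) 1 ≤ γ ((L x) 0)

/-- The set occupied by the solid: a closed, bounded, (nonempty) connected and simply connected
subset of the plane with smooth boundary. -/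
structure IsBody (S : Set Plane) : Prop where
  isClosed : IsClosed S
  isBounded : Bornology.IsBounded S
  isConnected : IsConnected S
  isSimplyConnected : IsSimplyConnected S
  smooth : HasSmoothBoundary S

/-- `ψ` is a smooth real function with compact support contained in `Ω`. -/
structure IsTest (Ω : Set Plane) (ψ : Plane → ℝ) : Prop where
  smooth : ContDiff ℝ ∞ ψ
  compact : HasCompactSupport ψ
  subset : tsupport ψ ⊆ Ω

/-- The partial derivative `∂_j ψ`. -/
noncomputable def pd (j : Fin 2) (ψ : Plane → ℝ) (x : Plane) : ℝ :=
  fderiv ℝ ψ x (EuclideanSpace.single j 1)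

/-- `div φ = 0` in the plane, in the sense of distributions. -/
def DivFree (φ : Plane → Plane) : Prop :=
  ∀ ψ, IsTest univ ψ → ∑ i, ∫ x, φ x i * pd i ψ x = 0

/-- `D(φ) = 0` in the open set `Ω`, in the sense of distributions. -/
def StrainFree (Ω : Set Plane) (φ : Plane → Plane) : Prop :=
  ∀ ψ, IsTest Ω ψ → ∀ i j, (∫ x, φ x i * pd j ψ x) + ∫ x, φ x j * pd i ψ x = 0

/-- `G` is the weak gradient of `φ` in the open set `Ω`, with `G x i j = ∂_j φ_i (x)`. -/
def IsWeakGrad (Ω : Set Plane) (φ : Plane → Plane) (G : Plane → Fin 2 → Fin 2 → ℝ) : Prop :=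
  ∀ i j, LocallyIntegrableOn (fun x => G x i j) Ω ∧
    ∀ ψ, IsTest Ω ψ → ∫ x in Ω, φ x i * pd j ψ x = -∫ x in Ω, G x i j * ψ x

open Classical in
/-- The weak gradient in `Ω` (unique up to null sets in `Ω` when it exists). -/
noncomputable def weakGrad (Ω : Set Plane) (φ : Plane → Plane) : Plane → Fin 2 → Fin 2 → ℝ :=
  if h : ∃ G, IsWeakGrad Ω φ G then h.choose else 0

/-! ### Elementary facts, used to see that the spaces below are vector spaces -/

theorem continuous_pd {Ω : Set Plane} {ψ : Plane → ℝ} (h : IsTest Ω ψ) (j : Fin 2) :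
    Continuous (pd j ψ) :=
  (h.smooth.continuous_fderiv (by simp)).clm_apply continuous_const

theorem compact_pd {Ω : Set Plane} {ψ : Plane → ℝ} (h : IsTest Ω ψ) (j : Fin 2) :
    HasCompactSupport (pd j ψ) :=
  (h.compact.fderiv (𝕜 := ℝ)).comp_left (g := fun T : Plane →L[ℝ] ℝ => T (EuclideanSpace.single j 1))
    (by simp)

theorem integrable_coord (φ : L2) (i : Fin 2) {g : Plane → ℝ} (hg : Continuous g)
    (hc : HasCompactSupport g) : Integrable (fun x => φ x i * g x) := by
  have h1 : MemLp (fun x => φ x i) 2 (volume : Measure Plane) :=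
    (EuclideanSpace.proj i : Plane →L[ℝ] ℝ).comp_memLp' (Lp.memLp φ)
  exact (h1.locallyIntegrable (by norm_num)).integrable_smul_right_of_hasCompactSupport hg hc

theorem integral_coord_add (φ φ' : L2) (i : Fin 2) {g : Plane → ℝ} (hg : Continuous g)
    (hc : HasCompactSupport g) (Ω : Set Plane) :
    ∫ x in Ω, (φ + φ' : L2) x i * g x
      = (∫ x in Ω, φ x i * g x) + ∫ x in Ω, φ' x i * g x := by
  rw [← integral_add (integrable_coord φ i hg hc).integrableOn
    (integrable_coord φ' i hg hc).integrableOn]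
  refine integral_congr_ae (ae_restrict_of_ae ?_)
  filter_upwards [Lp.coeFn_add φ φ'] with x hx
  simp only [hx, Pi.add_apply, PiLp.add_apply, add_mul]

theorem integral_coord_smul (c : ℝ) (φ : L2) (i : Fin 2) (g : Plane → ℝ) (Ω : Set Plane) :
    ∫ x in Ω, (c • φ : L2) x i * g x = c * ∫ x in Ω, φ x i * g x := by
  rw [← integral_const_mul]
  refine integral_congr_ae (ae_restrict_of_ae ?_)
  filter_upwards [Lp.coeFn_smul c φ] with x hx
  simp [hx, mul_assoc]

theorem integral_coord_zero (i : Fin 2) (g : Plane → ℝ) (Ω : Set Plane) :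
    ∫ x in Ω, (0 : L2) x i * g x = 0 := by
  simpa only [zero_smul, zero_mul] using integral_coord_smul 0 0 i g Ω

theorem integrable_grad {Ω : Set Plane} {G : Plane → ℝ} (hG : LocallyIntegrableOn G Ω)
    {ψ : Plane → ℝ} (h : IsTest Ω ψ) : IntegrableOn (fun x => G x * ψ x) Ω := by
  have h1 : IntegrableOn G (tsupport ψ) := hG.integrableOn_compact_subset h.subset h.compact
  have h2 : IntegrableOn (fun x => G x * ψ x) (tsupport ψ) :=
    h1.mul_continuousOn h.smooth.continuous.continuousOn h.compact
  have h3 : Integrable (fun x => G x * ψ x) := by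
    rwa [integrableOn_iff_integrable_of_support_subset] at h2
    exact (Function.support_mul_subset_right _ _).trans (subset_tsupport ψ)
  exact h3.integrableOn

theorem isWeakGrad_zero (Ω : Set Plane) : IsWeakGrad Ω (0 : L2) 0 := fun i j =>
  ⟨(locallyIntegrable_zero).locallyIntegrableOn _, fun ψ _ => by
    rw [integral_coord_zero]; simp⟩

theorem IsWeakGrad.add {Ω : Set Plane} {φ φ' : L2} {G G' : Plane → Fin 2 → Fin 2 → ℝ}
    (h : IsWeakGrad Ω φ G) (h' : IsWeakGrad Ω φ' G') :
    IsWeakGrad Ω (φ + φ' : L2) (G + G') := fun i j =>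
  ⟨(h i j).1.add (h' i j).1, fun ψ hψ => by
    rw [integral_coord_add _ _ _ (continuous_pd hψ j) (compact_pd hψ j), (h i j).2 ψ hψ,
      (h' i j).2 ψ hψ, ← neg_add,
      ← integral_add (integrable_grad (h i j).1 hψ) (integrable_grad (h' i j).1 hψ)]
    simp [add_mul]⟩

theorem IsWeakGrad.smul {Ω : Set Plane} (c : ℝ) {φ : L2} {G : Plane → Fin 2 → Fin 2 → ℝ}
    (h : IsWeakGrad Ω φ G) : IsWeakGrad Ω (c • φ : L2) (c • G) := fun i j =>
  ⟨(h i j).1.smul c, fun ψ hψ => by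
    rw [integral_coord_smul, (h i j).2 ψ hψ, mul_neg, ← integral_const_mul]
    simp [mul_assoc]⟩

/-! ### The function spaces -/

/-- The space `𝓗`: square integrable fields with `div φ = 0` in the plane and `D(φ) = 0` in the
(interior of the) solid. -/
def spaceH (S : Set Plane) : Submodule ℝ L2 where
  carrier := {φ | DivFree φ ∧ StrainFree (interior S) φ}
  zero_mem' := by
    constructor
    · intro ψ _
      have := fun i => integral_coord_zero i (pd i ψ) univ
      simp only [Measure.restrict_univ] at this
      simp only [this, Finset.sum_const_zero]
    · intro ψ _ i j
      have := fun i j => integral_coord_zero i (pd j ψ) univ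
      simp only [Measure.restrict_univ] at this
      simp only [this, add_zero]
  add_mem' := by
    rintro φ φ' ⟨h1, h2⟩ ⟨h1', h2'⟩
    constructor
    · intro ψ hψ
      have := fun i =>
        integral_coord_add φ φ' i (continuous_pd hψ i) (compact_pd hψ i) univ
      simp only [Measure.restrict_univ] at this
      simp only [this, Finset.sum_add_distrib, h1 ψ hψ, h1' ψ hψ, add_zero]
    · intro ψ hψ i j
      have := fun i j =>
        integral_coord_add φ φ' i (continuous_pd hψ j) (compact_pd hψ j) univ
      simp only [Measure.restrict_univ] at this
      rw [this, this]
      linarith [h2 ψ hψ i j, h2' ψ hψ i j]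
  smul_mem' := by
    rintro c φ ⟨h1, h2⟩
    constructor
    · intro ψ hψ
      have := fun i => integral_coord_smul c φ i (pd i ψ) univ
      simp only [Measure.restrict_univ] at this
      simp only [this, ← Finset.mul_sum, h1 ψ hψ, mul_zero]
    · intro ψ hψ i j
      have := fun i j => integral_coord_smul c φ i (pd j ψ) univ
      simp only [Measure.restrict_univ] at this
      rw [this, this, ← mul_add, h2 ψ hψ i j, mul_zero]

/-- The fields in `𝓗` which have, in the fluid domain `Sᶜ`, a weak gradient `∇φ` with
`∫ |∇φ(y)|² κ(y)² dy < ∞`. -/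
def weightedSpace (S : Set Plane) (κ : Plane → ℝ) : Submodule ℝ L2 where
  carrier := {φ | φ ∈ spaceH S ∧ ∃ G, IsWeakGrad Sᶜ φ G ∧
    ∀ i j, MemLp (fun y => κ y * G y i j) 2 (volume.restrict Sᶜ)}
  zero_mem' := ⟨(spaceH S).zero_mem, 0, isWeakGrad_zero _, fun i j => by simp⟩
  add_mem' := by
    rintro φ φ' ⟨h, G, hG, hL⟩ ⟨h', G', hG', hL'⟩
    refine ⟨(spaceH S).add_mem h h', G + G', hG.add hG', fun i j => ?_⟩
    convert (hL i j).add (hL' i j) using 1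
    ext y
    simp [mul_add]
  smul_mem' := by
    rintro c φ ⟨h, G, hG, hL⟩
    refine ⟨(spaceH S).smul_mem c h, c • G, hG.smul c, fun i j => ?_⟩
    convert (hL i j).const_smul c using 1
    ext y
    simp [mul_left_comm]

/-- The space `𝓥` with a bar below: `∫ |∇φ|² < ∞` over the fluid domain. -/
def spaceVlow (S : Set Plane) : Submodule ℝ L2 := weightedSpace S fun _ => 1

/-- The space `𝓥`: `∫ |∇φ(y)|² (1 + |y|²) dy < ∞` over the fluid domain. -/
noncomputable def spaceV (S : Set Plane) : Submodule ℝ L2 :=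
  weightedSpace S fun y => Real.sqrt (1 + ‖y‖ ^ 2)

/-- `K` is a Lipschitz constant, on the closure of the fluid domain, of a representative of `φ`. -/
def HasLipConst (S : Set Plane) (φ : Plane → Plane) (K : ℝ) : Prop :=
  0 ≤ K ∧ ∃ g : Plane → Plane,
    (∀ x ∈ closure Sᶜ, ∀ y ∈ closure Sᶜ, ‖g x - g y‖ ≤ K * ‖x - y‖) ∧
      φ =ᵐ[volume.restrict Sᶜ] g

/-- The space `𝓥` with a hat: the fields in `𝓥` that are Lipschitz on the closure of the fluid
domain. -/
noncomputable def spaceVhat (S : Set Plane) : Submodule ℝ L2 where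
  carrier := {φ | φ ∈ spaceV S ∧ ∃ K, HasLipConst S φ K}
  zero_mem' := ⟨(spaceV S).zero_mem, 0, le_rfl, 0, by simp,
    ae_restrict_of_ae (Lp.coeFn_zero Plane 2 volume)⟩
  add_mem' := by
    rintro φ φ' ⟨h, K, hK, g, hg, he⟩ ⟨h', K', hK', g', hg', he'⟩
    refine ⟨(spaceV S).add_mem h h', K + K', add_nonneg hK hK', g + g', fun x hx y hy => ?_, ?_⟩
    · calc ‖(g + g') x - (g + g') y‖ = ‖(g x - g y) + (g' x - g' y)‖ := by
            simp only [Pi.add_apply]; congr 1; abel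
        _ ≤ ‖g x - g y‖ + ‖g' x - g' y‖ := norm_add_le _ _
        _ ≤ (K + K') * ‖x - y‖ := by
            rw [add_mul]; exact add_le_add (hg x hx y hy) (hg' x hx y hy)
    · filter_upwards [ae_restrict_of_ae (Lp.coeFn_add φ φ'), he, he'] with x hx h1 h2
      simp only [hx, Pi.add_apply, h1, h2]
  smul_mem' := by
    rintro c φ ⟨h, K, hK, g, hg, he⟩
    refine ⟨(spaceV S).smul_mem c h, |c| * K, by positivity, c • g, fun x hx y hy => ?_, ?_⟩
    · rw [Pi.smul_apply, Pi.smul_apply, ← smul_sub, norm_smul, Real.norm_eq_abs, mul_assoc]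
      exact mul_le_mul_of_nonneg_left (hg x hx y hy) (abs_nonneg c)
    · filter_upwards [ae_restrict_of_ae (Lp.coeFn_smul c φ), he] with x hx h1
      simp [hx, h1]

/-! ### The rigid part and the norms -/

open Classical in
/-- The pair `(ℓ_φ, r_φ)` with `φ(x) = ℓ_φ + r_φ x^⊥` in the solid. -/
noncomputable def rigidPart (S : Set Plane) (φ : Plane → Plane) : Plane × ℝ :=
  if h : ∃ p : Plane × ℝ, ∀ᵐ x ∂volume.restrict S, φ x = rigidField p x then h.choose else 0

/-- `ℓ_φ`. -/
noncomputable def ell (S : Set Plane) (φ : Plane → Plane) : Plane := (rigidPart S φ).1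

/-- `r_φ`. -/
noncomputable def rot (S : Set Plane) (φ : Plane → Plane) : ℝ := (rigidPart S φ).2

/-- `φ_𝓢`, the rigid field `x ↦ ℓ_φ + r_φ x^⊥`, on the whole plane. -/
noncomputable def solidPart (S : Set Plane) (φ : Plane → Plane) : Plane → Plane :=
  rigidField (rigidPart S φ)

/-- The inner product of `𝓗`, for a solid with mass `m` and moment of inertia `J`. -/
noncomputable def innerH (S : Set Plane) (m J : ℝ) (φ ψ : Plane → Plane) : ℝ :=
  (∫ x in Sᶜ, inner ℝ (φ x) (ψ x)) + m * inner ℝ (ell S φ) (ell S ψ) + J * (rot S φ * rot S ψ)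

/-- The norm of `𝓗`. -/
noncomputable def normH (S : Set Plane) (m J : ℝ) (φ : Plane → Plane) : ℝ :=
  Real.sqrt (innerH S m J φ φ)

/-- The squared Frobenius norm `|∇φ(y)|²` in the fluid domain. -/
noncomputable def gradSq (S : Set Plane) (φ : Plane → Plane) (y : Plane) : ℝ :=
  ∑ i, ∑ j, weakGrad Sᶜ φ y i j ^ 2

/-- The norm of the space `spaceVlow`. -/
noncomputable def normVlow (S : Set Plane) (m J : ℝ) (φ : Plane → Plane) : ℝ :=
  normH S m J φ + Real.sqrt (∫ y in Sᶜ, gradSq S φ y)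

/-- The norm of `𝓥`. -/
noncomputable def normV (S : Set Plane) (m J : ℝ) (φ : Plane → Plane) : ℝ :=
  normH S m J φ + Real.sqrt (∫ y in Sᶜ, gradSq S φ y * (1 + ‖y‖ ^ 2))

/-- The Lipschitz norm on the closure of the fluid domain: supremum plus best Lipschitz
constant. -/
noncomputable def lipNorm (S : Set Plane) (φ : Plane → Plane) : ℝ :=
  (eLpNorm φ ∞ (volume.restrict Sᶜ)).toReal + sInf {K | HasLipConst S φ K}

/-- The norm of the space `spaceVhat`. -/
noncomputable def normVhat (S : Set Plane) (m J : ℝ) (φ : Plane → Plane) : ℝ :=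
  normV S m J φ + lipNorm S φ

/-! ### The forms -/

/-- The integrand `[((u - u_𝓢) · ∇) w] · v - r_u v^⊥ · w` of the form `b`. -/
noncomputable def bIntegrand (S : Set Plane) (u v w : Plane → Plane) (x : Plane) : ℝ :=
  (∑ i, ∑ j, (u x j - solidPart S u x j) * weakGrad Sᶜ w x i j * v x i)
    - rot S u * inner ℝ (perp (v x)) (w x)

/-- The expression defining `b(u, v, w)`, with the integral taken over `A`. -/
noncomputable def bOn (S A : Set Plane) (m : ℝ) (u v w : Plane → Plane) : ℝ :=
  (∫ x in A, bIntegrand S u v w x) - m * rot S u * inner ℝ (perp (ell S v)) (ell S w)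

/-- The form `b(u, v, w)`. -/
noncomputable def bForm (S : Set Plane) (m : ℝ) (u v w : Plane → Plane) : ℝ :=
  bOn S Sᶜ m u v w

/-- Arc length on the boundary of the solid. -/
noncomputable def arcLength (S : Set Plane) : Measure Plane :=
  (Measure.hausdorffMeasure 1 : Measure Plane).restrict (frontier S)

/-- `γ` is the trace on the boundary of the solid of the restriction of `φ` to the fluid domain:
the limit in `L²` of the boundary of the boundary values of smooth compactly supported fields that
converge to `φ` in `H¹` of the fluid domain. -/
def IsTrace (S : Set Plane) (φ γ : Plane → Plane) : Prop :=
  MemLp γ 2 (arcLength S) ∧ ∃ f : ℕ → Plane → Plane,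
    (∀ n, ContDiff ℝ ∞ (f n) ∧ HasCompactSupport (f n)) ∧
    Tendsto (fun n => eLpNorm (fun x => f n x - φ x) 2 (volume.restrict Sᶜ)) atTop (𝓝 0) ∧
    (∀ i j, Tendsto (fun n =>
      eLpNorm (fun x => pd j (fun y => f n y i) x - weakGrad Sᶜ φ x i j) 2
        (volume.restrict Sᶜ)) atTop (𝓝 0)) ∧
    Tendsto (fun n => eLpNorm (fun x => f n x - γ x) 2 (arcLength S)) atTop (𝓝 0)

open Classical in
/-- The trace on the boundary of the solid, from the side of the fluid. -/
noncomputable def trace (S : Set Plane) (φ : Plane → Plane) : Plane → Plane :=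
  if h : ∃ γ, IsTrace S φ γ then h.choose else 0

/-- The entries of the deformation tensor `D(φ)` in the fluid domain. -/
noncomputable def strain (S : Set Plane) (φ : Plane → Plane) (x : Plane) (i j : Fin 2) : ℝ :=
  (weakGrad Sᶜ φ x i j + weakGrad Sᶜ φ x j i) / 2

/-- The boundary integrand `(u - u_𝓢) · (v - v_𝓢)` of the form `a`. -/
noncomputable def aBoundary (S : Set Plane) (u v : Plane → Plane) (x : Plane) : ℝ :=
  inner ℝ (trace S u x - solidPart S u x) (trace S v x - solidPart S v x)

/-- The integrand `D(u) : D(v)` of the form `a`. -/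
noncomputable def aInterior (S : Set Plane) (u v : Plane → Plane) (x : Plane) : ℝ :=
  ∑ i, ∑ j, strain S u x i j * strain S v x i j

/-- The form `a(u, v)`. -/
noncomputable def aForm (S : Set Plane) (α : ℝ) (u v : Plane → Plane) : ℝ :=
  -α * (∫ x, aBoundary S u v x ∂arcLength S) - ∫ x in Sᶜ, aInterior S u v x

end FluidBody

/-! The bounds on `b` are Hölder inequalities. The term quadratic in u and v is estimated as
L⁴·L²·L⁴ by Ladyzhenskaya's embedding of H¹ of the exterior domain into L⁴
(`ConePartition.exists_eLpNorm_four_le`), or as L²·L^∞·L² when w is Lipschitz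
(`HasLipConst.abs_grad_le`). The rigid velocity u_S grows linearly, and this growth is what the
weight in the norm of 𝓥 pays for (`abs_solidPart_le`). For `a` a trace inequality is needed as well.

The embedding, the trace inequality and the density of smooth functions behind both rest on one
geometric device, without an extension operator. Near a boundary point the solid is a Lipschitz
subgraph, so a fluid point moved inside a suitable cone stays in the fluid
(`IsChart.coneCondition`); a finite partition of unity reduces everything to such pieces
(`IsBody.exists_conePartition`). Mollification with kernels supported in the cone only samples the
field inside the domain, which gives density (`ConePartition.approx`). For smooth h, integrating the
derivative of h² along a ray bounds h(x)² by the integral of |h||∇h| over that ray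
(`sq_le_lintegral_ray`). Two independent directions multiply to the L⁴ bound, and rays issuing from
the boundary give the trace bound (`IsChart.exists_trace_bound`).

For b(u,v,v) = 0, the field u is divergence free in the whole plane and equals u_S in the solid.
Hence u - u_S, restricted to the fluid, is orthogonal to the gradient of every test function of the
plane, whatever its values on the boundary (`IsBody.integral_relative_eq_zero`). Testing with χ|v|²
leaves only the flux through the region where χ varies. The difficulty is at infinity: for v in the
larger space the contribution of r x^⊥ need not be integrable. Writing u - u_S = (u - ℓ) - r x^⊥,
the first part is integrable with v, while a rotation does not see radial cut-offs, so its truncated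
integral is one and the same constant for all large radii (`IsBody.setIntegral_convection_perp`).
The flux of the first part is O(1/N), and in the limit the two parts cancel
(`IsBody.integral_convection_translated`). Antisymmetry follows by polarization.

Multilinearity requires that the chosen objects be unique. For weak gradients and traces this is
uniqueness almost everywhere. For the rigid part, existence is the point: a field without strain is
locally rigid by mollification, and the connectedness of the solid makes the local rigid motions
agree (`IsBody.exists_rigid`). -/

namespace FluidBody

/-! ### Mollification -/

/-- A mollification kernel: smooth, nonnegative, compactly supported, of total mass one. -/
structure IsKernel (ρ : Plane → ℝ) : Prop where
  smooth : ContDiff ℝ ∞ ρ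
  compact : HasCompactSupport ρ
  nonneg : ∀ x, 0 ≤ ρ x
  integral_eq : ∫ x, ρ x = 1

/-- The average `x ↦ ∫ ρ(z - x) g(z) dz`. -/
noncomputable def moll (ρ : Plane → ℝ) (g : Plane → ℝ) (x : Plane) : ℝ := ∫ z, ρ (z - x) * g z

theorem moll_eq_convolution (ρ g : Plane → ℝ) :
    moll ρ g = convolution g (fun y => ρ (-y)) (ContinuousLinearMap.mul ℝ ℝ) volume := by
  ext x
  simp [moll, convolution, mul_comm]

theorem IsKernel.smooth_neg {ρ : Plane → ℝ} (hρ : IsKernel ρ) : ContDiff ℝ ∞ fun y => ρ (-y) :=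
  hρ.smooth.comp contDiff_neg

theorem IsKernel.compact_neg {ρ : Plane → ℝ} (hρ : IsKernel ρ) :
    HasCompactSupport fun y => ρ (-y) :=
  hρ.compact.comp_homeomorph (Homeomorph.neg Plane)

theorem contDiff_moll {ρ g : Plane → ℝ} (hρ : IsKernel ρ) (hg : LocallyIntegrable g) :
    ContDiff ℝ ∞ (moll ρ g) := by
  rw [moll_eq_convolution]
  exact hρ.compact_neg.contDiff_convolution_right (n := ⊤) _ hg hρ.smooth_neg

theorem hasCompactSupport_moll {ρ g : Plane → ℝ} (hρ : IsKernel ρ) (hg : HasCompactSupport g) :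
    HasCompactSupport (moll ρ g) := by
  rw [moll_eq_convolution]
  exact HasCompactSupport.convolution _ hg hρ.compact_neg

/-- The derivative falls on the kernel, with a sign because x enters through z - x. The right-hand
side is then a distributional pairing of g with the test function z ↦ ρ(z - x), so distributional
identities for g become pointwise ones for its average. -/
theorem pd_moll {ρ g : Plane → ℝ} (hρ : IsKernel ρ) (hg : LocallyIntegrable g) (j : Fin 2)
    (x : Plane) : pd j (moll ρ g) x = -∫ z, pd j ρ (z - x) * g z := by
  have h1 : ContDiff ℝ 1 (fun y => ρ (-y)) := hρ.smooth_neg.of_le (by simp)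
  have h := (hρ.compact_neg.hasFDerivAt_convolution_right (ContinuousLinearMap.mul ℝ ℝ) hg h1 x)
  rw [← moll_eq_convolution] at h
  rw [pd, h.fderiv]
  have hd : ∀ y, fderiv ℝ (fun y => ρ (-y)) y = -fderiv ℝ ρ (-y) := fun y => by
    have := ((hρ.smooth.differentiable (by simp)) (-y)).hasFDerivAt.comp y
      (hasFDerivAt_id (𝕜 := ℝ) y).neg
    ext v
    simpa [Function.comp_def] using congrArg (fun T : Plane →L[ℝ] ℝ => T v) (HasFDerivAt.fderiv this)
  have hint := (hρ.compact_neg.fderiv (𝕜 := ℝ)).convolutionExists_right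
    ((ContinuousLinearMap.mul ℝ ℝ).precompR Plane) hg (h1.continuous_fderiv (by simp)) x
  rw [convolution, ContinuousLinearMap.integral_apply hint, ← integral_neg]
  congr 1
  ext z
  simp [hd, pd, ContinuousLinearMap.precompR, mul_comm]

theorem IsKernel.integrable {ρ : Plane → ℝ} (hρ : IsKernel ρ) : Integrable ρ :=
  hρ.smooth.continuous.integrable_of_hasCompactSupport hρ.compact

theorem IsKernel.lintegral_eq {ρ : Plane → ℝ} (hρ : IsKernel ρ) : ∫⁻ x, ‖ρ x‖ₑ = 1 := by
  have := ofReal_integral_eq_lintegral_ofReal hρ.integrable (ae_of_all _ hρ.nonneg)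
  rw [hρ.integral_eq] at this
  simp only [Real.enorm_of_nonneg (hρ.nonneg _)]
  simpa using this.symm

theorem moll_eq_shift (ρ g : Plane → ℝ) (x : Plane) : moll ρ g x = ∫ y, ρ y * g (x + y) := by
  rw [moll, ← integral_add_left_eq_self _ x]
  simp

/-- The square of an average is at most the average of the squares. -/
theorem sq_lintegral_le {α : Type*} [MeasurableSpace α] {μ : Measure α} {f g : α → ℝ≥0∞}
    (hf : AEMeasurable f μ) (hg : AEMeasurable g μ) (h1 : ∫⁻ x, f x ∂μ = 1) :
    (∫⁻ x, f x * g x ∂μ) ^ 2 ≤ ∫⁻ x, f x * g x ^ 2 ∂μ := by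
  -- Cauchy–Schwarz for the splitting f g = f^{1/2} · (f^{1/2} g); the first factor has L² norm one.
  have h := ENNReal.lintegral_mul_le_Lp_mul_Lq μ Real.HolderConjugate.two_two
    (hf.pow_const (1 / 2 : ℝ)) ((hf.pow_const (1 / 2 : ℝ)).mul hg)
  have e1 : ∀ x, f x ^ (1 / 2 : ℝ) * (f x ^ (1 / 2 : ℝ) * g x) = f x * g x := fun x => by
    rw [← mul_assoc, ← ENNReal.rpow_add_of_nonneg _ _ (by norm_num) (by norm_num)]
    norm_num
  have e2 : ∀ x, (f x ^ (1 / 2 : ℝ)) ^ (2 : ℝ) = f x := fun x => by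
    rw [← ENNReal.rpow_mul]; norm_num
  have e3 : ∀ x, (f x ^ (1 / 2 : ℝ) * g x) ^ (2 : ℝ) = f x * g x ^ 2 := fun x => by
    rw [ENNReal.mul_rpow_of_nonneg _ _ (by norm_num), e2]; norm_num
  simp only [Pi.mul_apply, e1, e2, e3, h1, ENNReal.one_rpow, one_mul] at h
  calc _ ≤ ((∫⁻ x, f x * g x ^ 2 ∂μ) ^ (1 / 2 : ℝ)) ^ 2 := by gcongr
    _ = _ := by rw [← ENNReal.rpow_natCast, ← ENNReal.rpow_mul]; norm_num

theorem eLpNorm_two_sq {α : Type*} [MeasurableSpace α] {μ : Measure α} {E : Type*}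
    [NormedAddCommGroup E] (f : α → E) :
    eLpNorm f 2 μ ^ 2 = ∫⁻ x, ‖f x‖ₑ ^ 2 ∂μ := by
  have := eLpNorm_nnreal_pow_eq_lintegral (μ := μ) (f := f) (p := 2) (by norm_num)
  simpa using this

/-- Mollification is close to the identity in `L²` when small translations are. -/
theorem eLpNorm_moll_sub_le {ρ g : Plane → ℝ} (hρ : IsKernel ρ) (hg : MemLp g 2) {ε : ℝ≥0∞}
    (h : ∀ y, ρ y ≠ 0 → eLpNorm (fun x => g (x + y) - g x) 2 volume ≤ ε) :
    eLpNorm (fun x => moll ρ g x - g x) 2 volume ≤ ε := by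
  have hgl : LocallyIntegrable g := hg.locallyIntegrable (by norm_num)
  have hmp : ∀ x : Plane, MeasurePreserving (fun y => x + y) (volume : Measure Plane) volume :=
    fun x => measurePreserving_add_left volume x
  have hmq : ∀ x : Plane, MeasurePreserving (fun y => y + x) (volume : Measure Plane) volume :=
    fun x => measurePreserving_add_right volume x
  have hpt : ∀ x, ‖moll ρ g x - g x‖ₑ ^ 2 ≤ ∫⁻ y, ‖ρ y‖ₑ * ‖g (x + y) - g x‖ₑ ^ 2 := by
    intro x
    have hgx : LocallyIntegrable (fun y => g (x + y)) := by
      have : MemLp (fun y => g (x + y)) 2 (volume : Measure Plane) := hg.comp_measurePreserving (hmp x)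
      exact this.locallyIntegrable (by norm_num)
    have i1 : Integrable (fun y => ρ y * g (x + y)) := by
      simpa using hgx.integrable_smul_left_of_hasCompactSupport hρ.smooth.continuous hρ.compact
    -- The kernel has mass one, so g x may be moved under the integral.
    have e : moll ρ g x - g x = ∫ y, ρ y * (g (x + y) - g x) := by
      simp only [mul_sub]
      rw [integral_sub i1 (hρ.integrable.mul_const _), integral_mul_const, hρ.integral_eq, one_mul,
        moll_eq_shift]
    rw [e]
    calc _ ≤ (∫⁻ y, ‖ρ y * (g (x + y) - g x)‖ₑ) ^ 2 := by
          gcongr; exact enorm_integral_le_lintegral_enorm _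
      _ = (∫⁻ y, ‖ρ y‖ₑ * ‖g (x + y) - g x‖ₑ) ^ 2 := by simp only [enorm_mul]
      _ ≤ _ := sq_lintegral_le hρ.smooth.continuous.aestronglyMeasurable.enorm
          (hgx.aestronglyMeasurable.sub aestronglyMeasurable_const).enorm hρ.lintegral_eq
  have hsq : eLpNorm (fun x => moll ρ g x - g x) 2 volume ^ 2 ≤ ε ^ 2 := by
    rw [eLpNorm_two_sq]
    calc _ ≤ ∫⁻ x, ∫⁻ y, ‖ρ y‖ₑ * ‖g (x + y) - g x‖ₑ ^ 2 := lintegral_mono hpt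
      _ = ∫⁻ y, ∫⁻ x, ‖ρ y‖ₑ * ‖g (x + y) - g x‖ₑ ^ 2 := by
          apply lintegral_lintegral_swap
          have h1 : AEStronglyMeasurable (fun p : Plane × Plane => g (p.1 + p.2))
              ((volume : Measure Plane).prod volume) :=
            hg.1.comp_quasiMeasurePreserving
              (quasiMeasurePreserving_add (volume : Measure Plane) volume)
          have h2 : AEStronglyMeasurable (fun p : Plane × Plane => g p.1)
              ((volume : Measure Plane).prod volume) := hg.1.comp_fst
          have h3 : AEStronglyMeasurable (fun p : Plane × Plane => ρ p.2)
              ((volume : Measure Plane).prod volume) :=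
            hρ.smooth.continuous.aestronglyMeasurable.comp_snd
          exact h3.enorm.mul ((h1.sub h2).enorm.pow_const 2)
      _ = ∫⁻ y, ‖ρ y‖ₑ * eLpNorm (fun x => g (x + y) - g x) 2 volume ^ 2 := by
          congr 1; ext y
          rw [lintegral_const_mul', eLpNorm_two_sq]
          simp
      _ ≤ ∫⁻ y, ‖ρ y‖ₑ * ε ^ 2 := by
          refine lintegral_mono fun y => ?_
          by_cases hy : ρ y = 0
          · simp [hy]
          · dsimp only; gcongr; exact h y hy
      _ = ε ^ 2 := by
          rw [lintegral_mul_const'' _ hρ.smooth.continuous.aestronglyMeasurable.enorm,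
            hρ.lintegral_eq, one_mul]
  exact (ENNReal.pow_le_pow_left_iff two_ne_zero).1 hsq

/-- Translations act continuously on `L²`. -/
theorem tendsto_translate {g : Plane → ℝ} (hg : MemLp g 2) :
    Tendsto (fun y => eLpNorm (fun x => g (x + y) - g x) 2 volume) (𝓝 0) (𝓝 0) := by
  let τ : Plane → C(Plane, Plane) := fun y => ⟨fun x => x + y, by fun_prop⟩
  have hτ : ∀ y, MeasurePreserving (τ y) (volume : Measure Plane) volume :=
    fun y => measurePreserving_add_right volume y
  have hτc : Continuous τ :=
    (ContinuousMap.curry ⟨fun p : Plane × Plane => p.2 + p.1, by fun_prop⟩).continuous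
  have hc : Continuous fun y => Lp.compMeasurePreserving (τ y) (hτ y) (hg.toLp g) :=
    continuous_const.compMeasurePreservingLp hτc hτ (by norm_num)
  have h := (hc.tendsto 0)
  rw [Lp.tendsto_Lp_iff_tendsto_eLpNorm'] at h
  refine h.congr fun y => ?_
  apply eLpNorm_congr_ae
  have hz : ∀ y, Lp.compMeasurePreserving (τ y) (hτ y) (hg.toLp g) =ᵐ[volume] fun x => g (x + y) :=
    fun y => (Lp.coeFn_compMeasurePreserving _ (hτ y)).trans
      ((hτ y).quasiMeasurePreserving.ae_eq_comp hg.coeFn_toLp)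
  filter_upwards [hz y, hz 0] with x h1 h2
  simp only [Pi.sub_apply, h1, h2, add_zero]

/-- Only translations by points of the support of the kernel matter, and these become small in L² as
the supports shrink to the origin. -/
theorem tendsto_moll {ρ : ℕ → Plane → ℝ} (hρ : ∀ n, IsKernel (ρ n))
    (hs : ∀ δ > 0, ∀ᶠ n in atTop, ∀ y, ρ n y ≠ 0 → ‖y‖ < δ) {g : Plane → ℝ} (hg : MemLp g 2) :
    Tendsto (fun n => eLpNorm (fun x => moll (ρ n) g x - g x) 2 volume) atTop (𝓝 0) := by
  rw [ENNReal.tendsto_nhds_zero]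
  intro ε hε
  have h := (ENNReal.tendsto_nhds_zero.1 (tendsto_translate hg)) ε hε
  obtain ⟨δ, hδ, hb⟩ := Metric.eventually_nhds_iff.1 h
  filter_upwards [hs δ hδ] with n hn
  exact eLpNorm_moll_sub_le (hρ n) hg fun y hy => hb (by simpa using hn y hy)

/-- The open cone spanned by two vectors. -/
def cone (a b : Plane) : Set Plane := {y | ∃ s t : ℝ, 0 < s ∧ 0 < t ∧ y = s • a + t • b}

/-- Kernels with shrinking supports inside a given open cone. -/
theorem exists_kernels {a b : Plane} (hab : ∃ ε > 0, Metric.ball (a + b) ε ⊆ cone a b) :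
    ∃ ρ : ℕ → Plane → ℝ, (∀ n, IsKernel (ρ n)) ∧ (∀ n, tsupport (ρ n) ⊆ cone a b) ∧
      (∀ δ > 0, ∀ᶠ n in atTop, ∀ y, y ∈ tsupport (ρ n) → ‖y‖ < δ) := by
  obtain ⟨ε, hε, hball⟩ := hab
  let l : ℕ → ℝ := fun n => 1 / ((n : ℝ) + 1)
  have hl : ∀ n, 0 < l n := fun n => by positivity
  -- The bump lives in the ball of radius ε/2 around a + b, scaled by l n; it stays in the cone
  -- because cones are invariant under positive scaling.
  let B : ∀ n, ContDiffBump (l n • (a + b)) := fun n =>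
    ⟨l n * (ε / 4), l n * (ε / 2), by have := hl n; positivity,
      by have := hl n; nlinarith⟩
  have hsupp : ∀ n, tsupport ((B n).normed volume) = Metric.closedBall (l n • (a + b)) (l n * (ε / 2)) :=
    fun n => (B n).tsupport_normed_eq
  refine ⟨fun n => (B n).normed volume, fun n => ⟨(B n).contDiff_normed,
    (B n).hasCompactSupport_normed, (B n).nonneg_normed, (B n).integral_normed⟩, fun n => ?_, ?_⟩
  · rw [hsupp n]
    intro y hy
    have h1 : (l n)⁻¹ • y ∈ Metric.ball (a + b) ε := by
      rw [Metric.mem_ball, dist_eq_norm]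
      rw [Metric.mem_closedBall, dist_eq_norm] at hy
      have : (l n)⁻¹ • y - (a + b) = (l n)⁻¹ • (y - l n • (a + b)) := by
        rw [smul_sub, smul_smul, inv_mul_cancel₀ (hl n).ne', one_smul]
      rw [this, norm_smul, Real.norm_of_nonneg (by have := hl n; positivity)]
      calc _ ≤ (l n)⁻¹ * (l n * (ε / 2)) := by gcongr
        _ = ε / 2 := by field_simp [(hl n).ne']
        _ < ε := by linarith
    obtain ⟨s, t, hs, ht, e⟩ := hball h1
    refine ⟨l n * s, l n * t, mul_pos (hl n) hs, mul_pos (hl n) ht, ?_⟩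
    rw [mul_smul, mul_smul, ← smul_add, ← e, smul_smul, mul_inv_cancel₀ (hl n).ne', one_smul]
  · intro δ hδ
    have ht : Tendsto (fun n => l n * (‖a + b‖ + ε)) atTop (𝓝 0) := by
      simpa only [zero_mul] using tendsto_one_div_add_atTop_nhds_zero_nat.mul_const (‖a + b‖ + ε)
    filter_upwards [ht.eventually (gt_mem_nhds hδ)] with n hn y hy
    rw [hsupp n, Metric.mem_closedBall, dist_eq_norm] at hy
    have h1 : ‖y‖ ≤ ‖y - l n • (a + b)‖ + ‖l n • (a + b)‖ := by
      simpa using norm_add_le (y - l n • (a + b)) (l n • (a + b))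
    rw [norm_smul, Real.norm_of_nonneg (hl n).le] at h1
    nlinarith [hl n]

/-! ### Density of smooth functions -/

/-- The scalar function `φ` has the weak gradient `G` in `Ω`. -/
def HasWeakGrad (Ω : Set Plane) (φ : Plane → ℝ) (G : Fin 2 → Plane → ℝ) : Prop :=
  ∀ j, ∀ ψ, IsTest Ω ψ → ∫ x in Ω, φ x * pd j ψ x = -∫ x in Ω, G j x * ψ x

/-- `φ` is the limit in `H¹(Ω)` of restrictions of smooth compactly supported functions, and `G` is
the limit of the gradients. -/
def Approx (Ω : Set Plane) (φ : Plane → ℝ) (G : Fin 2 → Plane → ℝ) : Prop :=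
  ∀ ε : ℝ≥0∞, ε ≠ 0 → ∃ f : Plane → ℝ, ContDiff ℝ ∞ f ∧ HasCompactSupport f ∧
    eLpNorm (fun x => f x - φ x) 2 (volume.restrict Ω) ≤ ε ∧
    ∀ j, eLpNorm (fun x => pd j f x - G j x) 2 (volume.restrict Ω) ≤ ε

theorem pd_add {f g : Plane → ℝ} (hf : Differentiable ℝ f) (hg : Differentiable ℝ g) (j : Fin 2)
    (x : Plane) : pd j (fun y => f y + g y) x = pd j f x + pd j g x := by
  simp [pd, fderiv_fun_add (hf x) (hg x)]

theorem pd_sub {f g : Plane → ℝ} (hf : Differentiable ℝ f) (hg : Differentiable ℝ g) (j : Fin 2)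
    (x : Plane) : pd j (fun y => f y - g y) x = pd j f x - pd j g x := by
  simp [pd, fderiv_fun_sub (hf x) (hg x)]

theorem pd_mul {f g : Plane → ℝ} (hf : Differentiable ℝ f) (hg : Differentiable ℝ g) (j : Fin 2)
    (x : Plane) : pd j (fun y => f y * g y) x = f x * pd j g x + g x * pd j f x := by
  simp [pd, fderiv_fun_mul (hf x) (hg x)]

theorem pd_const_mul {f : Plane → ℝ} (hf : Differentiable ℝ f) (c : ℝ) (j : Fin 2)
    (x : Plane) : pd j (fun y => c * f y) x = c * pd j f x := by
  simp [pd, fderiv_const_mul (hf x)]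

theorem _root_.ContDiff.differentiable_infty {f : Plane → ℝ} (hf : ContDiff ℝ ∞ f) : Differentiable ℝ f :=
  hf.differentiable (by simp)

theorem isTest_univ {f : Plane → ℝ} (hf : ContDiff ℝ ∞ f) (hc : HasCompactSupport f) :
    IsTest univ f := ⟨hf, hc, subset_univ _⟩

theorem contDiff_pd {f : Plane → ℝ} (hf : ContDiff ℝ ∞ f) (j : Fin 2) : ContDiff ℝ ∞ (pd j f) :=
  (hf.fderiv_right (m := ∞) (by simp)).clm_apply contDiff_const

theorem pd_eq_zero_of_notMem {f : Plane → ℝ} {x : Plane} (hx : x ∉ tsupport f) (j : Fin 2) :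
    pd j f x = 0 := by
  rw [pd, fderiv_of_notMem_tsupport ℝ hx]; rfl

theorem pd_comp_sub {f : Plane → ℝ} (j : Fin 2) (x z : Plane) :
    pd j (fun y => f (y - x)) z = pd j f (z - x) := by
  rw [pd, pd, fderiv_comp_sub]

/-- Approximability is closed under H¹ limits, by the triangle inequality with ε/2 twice. This is
what removes the cut-off at infinity later. -/
theorem Approx.mono_left {Ω : Set Plane} {φ : Plane → ℝ} {G : Fin 2 → Plane → ℝ}
    (h : ∀ ε : ℝ≥0∞, ε ≠ 0 → ∃ φ' G', Approx Ω φ' G' ∧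
      eLpNorm (fun x => φ' x - φ x) 2 (volume.restrict Ω) ≤ ε ∧
      (∀ j, eLpNorm (fun x => G' j x - G j x) 2 (volume.restrict Ω) ≤ ε) ∧
      AEStronglyMeasurable φ' (volume.restrict Ω) ∧
      ∀ j, AEStronglyMeasurable (G' j) (volume.restrict Ω))
    (hm : AEStronglyMeasurable φ (volume.restrict Ω))
    (hG : ∀ j, AEStronglyMeasurable (G j) (volume.restrict Ω)) : Approx Ω φ G := by
  intro ε hε
  obtain ⟨φ', G', hA, h1, h2, m1, m2⟩ := h (ε / 2) (by simp [hε])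
  obtain ⟨f, hf, hc, h3, h4⟩ := hA (ε / 2) (by simp [hε])
  refine ⟨f, hf, hc, ?_, fun j => ?_⟩
  · have := eLpNorm_add_le (p := 2) (hf.continuous.aestronglyMeasurable.sub m1) (m1.sub hm) (by norm_num)
    rw [sub_add_sub_cancel] at this
    calc _ ≤ _ := this
      _ ≤ ε / 2 + ε / 2 := add_le_add h3 h1
      _ = ε := ENNReal.add_halves ε
  · have := eLpNorm_add_le (p := 2) ((contDiff_pd hf j).continuous.aestronglyMeasurable.sub (m2 j))
      ((m2 j).sub (hG j)) (by norm_num)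
    rw [sub_add_sub_cancel] at this
    calc _ ≤ _ := this
      _ ≤ ε / 2 + ε / 2 := add_le_add (h4 j) (h2 j)
      _ = ε := ENNReal.add_halves ε

theorem Approx.congr {Ω : Set Plane} {φ φ' : Plane → ℝ} {G G' : Fin 2 → Plane → ℝ}
    (h : Approx Ω φ G) (h1 : φ =ᵐ[volume.restrict Ω] φ')
    (h2 : ∀ j, G j =ᵐ[volume.restrict Ω] G' j) : Approx Ω φ' G' := by
  intro ε hε
  obtain ⟨f, hf, hc, h3, h4⟩ := h ε hε
  refine ⟨f, hf, hc, ?_, fun j => ?_⟩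
  · refine (eLpNorm_congr_ae ?_).trans_le h3
    filter_upwards [h1] with x hx; rw [hx]
  · refine (eLpNorm_congr_ae ?_).trans_le (h4 j)
    filter_upwards [h2 j] with x hx; rw [hx]

theorem approx_zero (Ω : Set Plane) : Approx Ω 0 0 := fun ε _ =>
  ⟨0, contDiff_const, HasCompactSupport.zero, by simp, fun j => by
    have : (fun x => pd j (0 : Plane → ℝ) x - (0 : Fin 2 → Plane → ℝ) j x) = 0 := by
      ext x; simp [pd]
    rw [this]; simp⟩

theorem Approx.add {Ω : Set Plane} {φ φ' : Plane → ℝ} {G G' : Fin 2 → Plane → ℝ}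
    (h : Approx Ω φ G) (h' : Approx Ω φ' G') 
    (hm : AEStronglyMeasurable φ (volume.restrict Ω))
    (hG : ∀ j, AEStronglyMeasurable (G j) (volume.restrict Ω))
    (hm' : AEStronglyMeasurable φ' (volume.restrict Ω))
    (hG' : ∀ j, AEStronglyMeasurable (G' j) (volume.restrict Ω)) :
    Approx Ω (fun x => φ x + φ' x) (fun j x => G j x + G' j x) := by
  intro ε hε
  obtain ⟨f, hf, hc, h1, h2⟩ := h (ε / 2) (by simp [hε])
  obtain ⟨f', hf', hc', h1', h2'⟩ := h' (ε / 2) (by simp [hε])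
  refine ⟨fun x => f x + f' x, hf.add hf', hc.add hc', ?_, fun j => ?_⟩
  · have := eLpNorm_add_le (p := 2) (hf.continuous.aestronglyMeasurable.sub hm)
      (hf'.continuous.aestronglyMeasurable.sub hm') (by norm_num)
    calc _ = _ := by congr 1; ext x; simp only [Pi.add_apply, Pi.sub_apply]; ring
      _ ≤ _ := this
      _ ≤ ε / 2 + ε / 2 := add_le_add h1 h1'
      _ = ε := ENNReal.add_halves ε
  · have := eLpNorm_add_le (p := 2) ((contDiff_pd hf j).continuous.aestronglyMeasurable.sub (hG j))
      ((contDiff_pd hf' j).continuous.aestronglyMeasurable.sub (hG' j)) (by norm_num)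
    calc _ = _ := by
          congr 1; ext x
          rw [pd_add hf.differentiable_infty hf'.differentiable_infty]
          simp only [Pi.add_apply, Pi.sub_apply]; ring
      _ ≤ _ := this
      _ ≤ ε / 2 + ε / 2 := add_le_add (h2 j) (h2' j)
      _ = ε := ENNReal.add_halves ε

/-- `C` bounds the smooth function `χ` and its gradient. -/
structure BoundedC1 (χ : Plane → ℝ) : Prop where
  smooth : ContDiff ℝ ∞ χ
  bound : ∃ C, ∀ x, ‖χ x‖ ≤ C
  bound_pd : ∀ j, ∃ C, ∀ x, ‖pd j χ x‖ ≤ C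

theorem boundedC1_of_compact {χ : Plane → ℝ} (h : ContDiff ℝ ∞ χ) (hc : HasCompactSupport χ) :
    BoundedC1 χ :=
  ⟨h, hc.exists_bound_of_continuous h.continuous, fun j =>
    (compact_pd (isTest_univ h hc) j).exists_bound_of_continuous (contDiff_pd h j).continuous⟩

/-- The condition on a cut-off function `χ` that makes it possible to mollify `χ φ` from inside the
domain `Ω`, with kernels supported in the cone spanned by `a` and `b`. -/
def ConeCondition (Ω T : Set Plane) (a b : Plane) : Prop :=
  ∃ δ > 0, ∀ x ∈ Ω, ∀ s t : ℝ, 0 ≤ s → 0 ≤ t → x + (s • a + t • b) ∈ T →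
    (‖s • a + t • b‖ < δ ∨ x ∈ T) → x + (s • a + t • b) ∈ Ω

/-- The extension of χφ by zero has in general no weak gradient across the boundary, so an ordinary
mollification fails. With kernels supported in the cone, the function z ↦ χ(z) ρ(z - x) is supported
inside Ω for every x in Ω, hence admissible in the definition of the weak gradient. Differentiation
therefore commutes with mollification at all points of Ω. -/
theorem approx_mul_of_coneCondition {Ω : Set Plane} (hΩ : IsOpen Ω) {φ : Plane → ℝ}
    {G : Fin 2 → Plane → ℝ} (hw : HasWeakGrad Ω φ G) (hφ : MemLp φ 2 (volume.restrict Ω))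
    (hG : ∀ j, MemLp (G j) 2 (volume.restrict Ω)) {χ : Plane → ℝ} (hχ : ContDiff ℝ ∞ χ)
    (hc : HasCompactSupport χ) {a b : Plane} (hab : ∃ ε > 0, Metric.ball (a + b) ε ⊆ cone a b)
    (hcone : ConeCondition Ω (tsupport χ) a b) :
    Approx Ω (fun x => χ x * φ x) (fun j x => χ x * G j x + φ x * pd j χ x) := by
  have hb := boundedC1_of_compact hχ hc
  obtain ⟨ρ, hρ, hρc, hρ0⟩ := exists_kernels hab
  obtain ⟨δ, hδ, hcone⟩ := hcone
  have mχ : MemLp χ ∞ (volume.restrict Ω) := by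
    obtain ⟨C, hC⟩ := hb.bound
    exact memLp_top_of_bound hχ.continuous.aestronglyMeasurable C (ae_of_all _ hC)
  have mpd : ∀ j, MemLp (pd j χ) ∞ (volume.restrict Ω) := fun j => by
    obtain ⟨C, hC⟩ := hb.bound_pd j
    exact memLp_top_of_bound (contDiff_pd hχ j).continuous.aestronglyMeasurable C (ae_of_all _ hC)
  have mP0 : MemLp (fun x => χ x * φ x) 2 (volume.restrict Ω) := hφ.mul mχ
  have mQ0 : ∀ j, MemLp (fun x => χ x * G j x + φ x * pd j χ x) 2 (volume.restrict Ω) :=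
    fun j => ((hG j).mul mχ).add ((mpd j).mul hφ)
  set P : Plane → ℝ := Ω.indicator fun x => χ x * φ x with hP
  set Q : Fin 2 → Plane → ℝ := fun j => Ω.indicator fun x => χ x * G j x + φ x * pd j χ x with hQ
  have mP : MemLp P 2 := (memLp_indicator_iff_restrict hΩ.measurableSet).2 mP0
  have mQ : ∀ j, MemLp (Q j) 2 := fun j => (memLp_indicator_iff_restrict hΩ.measurableSet).2 (mQ0 j)
  have lP : LocallyIntegrable P := mP.locallyIntegrable (by norm_num)
  have cP : HasCompactSupport P := by
    refine hc.mono fun x hx => ?_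
    rw [Function.mem_support] at hx ⊢
    intro h0
    exact hx (by simp [hP, h0])
  -- Once the kernel is supported in the ball of radius δ, the cone condition applies in its
  -- short-step alternative.
  have hgrad : ∀ᶠ n in atTop, ∀ x ∈ Ω, ∀ j, pd j (moll (ρ n) P) x = moll (ρ n) (Q j) x := by
    filter_upwards [hρ0 δ hδ] with n hn x hx j
    let κ : Plane → ℝ := fun z => ρ n (z - x)
    have hκ : ContDiff ℝ ∞ κ := (hρ n).smooth.comp (contDiff_id.sub contDiff_const)
    have hκc : HasCompactSupport κ := by
      simpa [κ, Function.comp_def, sub_eq_add_neg] using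
        (hρ n).compact.comp_homeomorph (Homeomorph.addRight (-x))
    have hκs : ∀ z ∈ tsupport κ, z - x ∈ tsupport (ρ n) := fun z hz => by
      have := tsupport_comp_subset_preimage (ρ n) (f := fun z : Plane => z - x) (by fun_prop)
      exact this hz
    have htest : IsTest Ω (fun z => χ z * κ z) := by
      refine ⟨hχ.mul hκ, hc.mul_right, fun z hz => ?_⟩
      have hz1 : z ∈ tsupport χ := tsupport_mul_subset_left hz
      have hz2 : z ∈ tsupport κ := tsupport_mul_subset_right hz
      obtain ⟨s, t, hs, ht, e⟩ := hρc n (hκs z hz2)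
      have e' : z = x + (s • a + t • b) := by rw [← e]; abel
      have hlt := hn _ (hκs z hz2)
      rw [e] at hlt
      rw [e'] at hz1 ⊢
      exact hcone x hx s t hs.le ht.le hz1 (Or.inl hlt)
    have hw' := hw j _ htest
    have hi1 : IntegrableOn (fun z => φ z * (χ z * pd j κ z)) Ω := by
      have := (hφ.locallyIntegrable (by norm_num)).integrable_smul_right_of_hasCompactSupport
        (hχ.continuous.mul (contDiff_pd hκ j).continuous) hc.mul_right
      simpa [IntegrableOn] using this
    have hi2 : IntegrableOn (fun z => φ z * (κ z * pd j χ z)) Ω := by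
      have := (hφ.locallyIntegrable (by norm_num)).integrable_smul_right_of_hasCompactSupport
        (hκ.continuous.mul (contDiff_pd hχ j).continuous) hκc.mul_right
      simpa [IntegrableOn] using this
    have hi3 : IntegrableOn (fun z => G j z * (χ z * κ z)) Ω := by
      have := ((hG j).locallyIntegrable (by norm_num)).integrable_smul_right_of_hasCompactSupport
        (hχ.continuous.mul hκ.continuous) hc.mul_right
      simpa [IntegrableOn] using this
    simp only [pd_mul hχ.differentiable_infty hκ.differentiable_infty, mul_add] at hw'
    rw [integral_add hi1 hi2] at hw'
    have e1 : pd j (moll (ρ n) P) x = -∫ z in Ω, φ z * (χ z * pd j κ z) := by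
      rw [pd_moll (hρ n) lP, ← integral_indicator hΩ.measurableSet]
      congr 2
      ext z
      by_cases hz : z ∈ Ω
      · simp only [hP, Set.indicator_of_mem hz, κ, pd_comp_sub]; ring
      · simp [hP, hz]
    have e2 : moll (ρ n) (Q j) x
        = (∫ z in Ω, G j z * (χ z * κ z)) + ∫ z in Ω, φ z * (κ z * pd j χ z) := by
      rw [← integral_add hi3 hi2, moll, ← integral_indicator hΩ.measurableSet]
      congr 1
      ext z
      by_cases hz : z ∈ Ω
      · simp only [hQ, Set.indicator_of_mem hz, κ]; ring
      · simp [hQ, hz]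
    rw [e1, e2]; linarith
  have hsm : ∀ δ > 0, ∀ᶠ n in atTop, ∀ y, ρ n y ≠ 0 → ‖y‖ < δ := fun δ hδ => by
    filter_upwards [hρ0 δ hδ] with n hn y hy using hn y (subset_tsupport _ hy)
  intro ε hε
  have t1 := ENNReal.tendsto_nhds_zero.1 (tendsto_moll hρ hsm mP) ε (pos_iff_ne_zero.2 hε)
  have t2 : ∀ᶠ n in atTop, ∀ j,
      eLpNorm (fun x => moll (ρ n) (Q j) x - Q j x) 2 volume ≤ ε := eventually_all.2 fun j =>
    ENNReal.tendsto_nhds_zero.1 (tendsto_moll hρ hsm (mQ j)) ε (pos_iff_ne_zero.2 hε)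
  obtain ⟨n, h1, h2, h3⟩ := (hgrad.and (t1.and t2)).exists
  refine ⟨moll (ρ n) P, contDiff_moll (hρ n) lP, hasCompactSupport_moll (hρ n) cP, ?_, fun j => ?_⟩
  · refine le_trans (le_of_eq ?_) ((eLpNorm_mono_measure _
      (Measure.restrict_le_self (s := Ω))).trans h2)
    apply eLpNorm_congr_ae
    filter_upwards [ae_restrict_mem hΩ.measurableSet] with x hx
    simp [hP, hx]
  · refine le_trans (le_of_eq ?_) ((eLpNorm_mono_measure _
      (Measure.restrict_le_self (s := Ω))).trans (h3 j))
    apply eLpNorm_congr_ae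
    filter_upwards [ae_restrict_mem hΩ.measurableSet] with x hx
    simp [hQ, hx, h1 x hx j]

/-! ### Radial cut-off functions -/

theorem contDiff_radial {θ : ℝ → ℝ} (hθ : ContDiff ℝ ∞ θ) :
    ContDiff ℝ ∞ fun x : Plane => θ (‖x‖ ^ 2) := hθ.comp (contDiff_norm_sq ℝ)

/-- The factor x j makes the gradient parallel to x, hence orthogonal to x^⊥. This is why rotations
do not see radial cut-offs. -/
theorem pd_radial {θ : ℝ → ℝ} (hθ : ContDiff ℝ ∞ θ) (j : Fin 2) (x : Plane) :
    pd j (fun x : Plane => θ (‖x‖ ^ 2)) x = 2 * x j * deriv θ (‖x‖ ^ 2) := by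
  have h1 : HasFDerivAt (fun x : Plane => ‖x‖ ^ 2) (2 • innerSL ℝ x) x :=
    (hasStrictFDerivAt_norm_sq x).hasFDerivAt
  have h2 := ((hθ.differentiable (by simp)) (‖x‖ ^ 2)).hasDerivAt.comp_hasFDerivAt x h1
  have h3 := h2.fderiv
  simp only [Function.comp_def] at h3
  rw [pd, h3]
  simp [EuclideanSpace.inner_single_right]
  ring

theorem hasCompactSupport_radial {θ : ℝ → ℝ} {M : ℝ} (h : ∀ s, M ≤ s → θ s = 0) :
    HasCompactSupport fun x : Plane => θ (‖x‖ ^ 2) := by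
  refine HasCompactSupport.intro (isCompact_closedBall (0 : Plane) (|M| + 1)) fun x hx => h _ ?_
  rw [Metric.mem_closedBall, dist_zero_right, not_le] at hx
  nlinarith [le_abs_self M, abs_nonneg M, norm_nonneg x]

theorem exists_bound_deriv_smoothTransition :
    ∃ D, 0 ≤ D ∧ ∀ s, |deriv Real.smoothTransition s| ≤ D := by
  have hc : HasCompactSupport (deriv Real.smoothTransition) := by
    refine HasCompactSupport.intro (isCompact_Icc (a := (0 : ℝ)) (b := 1)) fun s hs => ?_
    rw [mem_Icc, not_and_or, not_le, not_le] at hs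
    rcases hs with hs | hs
    · have : Real.smoothTransition =ᶠ[𝓝 s] fun _ => 0 := by
        filter_upwards [gt_mem_nhds hs] with t ht using Real.smoothTransition.zero_of_nonpos ht.le
      rw [this.deriv_eq]; simp
    · have : Real.smoothTransition =ᶠ[𝓝 s] fun _ => 1 := by
        filter_upwards [lt_mem_nhds hs] with t ht using Real.smoothTransition.one_of_one_le ht.le
      rw [this.deriv_eq]; simp
  obtain ⟨D, hD⟩ := hc.exists_bound_of_continuous
    ((Real.smoothTransition.contDiff (n := 1)).continuous_deriv le_rfl)
  exact ⟨D, (norm_nonneg _).trans (hD 0), hD⟩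

/-- The profile of a cut-off function that is `1` up to radius `N` and `0` from radius `√2 N` on. -/
noncomputable def cutProfile (N : ℝ) (s : ℝ) : ℝ := Real.smoothTransition (2 - s / N ^ 2)

/-- The associated cut-off function. -/
noncomputable def cut (N : ℝ) (x : Plane) : ℝ := cutProfile N (‖x‖ ^ 2)

theorem contDiff_cutProfile (N : ℝ) : ContDiff ℝ ∞ (cutProfile N) :=
  Real.smoothTransition.contDiff.comp (contDiff_const.sub (contDiff_id.div_const _))

theorem cutProfile_eq_zero {N : ℝ} (hN : 0 < N) (s : ℝ) (hs : 2 * N ^ 2 ≤ s) : cutProfile N s = 0 := by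
  refine Real.smoothTransition.zero_of_nonpos ?_
  rw [sub_nonpos, le_div_iff₀ (by positivity)]; exact hs

theorem cutProfile_eq_one {N : ℝ} (hN : 0 < N) (s : ℝ) (hs : s ≤ N ^ 2) : cutProfile N s = 1 := by
  refine Real.smoothTransition.one_of_one_le ?_
  have : s / N ^ 2 ≤ 1 := (div_le_one (by positivity)).2 hs
  linarith

theorem contDiff_cut (N : ℝ) : ContDiff ℝ ∞ (cut N) := contDiff_radial (contDiff_cutProfile N)

theorem hasCompactSupport_cut {N : ℝ} (hN : 0 < N) : HasCompactSupport (cut N) :=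
  hasCompactSupport_radial (cutProfile_eq_zero hN)

theorem cut_eq_one {N : ℝ} (hN : 0 < N) {x : Plane} (hx : ‖x‖ ≤ N) : cut N x = 1 :=
  cutProfile_eq_one hN _ (by gcongr)

theorem cut_nonneg (N : ℝ) (x : Plane) : 0 ≤ cut N x := Real.smoothTransition.nonneg _

theorem cut_le_one (N : ℝ) (x : Plane) : cut N x ≤ 1 := Real.smoothTransition.le_one _

/-- The derivative of the profile is O(1/N²) and the factor x j is at most 2N wherever it matters;
one power of 1/N remains, uniformly in N. -/
theorem exists_bound_pd_cut : ∃ D, 0 ≤ D ∧ ∀ N, 0 < N → ∀ j x, |pd j (cut N) x| ≤ D / N := by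
  obtain ⟨D, hD, hb⟩ := exists_bound_deriv_smoothTransition
  refine ⟨4 * D, by positivity, fun N hN j x => ?_⟩
  have e : pd j (cut N) x = 2 * x j * deriv (cutProfile N) (‖x‖ ^ 2) :=
    pd_radial (contDiff_cutProfile N) j x
  rw [e]
  have hd : deriv (cutProfile N) (‖x‖ ^ 2)
      = deriv Real.smoothTransition (2 - ‖x‖ ^ 2 / N ^ 2) * (-(1 / N ^ 2)) := by
    have h1 : HasDerivAt (fun s : ℝ => 2 - s / N ^ 2) (-(1 / N ^ 2)) (‖x‖ ^ 2) :=
      ((hasDerivAt_id _).div_const _).const_sub 2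
    have h2 := (((Real.smoothTransition.contDiff (n := 1)).differentiable (by simp))
      (2 - ‖x‖ ^ 2 / N ^ 2)).hasDerivAt
    exact (HasDerivAt.comp (‖x‖ ^ 2) h2 h1).deriv
  -- The cut-off already vanishes beyond √2 N; the cruder radius 2N avoids the square root.
  by_cases hx : 2 * N < ‖x‖
  · have : cutProfile N =ᶠ[𝓝 (‖x‖ ^ 2)] fun _ => 0 := by
      have : 2 * N ^ 2 < ‖x‖ ^ 2 := by nlinarith
      filter_upwards [lt_mem_nhds this] with s hs using cutProfile_eq_zero hN s hs.le
    rw [this.deriv_eq]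
    simp only [deriv_const, mul_zero, abs_zero]
    positivity
  · rw [hd, abs_mul, abs_mul, abs_mul, abs_neg, abs_of_pos (by positivity : (0:ℝ) < 1 / N ^ 2),
      abs_two]
    have hxj : |x j| ≤ 2 * N := (PiLp.norm_apply_le x j).trans (not_lt.1 hx)
    calc _ ≤ 2 * (2 * N) * (D * (1 / N ^ 2)) := by
          gcongr
          exact hb _
      _ = _ := by field_simp; ring

theorem tendsto_eLpNorm_cut {φ : Plane → ℝ} {μ : Measure Plane} (hφ : MemLp φ 2 μ) :
    Tendsto (fun n : ℕ => eLpNorm (fun x => cut (n + 1) x * φ x - φ x) 2 μ) atTop (𝓝 0) := by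
  have h2 : Tendsto (fun n : ℕ => ∫⁻ x, ‖cut (n + 1) x * φ x - φ x‖ₑ ^ 2 ∂μ) atTop (𝓝 0) := by
    have := tendsto_lintegral_of_dominated_convergence' (μ := μ)
      (F := fun (n : ℕ) x => ‖cut (n + 1) x * φ x - φ x‖ₑ ^ 2) (f := fun _ => 0)
      (fun x => ‖φ x‖ₑ ^ 2)
      (fun n => ((((contDiff_cut _).continuous.aestronglyMeasurable.mul hφ.1).sub
        hφ.1).enorm).pow_const 2) (fun n => ae_of_all _ fun x => ?_) ?_ (ae_of_all _ fun x => ?_)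
    · simpa using this
    · have : cut (n + 1) x * φ x - φ x = (cut (n + 1) x - 1) * φ x := by ring
      dsimp only
      rw [this, enorm_mul]
      have h1 : ‖cut (n + 1) x - 1‖ₑ ≤ 1 := by
        rw [← enorm_one (G := ℝ), enorm_le_iff_norm_le, Real.norm_eq_abs, norm_one, abs_le]
        constructor <;> linarith [cut_nonneg (n + 1) x, cut_le_one (n + 1) x]
      gcongr
      exact mul_le_of_le_one_left zero_le h1
    · rw [← eLpNorm_two_sq]
      exact (ENNReal.pow_lt_top hφ.2).ne
    · refine tendsto_const_nhds.congr' ?_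
      filter_upwards [eventually_ge_atTop ⌈‖x‖⌉₊] with n hn
      have : ‖x‖ ≤ n + 1 := (Nat.le_ceil _).trans (by exact_mod_cast hn.trans (Nat.le_succ n))
      rw [cut_eq_one (by positivity) this]
      simp
  simp only [← eLpNorm_two_sq] at h2
  have h3 := h2.ennrpow_const (1 / 2)
  refine (h3.congr fun n => ?_).trans (by simp)
  rw [← ENNReal.rpow_natCast, ← ENNReal.rpow_mul]
  norm_num

/-! ### Skew coordinates -/

theorem exists_skewEquiv {a b : Plane} (hab : LinearIndependent ℝ ![a, b]) :
    ∃ e : (ℝ × ℝ) ≃L[ℝ] Plane, ∀ p, e p = p.1 • a + p.2 • b := by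
  let A : ℝ × ℝ →ₗ[ℝ] Plane :=
    (LinearMap.fst ℝ ℝ ℝ).smulRight a + (LinearMap.snd ℝ ℝ ℝ).smulRight b
  have hA : ∀ p, A p = p.1 • a + p.2 • b := fun p => rfl
  have hinj : Function.Injective A := by
    rw [← LinearMap.ker_eq_bot, LinearMap.ker_eq_bot']
    intro p hp
    rw [hA] at hp
    have := LinearIndependent.pair_iff.1 hab _ _ hp
    exact Prod.ext this.1 this.2
  exact ⟨(LinearEquiv.ofInjectiveOfFinrankEq A hinj (by simp)).toContinuousLinearEquiv, fun p => rfl⟩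

/-- The cone is the image of the open quadrant under a linear isomorphism, hence open, and it
contains a + b. -/
theorem exists_ball_subset_cone {a b : Plane} (hab : LinearIndependent ℝ ![a, b]) :
    ∃ ε > 0, Metric.ball (a + b) ε ⊆ cone a b := by
  obtain ⟨e, he⟩ := exists_skewEquiv hab
  have h1 : IsOpen (e '' (Ioi 0 ×ˢ Ioi 0)) :=
    e.toHomeomorph.isOpenMap _ (isOpen_Ioi.prod isOpen_Ioi)
  have h2 : a + b ∈ e '' (Ioi 0 ×ˢ Ioi 0) := ⟨(1, 1), by simp, by simp [he]⟩
  obtain ⟨ε, hε, hb⟩ := Metric.isOpen_iff.1 h1 _ h2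
  refine ⟨ε, hε, hb.trans ?_⟩
  rintro _ ⟨p, ⟨h3, h4⟩, rfl⟩
  exact ⟨p.1, p.2, h3, h4, he p⟩

/-! ### Density in a domain with suitable cut-off functions -/

theorem ConeCondition.mono {Ω T T' : Set Plane} {a b : Plane} (h : ConeCondition Ω T a b)
    (hT : T' ⊆ T) : ConeCondition Ω T' a b := by
  obtain ⟨δ, hδ, h⟩ := h
  exact ⟨δ, hδ, fun x hx s t hs ht h1 h2 => h x hx s t hs ht (hT h1) (h2.imp_right fun h => hT h)⟩

theorem Approx.sum {Ω : Set Plane} {ι : Type*} (s : Finset ι) {φ : ι → Plane → ℝ}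
    {G : ι → Fin 2 → Plane → ℝ} (h : ∀ i, Approx Ω (φ i) (G i))
    (hm : ∀ i, AEStronglyMeasurable (φ i) (volume.restrict Ω))
    (hG : ∀ i j, AEStronglyMeasurable (G i j) (volume.restrict Ω)) :
    Approx Ω (fun x => ∑ i ∈ s, φ i x) (fun j x => ∑ i ∈ s, G i j x) := by
  classical
  induction s using Finset.induction_on with
  | empty => simp only [Finset.sum_empty]; exact approx_zero Ω
  | insert i s hi ih =>
    simp only [Finset.sum_insert hi]
    exact (h i).add ih (hm i) (hG i) (Finset.aestronglyMeasurable_fun_sum _ fun i _ => hm i)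
      fun j => Finset.aestronglyMeasurable_fun_sum _ fun i _ => hG i j

/-- A finite smooth partition of unity in the domain `Ω`, such that the support of each member
satisfies a cone condition. -/
structure ConePartition (Ω : Set Plane) {ι : Type} [Fintype ι] (χ : ι → Plane → ℝ)
    (a b : ι → Plane) : Prop where
  bounded : ∀ i, BoundedC1 (χ i)
  sum_eq : ∀ x ∈ closure Ω, ∑ i, χ i x = 1
  span : ∀ i, LinearIndependent ℝ ![a i, b i]
  cone : ∀ i, ConeCondition Ω (tsupport (χ i)) (a i) (b i)

theorem pd_sum {ι : Type*} (s : Finset ι) {f : ι → Plane → ℝ} (hf : ∀ i, Differentiable ℝ (f i))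
    (j : Fin 2) (x : Plane) : pd j (fun y => ∑ i ∈ s, f i y) x = ∑ i ∈ s, pd j (f i) x := by
  simp only [pd]
  rw [fderiv_fun_sum fun i _ => hf i x]
  simp

theorem ConePartition.sum_pd {Ω : Set Plane} (hΩ : IsOpen Ω) {ι : Type} [Fintype ι]
    {χ : ι → Plane → ℝ} {a b : ι → Plane} (hp : ConePartition Ω χ a b) (j : Fin 2) {x : Plane}
    (hx : x ∈ Ω) : ∑ i, pd j (χ i) x = 0 := by
  rw [← pd_sum _ (fun i => (hp.bounded i).smooth.differentiable_infty) j x]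
  have : (fun y => ∑ i, χ i y) =ᶠ[𝓝 x] fun _ => 1 := by
    filter_upwards [hΩ.mem_nhds hx] with y hy using hp.sum_eq y (subset_closure hy)
  rw [pd, this.fderiv_eq]
  simp

/-- Each piece χ_i · cut N · φ can be mollified from inside. The pieces add up to cut N · φ with the
gradient given by the product rule, since the χ_i sum to one and their gradients to zero in Ω.
Letting N tend to infinity removes the cut-off, the extra term φ ∇(cut N) being O(1/N) in L². -/
theorem ConePartition.approx {Ω : Set Plane} (hΩ : IsOpen Ω) {ι : Type} [Fintype ι]
    {χ : ι → Plane → ℝ} {a b : ι → Plane} (hp : ConePartition Ω χ a b) {φ : Plane → ℝ}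
    {G : Fin 2 → Plane → ℝ} (hw : HasWeakGrad Ω φ G) (hφ : MemLp φ 2 (volume.restrict Ω))
    (hG : ∀ j, MemLp (G j) 2 (volume.restrict Ω)) : Approx Ω φ G := by
  have hstep : ∀ N, 0 < N → Approx Ω (fun x => cut N x * φ x)
      (fun j x => cut N x * G j x + φ x * pd j (cut N) x) := by
    intro N hN
    have key := Approx.sum (Ω := Ω) Finset.univ (fun i => approx_mul_of_coneCondition hΩ hw hφ hG
      (χ := fun x => χ i x * cut N x) ((hp.bounded i).smooth.mul (contDiff_cut N))
      ((hasCompactSupport_cut hN).mul_left) (exists_ball_subset_cone (hp.span i))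
      ((hp.cone i).mono tsupport_mul_subset_left))
      (fun i => (((hp.bounded i).smooth.mul (contDiff_cut N)).continuous.aestronglyMeasurable.mul
        hφ.1)) (fun i j =>
        (((hp.bounded i).smooth.mul (contDiff_cut N)).continuous.aestronglyMeasurable.mul
        (hG j).1).add (hφ.1.mul (contDiff_pd ((hp.bounded i).smooth.mul
          (contDiff_cut N)) j).continuous.aestronglyMeasurable))
    refine key.congr ?_ fun j => ?_
    · filter_upwards [ae_restrict_mem hΩ.measurableSet] with x hx
      rw [← Finset.sum_mul, ← Finset.sum_mul, hp.sum_eq x (subset_closure hx), one_mul]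
    · filter_upwards [ae_restrict_mem hΩ.measurableSet] with x hx
      rw [Finset.sum_add_distrib, ← Finset.sum_mul, ← Finset.sum_mul, ← Finset.mul_sum,
        hp.sum_eq x (subset_closure hx), one_mul]
      congr 2
      simp only [pd_mul (hp.bounded _).smooth.differentiable_infty
        (contDiff_cut N).differentiable_infty]
      rw [Finset.sum_add_distrib, ← Finset.sum_mul, ← Finset.mul_sum, hp.sum_pd hΩ j hx,
        hp.sum_eq x (subset_closure hx)]
      ring
  refine Approx.mono_left (fun ε hε => ?_) hφ.1 fun j => (hG j).1
  have hε2 : 0 < ε / 2 := ENNReal.half_pos hε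
  obtain ⟨D, hD, hb⟩ := exists_bound_pd_cut
  have t1 := ENNReal.tendsto_nhds_zero.1 (tendsto_eLpNorm_cut hφ) ε (pos_iff_ne_zero.2 hε)
  have t2 : ∀ᶠ n : ℕ in atTop, ∀ j,
      eLpNorm (fun x => cut (n + 1) x * G j x - G j x) 2 (volume.restrict Ω) ≤ ε / 2 :=
    eventually_all.2 fun j => ENNReal.tendsto_nhds_zero.1 (tendsto_eLpNorm_cut (hG j)) _ hε2
  have t3 : ∀ᶠ n : ℕ in atTop, ∀ j,
      eLpNorm (fun x => φ x * pd j (cut (n + 1)) x) 2 (volume.restrict Ω) ≤ ε / 2 := by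
    have h0 : Tendsto (fun n : ℕ => ENNReal.ofReal (D / ((n : ℝ) + 1)) *
        eLpNorm φ 2 (volume.restrict Ω)) atTop (𝓝 0) := by
      have h1 : Tendsto (fun n : ℕ => D / ((n : ℝ) + 1)) atTop (𝓝 0) := by
        simpa [div_eq_mul_inv] using
          (tendsto_one_div_add_atTop_nhds_zero_nat (𝕜 := ℝ)).const_mul D
      have h2 := ENNReal.Tendsto.mul_const (ENNReal.tendsto_ofReal h1)
        (Or.inr hφ.2.ne) (b := eLpNorm φ 2 (volume.restrict Ω))
      simpa using h2
    filter_upwards [ENNReal.tendsto_nhds_zero.1 h0 _ hε2] with n hn j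
    refine le_trans ?_ hn
    refine eLpNorm_le_mul_eLpNorm_of_ae_le_mul (ae_of_all _ fun x => ?_) 2
    rw [norm_mul, mul_comm]
    gcongr
    exact hb _ (by positivity) j x
  obtain ⟨n, h1, h2, h3⟩ := (t1.and (t2.and t3)).exists
  refine ⟨_, _, hstep (n + 1) (by positivity), h1, fun j => ?_,
    (contDiff_cut _).continuous.aestronglyMeasurable.mul hφ.1, fun j =>
    ((contDiff_cut _).continuous.aestronglyMeasurable.mul (hG j).1).add
      (hφ.1.mul (contDiff_pd (contDiff_cut _) j).continuous.aestronglyMeasurable)⟩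
  have := eLpNorm_add_le (p := 2)
    (((contDiff_cut (n + 1)).continuous.aestronglyMeasurable.mul (hG j).1).sub (hG j).1)
    (hφ.1.mul (contDiff_pd (contDiff_cut (n + 1)) j).continuous.aestronglyMeasurable) (by norm_num)
  calc _ = _ := by congr 1; ext x; simp only [Pi.add_apply, Pi.sub_apply, Pi.mul_apply]; ring
    _ ≤ _ := this
    _ ≤ ε / 2 + ε / 2 := add_le_add (h2 j) (h3 j)
    _ = ε := ENNReal.add_halves ε

/-- The push-forward of Lebesgue measure under the skew coordinates is a Haar measure, hence a
multiple of the area. Only the finiteness and positivity of the Jacobian c are used. -/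
theorem exists_lintegral_coords {a b : Plane} (hab : LinearIndependent ℝ ![a, b]) :
    ∃ c : ℝ≥0∞, c ≠ 0 ∧ c ≠ ⊤ ∧ ∀ f : Plane → ℝ≥0∞, Measurable f →
      ∫⁻ x, f x = c * ∫⁻ t : ℝ, ∫⁻ s : ℝ, f (s • a + t • b) := by
  obtain ⟨e, he⟩ := exists_skewEquiv hab
  let ν : Measure Plane := Measure.map e (volume : Measure (ℝ × ℝ))
  have hν : ν.IsAddHaarMeasure := e.isAddHaarMeasure_map volume
  have h := Measure.isAddLeftInvariant_eq_smul (volume : Measure Plane) ν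
  refine ⟨(Measure.addHaarScalarFactor (volume : Measure Plane) ν : ℝ≥0), ?_, by simp, fun f hf => ?_⟩
  · simpa using (Measure.addHaarScalarFactor_pos_of_isAddHaarMeasure (volume : Measure Plane) ν).ne'
  · conv_lhs => rw [h]
    rw [lintegral_smul_measure, lintegral_map hf e.continuous.measurable]
    simp only [he]
    rw [Measure.volume_eq_prod, lintegral_prod_symm]
    · rfl
    · exact (hf.comp (by fun_prop)).aemeasurable

/-! ### Bounds by integrals over rays -/

/-- The function `|h| |∇h|`, up to the factor `2 |a|`. -/
noncomputable def energyDensity (h : Plane → ℝ) (y : Plane) : ℝ≥0∞ := ‖h y‖ₑ * ‖fderiv ℝ h y‖ₑ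

theorem measurable_energyDensity {h : Plane → ℝ} (hh : ContDiff ℝ ∞ h) :
    Measurable (energyDensity h) :=
  hh.continuous.enorm.measurable.mul (hh.continuous_fderiv (by simp)).enorm.measurable

/-- The fundamental theorem of calculus for h² along the ray from x, whose far end contributes
nothing because h has compact support. Points of the ray outside the support of h do not count, so
it suffices that the others lie in Ω. -/
theorem sq_le_lintegral_ray {Ω : Set Plane} {h : Plane → ℝ} (hh : ContDiff ℝ ∞ h)
    (hc : HasCompactSupport h) {a : Plane} (ha : a ≠ 0) {x : Plane}
    (hx : ∀ s : ℝ, 0 < s → x + s • a ∈ tsupport h → x + s • a ∈ Ω) :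
    ‖h x‖ₑ ^ 2 ≤ 2 * ‖a‖ₑ * ∫⁻ s : ℝ, Ω.indicator (energyDensity h) (x + s • a) := by
  -- The ray is parametrized backwards, so that the value at 0 is bounded by the integral of the
  -- derivative over the negative half line.
  let f : ℝ → ℝ := fun s => h (x + (-s) • a) ^ 2
  have hline : ContDiff ℝ ∞ fun s : ℝ => x + (-s) • a :=
    contDiff_const.add (contDiff_neg.smul contDiff_const)
  have hf : ContDiff ℝ 1 f := ((hh.comp hline).pow 2).of_le (by simp)
  have hfc : HasCompactSupport f := by
    obtain ⟨R, hR⟩ := hc.isCompact.isBounded.subset_closedBall 0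
    refine HasCompactSupport.intro (isCompact_closedBall (0 : ℝ) ((R + ‖x‖) / ‖a‖)) fun s hs => ?_
    have : x + (-s) • a ∉ tsupport h := fun hm => hs <| by
      have h1 := hR hm
      rw [mem_closedBall_zero_iff] at h1 ⊢
      rw [le_div_iff₀ (norm_pos_iff.2 ha)]
      have h2 : ‖(-s) • a‖ ≤ ‖x + (-s) • a‖ + ‖x‖ := by
        simpa using norm_sub_le (x + (-s) • a) x
      rw [norm_smul, norm_neg] at h2
      linarith
    simp only [f, image_eq_zero_of_notMem_tsupport this]; norm_num
  have hder : ∀ s, HasDerivAt f (2 * h (x + (-s) • a) * (fderiv ℝ h (x + (-s) • a) (-a))) s := by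
    intro s
    have h1 : HasDerivAt (fun s : ℝ => x + (-s) • a) (-a) s := by
      have := ((hasDerivAt_id s).neg.smul_const a).const_add x
      simpa using this
    have h2 := ((hh.differentiable (by simp)) (x + (-s) • a)).hasFDerivAt.comp_hasDerivAt s h1
    have h3 := h2.pow 2
    simp only [Nat.cast_ofNat, Nat.add_one_sub_one, pow_one] at h3
    exact h3
  have h1 := hfc.enorm_le_lintegral_Ici_deriv hf 0
  have hf0 : ‖f 0‖ₑ = ‖h x‖ₑ ^ 2 := by simp [f]
  rw [hf0] at h1
  refine h1.trans ?_
  rw [setLIntegral_congr Iio_ae_eq_Iic.symm]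
  calc ∫⁻ s in Iio 0, ‖deriv f s‖ₑ
      ≤ ∫⁻ s in Iio (0 : ℝ), 2 * ‖a‖ₑ * Ω.indicator (energyDensity h) (x + (-s) • a) := by
        refine setLIntegral_mono' measurableSet_Iio fun s hs => ?_
        rw [(hder s).deriv]
        by_cases hm : x + (-s) • a ∈ tsupport h
        · rw [Set.indicator_of_mem (hx (-s) (by simpa using hs) hm), enorm_mul, enorm_mul,
            energyDensity]
          have h2 : ‖(2 : ℝ)‖ₑ = 2 := by
            rw [Real.enorm_of_nonneg (by norm_num)]; simp
          have h3 : ‖fderiv ℝ h (x + (-s) • a) (-a)‖ₑ ≤ ‖fderiv ℝ h (x + (-s) • a)‖ₑ * ‖a‖ₑ := by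
            simpa using (fderiv ℝ h (x + (-s) • a)).le_opENorm (-a)
          rw [h2]
          calc _ ≤ 2 * ‖h (x + (-s) • a)‖ₑ * (‖fderiv ℝ h (x + (-s) • a)‖ₑ * ‖a‖ₑ) := by gcongr
            _ = _ := by ring
        · rw [image_eq_zero_of_notMem_tsupport hm]; simp
    _ ≤ ∫⁻ s : ℝ, 2 * ‖a‖ₑ * Ω.indicator (energyDensity h) (x + (-s) • a) :=
        setLIntegral_le_lintegral _ _
    _ = 2 * ‖a‖ₑ * ∫⁻ s : ℝ, Ω.indicator (energyDensity h) (x + (-s) • a) := by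
        rw [lintegral_const_mul']
        exact ENNReal.mul_ne_top (by simp) (by simp)
    _ = _ := by
        congr 1
        exact lintegral_neg_eq_self (fun s : ℝ => Ω.indicator (energyDensity h) (x + s • a))

/-- Ladyzhenskaya's inequality in a domain, for functions supported where the domain satisfies
a cone condition. -/
theorem exists_lintegral_pow_four_le {Ω : Set Plane} (hΩ : IsOpen Ω) {a b : Plane}
    (hab : LinearIndependent ℝ ![a, b]) {T : Set Plane} (hT : ConeCondition Ω T a b) :
    ∃ C : ℝ≥0∞, C ≠ ⊤ ∧ ∀ h : Plane → ℝ, ContDiff ℝ ∞ h → HasCompactSupport h → tsupport h ⊆ T →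
      ∫⁻ x in Ω, ‖h x‖ₑ ^ 4 ≤ C * (∫⁻ x in Ω, energyDensity h x) ^ 2 := by
  obtain ⟨c, hc0, hct, hc⟩ := exists_lintegral_coords hab
  obtain ⟨δ, hδ, hcone⟩ := hT
  have ha : a ≠ 0 := hab.ne_zero 0
  have hb : b ≠ 0 := hab.ne_zero 1
  refine ⟨c⁻¹ * ((2 * ‖a‖ₑ) * (2 * ‖b‖ₑ)), ENNReal.mul_ne_top (ENNReal.inv_ne_top.2 hc0)
    (by finiteness), fun h hh hs hsT => ?_⟩
  set k : Plane → ℝ≥0∞ := Ω.indicator (energyDensity h) with hk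
  have hkm : Measurable k := (measurable_energyDensity hh).indicator hΩ.measurableSet
  -- Integrals of the density over whole lines parallel to a and to b. Each depends on one skew
  -- coordinate only, so their product integrates to the product of the integrals.
  let KA : ℝ → ℝ≥0∞ := fun t => ∫⁻ s : ℝ, k (s • a + t • b)
  let KB : ℝ → ℝ≥0∞ := fun s => ∫⁻ t : ℝ, k (s • a + t • b)
  have hpair : Measurable fun p : ℝ × ℝ => k (p.1 • a + p.2 • b) := hkm.comp (by fun_prop)
  have hKA : Measurable KA := hpair.lintegral_prod_left'
  have hKB : Measurable KB := hpair.lintegral_prod_right'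
  have hA : c * ∫⁻ t, KA t = ∫⁻ x, k x := (hc k hkm).symm
  have hB : c * ∫⁻ s, KB s = ∫⁻ x, k x := by
    rw [← hA]; congr 1
    exact lintegral_lintegral_swap hpair.aemeasurable
  have hpt : ∀ s t : ℝ, Ω.indicator (fun x => ‖h x‖ₑ ^ 4) (s • a + t • b)
      ≤ (2 * ‖a‖ₑ) * (2 * ‖b‖ₑ) * (KA t * KB s) := by
    intro s t
    set x := s • a + t • b with hx
    by_cases hxΩ : x ∈ Ω
    swap
    · simp [hxΩ]
    rw [Set.indicator_of_mem hxΩ]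
    by_cases hxT : x ∈ tsupport h
    swap
    · simp [image_eq_zero_of_notMem_tsupport hxT]
    -- Both ends of the step lie in T, which is the alternative of the cone condition that does not
    -- restrict the length of the step.
    have h1 := sq_le_lintegral_ray (Ω := Ω) hh hs ha (x := x) fun r hr hm => by
      have := hcone x hxΩ r 0 hr.le le_rfl (by simpa using hsT hm) (Or.inr (hsT hxT))
      simpa using this
    have h2 := sq_le_lintegral_ray (Ω := Ω) hh hs hb (x := x) fun r hr hm => by
      have := hcone x hxΩ 0 r le_rfl hr.le (by simpa using hsT hm) (Or.inr (hsT hxT))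
      simpa using this
    have e1 : ∫⁻ r : ℝ, k (x + r • a) = KA t := by
      refine Eq.trans ?_ (lintegral_add_left_eq_self (fun s : ℝ => k (s • a + t • b)) s)
      congr 1; ext r; congr 1; rw [hx, add_smul]; abel
    have e2 : ∫⁻ r : ℝ, k (x + r • b) = KB s := by
      refine Eq.trans ?_ (lintegral_add_left_eq_self (fun t : ℝ => k (s • a + t • b)) t)
      congr 1; ext r; congr 1; rw [hx, add_smul]; abel
    rw [e1] at h1
    rw [e2] at h2
    calc ‖h x‖ₑ ^ 4 = ‖h x‖ₑ ^ 2 * ‖h x‖ₑ ^ 2 := by ring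
      _ ≤ (2 * ‖a‖ₑ * KA t) * (2 * ‖b‖ₑ * KB s) := mul_le_mul' h1 h2
      _ = _ := by ring
  have hm4 : Measurable (Ω.indicator fun x => ‖h x‖ₑ ^ 4) :=
    (hh.continuous.enorm.measurable.pow_const 4).indicator hΩ.measurableSet
  rw [← lintegral_indicator hΩ.measurableSet, ← lintegral_indicator hΩ.measurableSet, hc _ hm4]
  calc c * ∫⁻ t : ℝ, ∫⁻ s : ℝ, Ω.indicator (fun x => ‖h x‖ₑ ^ 4) (s • a + t • b)
      ≤ c * ∫⁻ t : ℝ, ∫⁻ s : ℝ, (2 * ‖a‖ₑ) * (2 * ‖b‖ₑ) * (KA t * KB s) := by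
        gcongr with t s; exact hpt s t
    _ = c * ((2 * ‖a‖ₑ) * (2 * ‖b‖ₑ) * ((∫⁻ t, KA t) * ∫⁻ s, KB s)) := by
        congr 1
        have : ∀ t, ∫⁻ s : ℝ, (2 * ‖a‖ₑ) * (2 * ‖b‖ₑ) * (KA t * KB s)
            = (2 * ‖a‖ₑ) * (2 * ‖b‖ₑ) * (KA t * ∫⁻ s, KB s) := fun t => by
          rw [lintegral_const_mul _ (hKB.const_mul _), lintegral_const_mul _ hKB]
        simp only [this]
        rw [lintegral_const_mul _ (hKA.mul_const _), lintegral_mul_const _ hKA]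
    _ = c⁻¹ * ((2 * ‖a‖ₑ) * (2 * ‖b‖ₑ)) * ((c * ∫⁻ t, KA t) * (c * ∫⁻ s, KB s)) := by
        -- Each of the two line integrals needs a factor c to become the area integral, and only one
        -- is available; hence the c⁻¹ in the constant.
        have : c⁻¹ * c = 1 := ENNReal.inv_mul_cancel hc0 hct
        calc _ = (c⁻¹ * c) * (c * ((2 * ‖a‖ₑ) * (2 * ‖b‖ₑ) * ((∫⁻ t, KA t) * ∫⁻ s, KB s))) := by
              rw [this, one_mul]
          _ = _ := by ring
    _ = _ := by rw [hA, hB, sq]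

/-! ### The norm of `H¹` -/

/-- The norm of the pair `(φ, G)` in `L²(Ω)`. -/
noncomputable def h1Norm (Ω : Set Plane) (φ : Plane → ℝ) (G : Fin 2 → Plane → ℝ) : ℝ≥0∞ :=
  eLpNorm φ 2 (volume.restrict Ω) + ∑ j, eLpNorm (G j) 2 (volume.restrict Ω)

theorem enorm_fderiv_le (h : Plane → ℝ) (x : Plane) : ‖fderiv ℝ h x‖ₑ ≤ ∑ j, ‖pd j h x‖ₑ := by
  have : ‖fderiv ℝ h x‖ ≤ ∑ j, ‖pd j h x‖ := by
    refine ContinuousLinearMap.opNorm_le_bound _ (by positivity) fun v => ?_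
    have hv : v = ∑ j, v j • EuclideanSpace.single j (1 : ℝ) := by
      ext i; fin_cases i <;> simp
    have e : fderiv ℝ h x v = ∑ j, v j * pd j h x := by
      conv_lhs => rw [hv]
      simp [pd]
    rw [e, Finset.sum_mul]
    refine (norm_sum_le _ _).trans (Finset.sum_le_sum fun j _ => ?_)
    rw [norm_mul, mul_comm]
    gcongr
    exact PiLp.norm_apply_le v j
  rw [← ofReal_norm]
  simp only [← ofReal_norm]
  rw [← ENNReal.ofReal_sum_of_nonneg (fun _ _ => norm_nonneg _)]
  exact ENNReal.ofReal_le_ofReal this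

theorem eLpNorm_sum_le_of_measurable {μ : Measure Plane} {ι : Type*} (s : Finset ι)
    {f : ι → Plane → ℝ} (hf : ∀ i, AEStronglyMeasurable (f i) μ) {p : ℝ≥0∞} (hp : 1 ≤ p) :
    eLpNorm (fun x => ∑ i ∈ s, f i x) p μ ≤ ∑ i ∈ s, eLpNorm (f i) p μ := by
  have := eLpNorm_sum_le (s := s) (fun i _ => hf i) hp
  refine le_trans (le_of_eq ?_) this
  congr 1; ext x; simp

/-- Cauchy–Schwarz in each partial derivative. It turns the ray estimates into H¹ estimates. -/
theorem lintegral_energyDensity_le (Ω : Set Plane) {h : Plane → ℝ} (hh : ContDiff ℝ ∞ h) :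
    ∫⁻ x in Ω, energyDensity h x ≤ h1Norm Ω h (fun j => pd j h) ^ 2 := by
  calc ∫⁻ x in Ω, energyDensity h x ≤ ∫⁻ x in Ω, ∑ j, ‖h x‖ₑ * ‖pd j h x‖ₑ := by
        refine lintegral_mono fun x => ?_
        rw [energyDensity, ← Finset.mul_sum]
        gcongr
        exact enorm_fderiv_le h x
    _ = ∑ j, ∫⁻ x in Ω, ‖h x‖ₑ * ‖pd j h x‖ₑ := by
        rw [lintegral_finsetSum]
        exact fun j _ => hh.continuous.enorm.measurable.mul
          (contDiff_pd hh j).continuous.enorm.measurable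
    _ ≤ ∑ j, eLpNorm h 2 (volume.restrict Ω) * eLpNorm (pd j h) 2 (volume.restrict Ω) := by
        refine Finset.sum_le_sum fun j _ => ?_
        have := ENNReal.lintegral_mul_le_Lp_mul_Lq (volume.restrict Ω)
          Real.HolderConjugate.two_two hh.continuous.enorm.aemeasurable
          (contDiff_pd hh j).continuous.enorm.aemeasurable
        have e : ∀ f : Plane → ℝ, eLpNorm f 2 (volume.restrict Ω)
            = (∫⁻ x in Ω, ‖f x‖ₑ ^ (2 : ℝ)) ^ (1 / 2 : ℝ) := fun f => by
          rw [eLpNorm_eq_lintegral_rpow_enorm_toReal (by norm_num) (by norm_num)]; simp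
        rw [e, e]
        exact this
    _ = eLpNorm h 2 (volume.restrict Ω) * ∑ j, eLpNorm (pd j h) 2 (volume.restrict Ω) := by
        rw [Finset.mul_sum]
    _ ≤ h1Norm Ω h (fun j => pd j h) * h1Norm Ω h (fun j => pd j h) :=
        mul_le_mul' le_self_add le_add_self
    _ = _ := (sq _).symm

theorem eLpNorm_mul_le_of_bound {μ : Measure Plane} {χ f : Plane → ℝ} {C : ℝ} (hC : ∀ x, ‖χ x‖ ≤ C)
    (p : ℝ≥0∞) : eLpNorm (fun x => χ x * f x) p μ ≤ ENNReal.ofReal C * eLpNorm f p μ := by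
  refine eLpNorm_le_mul_eLpNorm_of_ae_le_mul (ae_of_all _ fun x => ?_) p
  rw [norm_mul]
  gcongr
  exact hC x

theorem BoundedC1.exists_h1Norm_mul_le {χ : Plane → ℝ} (hχ : BoundedC1 χ) (Ω : Set Plane) :
    ∃ C : ℝ≥0∞, C ≠ ⊤ ∧ ∀ f : Plane → ℝ, ContDiff ℝ ∞ f →
      h1Norm Ω (fun x => χ x * f x) (fun j => pd j fun x => χ x * f x)
        ≤ C * h1Norm Ω f (fun j => pd j f) := by
  obtain ⟨C, hC⟩ := hχ.bound
  choose D hD using hχ.bound_pd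
  refine ⟨ENNReal.ofReal C + ∑ j : Fin 2, (ENNReal.ofReal C + ENNReal.ofReal (D j)),
    by simp, fun f hf => ?_⟩
  rw [h1Norm, add_mul, Finset.sum_mul]
  refine add_le_add ?_ (Finset.sum_le_sum fun j _ => ?_)
  · exact (eLpNorm_mul_le_of_bound hC 2).trans (mul_le_mul_right le_self_add _)
  · have e : (pd j fun x => χ x * f x) = (fun x => χ x * pd j f x) + fun x => pd j χ x * f x := by
      ext x
      rw [pd_mul hχ.smooth.differentiable_infty hf.differentiable_infty, Pi.add_apply]; ring
    rw [e]
    refine (eLpNorm_add_le (hχ.smooth.continuous.mul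
      (contDiff_pd hf j).continuous).aestronglyMeasurable
      ((contDiff_pd hχ.smooth j).continuous.mul hf.continuous).aestronglyMeasurable
      (by norm_num)).trans ?_
    rw [add_mul]
    refine add_le_add ((eLpNorm_mul_le_of_bound hC 2).trans ?_)
      ((eLpNorm_mul_le_of_bound (hD j) 2).trans (mul_le_mul_right le_self_add _))
    refine mul_le_mul_right ?_ _
    exact (Finset.single_le_sum (f := fun j => eLpNorm (pd j f) 2 (volume.restrict Ω))
      (fun _ _ => zero_le) (Finset.mem_univ j)).trans le_add_self

/-- If each cut-off piece satisfies a bound in terms of `energyDensity`, then smooth functions are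
bounded by their `H¹` norm. -/
theorem ConePartition.exists_eLpNorm_le {Ω : Set Plane} {ι : Type} [Fintype ι]
    {χ : ι → Plane → ℝ} {a b : ι → Plane} (hp : ConePartition Ω χ a b) {μ : Measure Plane}
    {p : ℝ≥0∞} (h1p : 1 ≤ p) (hμ : ∀ᵐ x ∂μ, x ∈ closure Ω)
    (h : ∀ i, ∃ C : ℝ≥0∞, C ≠ ⊤ ∧ ∀ h : Plane → ℝ, ContDiff ℝ ∞ h → HasCompactSupport h →
      tsupport h ⊆ tsupport (χ i) → eLpNorm h p μ ≤ C * h1Norm Ω h (fun j => pd j h)) :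
    ∃ C : ℝ≥0∞, C ≠ ⊤ ∧ ∀ f : Plane → ℝ, ContDiff ℝ ∞ f → HasCompactSupport f →
      eLpNorm f p μ ≤ C * h1Norm Ω f (fun j => pd j f) := by
  choose C hC hb using h
  choose D hD hd using fun i => (hp.bounded i).exists_h1Norm_mul_le Ω
  refine ⟨∑ i, C i * D i, ?_, fun f hf hc => ?_⟩
  · simpa [ENNReal.sum_eq_top] using fun i => ENNReal.mul_ne_top (hC i) (hD i)
  · have e : f =ᵐ[μ] fun x => ∑ i, χ i x * f x := by
      filter_upwards [hμ] with x hx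
      rw [← Finset.sum_mul, hp.sum_eq x hx, one_mul]
    rw [eLpNorm_congr_ae e, Finset.sum_mul]
    refine (eLpNorm_sum_le_of_measurable _ (fun i => ((hp.bounded i).smooth.continuous.mul
      hf.continuous).aestronglyMeasurable) h1p).trans (Finset.sum_le_sum fun i _ => ?_)
    refine (hb i _ ((hp.bounded i).smooth.mul hf) hc.mul_left tsupport_mul_subset_left).trans ?_
    rw [mul_assoc]
    exact mul_le_mul_right (hd i f hf) _

theorem eLpNorm_four_pow {μ : Measure Plane} (f : Plane → ℝ) :
    eLpNorm f 4 μ ^ 4 = ∫⁻ x, ‖f x‖ₑ ^ 4 ∂μ := by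
  have := eLpNorm_nnreal_pow_eq_lintegral (μ := μ) (f := f) (p := 4) (by norm_num)
  norm_num at this
  exact_mod_cast this

theorem ConePartition.exists_eLpNorm_four_le {Ω : Set Plane} (hΩ : IsOpen Ω) {ι : Type} [Fintype ι]
    {χ : ι → Plane → ℝ} {a b : ι → Plane} (hp : ConePartition Ω χ a b) :
    ∃ C : ℝ≥0∞, C ≠ ⊤ ∧ ∀ f : Plane → ℝ, ContDiff ℝ ∞ f → HasCompactSupport f →
      eLpNorm f 4 (volume.restrict Ω) ≤ C * h1Norm Ω f (fun j => pd j f) := by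
  refine hp.exists_eLpNorm_le (by norm_num) ?_ fun i => ?_
  · filter_upwards [ae_restrict_mem hΩ.measurableSet] with x hx using subset_closure hx
  · obtain ⟨C, hC, hb⟩ := exists_lintegral_pow_four_le hΩ (hp.span i) (hp.cone i)
    -- C ≤ (C + 1)^4 spares a fourth root of the constant.
    refine ⟨C + 1, by simp [hC], fun h hh hc hs => ?_⟩
    have h4 : eLpNorm h 4 (volume.restrict Ω) ^ 4 ≤ ((C + 1) * h1Norm Ω h (fun j => pd j h)) ^ 4 := by
      rw [eLpNorm_four_pow]
      calc _ ≤ C * (∫⁻ x in Ω, energyDensity h x) ^ 2 := hb h hh hc hs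
        _ ≤ C * (h1Norm Ω h (fun j => pd j h) ^ 2) ^ 2 := by
            gcongr; exact lintegral_energyDensity_le Ω hh
        _ ≤ (C + 1) ^ 4 * (h1Norm Ω h (fun j => pd j h) ^ 2) ^ 2 := by
            gcongr
            exact le_self_add.trans (le_self_pow₀ le_add_self (by norm_num))
        _ = _ := by ring
    exact (ENNReal.pow_le_pow_left_iff (by norm_num)).1 h4

/-! ### The boundary of the solid -/

/-- In the ball around `p` of radius `ρ`, in the coordinates `L`, the set `S` is the subgraph of the
function `γ`, which has the Lipschitz constant `K` where it matters. -/
structure IsChart (S : Set Plane) (p : Plane) (L : Plane ≃ₗᵢ[ℝ] Plane) (γ : ℝ → ℝ) (ρ : ℝ)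
    (K : ℝ≥0) : Prop where
  smooth : ContDiff ℝ ∞ γ
  pos : 0 < ρ
  mem_iff : ∀ x ∈ Metric.ball p ρ, x ∈ S ↔ (L x) 1 ≤ γ ((L x) 0)
  lip : LipschitzOnWith K γ (Icc ((L p) 0 - ρ) ((L p) 0 + ρ))

theorem IsBody.exists_chart {S : Set Plane} (hS : IsBody S) {p : Plane} (hp : p ∈ frontier S) :
    ∃ L γ ρ K, IsChart S p L γ ρ K := by
  obtain ⟨L, γ, ρ, hγ, hρ, h⟩ := hS.smooth p hp
  obtain ⟨C, hC⟩ := (isCompact_Icc (a := (L p) 0 - ρ) (b := (L p) 0 + ρ)).exists_bound_of_continuousOn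
    (hγ.continuous_deriv (by simp)).continuousOn
  refine ⟨L, γ, ρ, C.toNNReal, hγ, hρ, h, ?_⟩
  refine (convex_Icc _ _).lipschitzOnWith_of_nnnorm_deriv_le
    (fun x _ => hγ.differentiable (by simp) x) fun x hx => ?_
  rw [← NNReal.coe_le_coe, coe_nnnorm]
  exact (hC x hx).trans (Real.le_coe_toNNReal C)

namespace IsChart
variable {S : Set Plane} {p : Plane} {L : Plane ≃ₗᵢ[ℝ] Plane} {γ : ℝ → ℝ} {ρ : ℝ} {K : ℝ≥0}

theorem coord_mem (_ : IsChart S p L γ ρ K) {x : Plane} (hx : x ∈ Metric.ball p ρ) :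
    (L x) 0 ∈ Icc ((L p) 0 - ρ) ((L p) 0 + ρ) := by
  have h1 : |(L x) 0 - (L p) 0| ≤ ‖x - p‖ := by
    rw [← L.norm_map (x - p), map_sub]
    exact PiLp.norm_apply_le (L x - L p) 0
  rw [Metric.mem_ball, dist_eq_norm] at hx
  have h2 := abs_le.1 (h1.trans hx.le)
  constructor <;> linarith [h2.1, h2.2]

theorem abs_sub_le (h : IsChart S p L γ ρ K) {x y : Plane} (hx : x ∈ Metric.ball p ρ)
    (hy : y ∈ Metric.ball p ρ) :
    |γ ((L x) 0) - γ ((L y) 0)| ≤ K * |(L x) 0 - (L y) 0| :=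
  h.lip.dist_le_mul _ (h.coord_mem hx) _ (h.coord_mem hy)

/-- The two edges of the cone contained in the fluid domain. -/
noncomputable def edge (L : Plane ≃ₗᵢ[ℝ] Plane) (K : ℝ≥0) (σ : ℝ) : Plane :=
  L.symm !₂[σ, (K : ℝ) + 1]

theorem linearIndependent_edge (L : Plane ≃ₗᵢ[ℝ] Plane) (K : ℝ≥0) :
    LinearIndependent ℝ ![edge L K 1, edge L K (-1)] := by
  rw [LinearIndependent.pair_iff]
  intro s t hst
  have h := congrArg L hst
  simp only [edge, map_add, map_smul, LinearIsometryEquiv.apply_symm_apply, map_zero] at h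
  have h0 := congrArg (fun v : Plane => v 0) h
  have h1 := congrArg (fun v : Plane => v 1) h
  simp at h0 h1
  have hK : (0 : ℝ) < K + 1 := by positivity
  have : (s + t) * ((K : ℝ) + 1) = 0 := by linarith
  have : s + t = 0 := by simpa [hK.ne'] using this
  constructor <;> linarith

/-- A step with coefficients s, t moves the point sideways by s - t and upwards by (s + t)(K + 1).
The graph rises by at most K |s - t| meanwhile, so a point above it stays above. Halving the radius
keeps the starting point of a short step inside the chart. -/
theorem coneCondition (h : IsChart S p L γ ρ K) {T : Set Plane}
    (hT : T ⊆ Metric.ball p (ρ / 2)) :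
    ConeCondition Sᶜ T (edge L K 1) (edge L K (-1)) := by
  refine ⟨ρ / 2, half_pos h.pos, fun x hx s t hs ht hy hor => ?_⟩
  set v := s • edge L K 1 + t • edge L K (-1) with hv
  have hyb : x + v ∈ Metric.ball p ρ := Metric.ball_subset_ball (by linarith [h.pos]) (hT hy)
  have hxb : x ∈ Metric.ball p ρ := by
    rcases hor with hor | hor
    · have h1 := hT hy
      rw [Metric.mem_ball, dist_eq_norm] at h1 ⊢
      have : ‖x - p‖ ≤ ‖x + v - p‖ + ‖v‖ := by
        calc ‖x - p‖ = ‖(x + v - p) - v‖ := by congr 1; abel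
          _ ≤ _ := norm_sub_le _ _
      linarith
    · exact Metric.ball_subset_ball (by linarith [h.pos]) (hT hor)
  have hLv : L v = s • !₂[1, (K : ℝ) + 1] + t • !₂[-1, (K : ℝ) + 1] := by
    simp [hv, edge]
  have e0 : (L (x + v)) 0 = (L x) 0 + (s - t) := by rw [map_add, hLv]; simp; ring
  have e1 : (L (x + v)) 1 = (L x) 1 + (s + t) * (K + 1) := by rw [map_add, hLv]; simp; ring
  intro hyS
  have h1 := (h.mem_iff _ hyb).1 hyS
  have h2 : γ ((L x) 0) < (L x) 1 := not_le.1 fun hle => hx ((h.mem_iff _ hxb).2 hle)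
  have h3 := h.abs_sub_le hyb hxb
  have h4 : |(L (x + v)) 0 - (L x) 0| ≤ s + t := by
    rw [e0, abs_le]; constructor <;> linarith
  have h5 : (K : ℝ) * |(L (x + v)) 0 - (L x) 0| ≤ K * (s + t) := by gcongr
  have h6 := (abs_le.1 h3).2
  nlinarith

/-- A point of the solid strictly below the graph is interior, by continuity. -/
theorem mem_graph (h : IsChart S p L γ ρ K) (hS : IsClosed S) {x : Plane}
    (hx : x ∈ Metric.ball p ρ) (hxf : x ∈ frontier S) : (L x) 1 = γ ((L x) 0) := by
  have hxS : x ∈ S := hS.frontier_subset hxf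
  refine le_antisymm ((h.mem_iff x hx).1 hxS) (not_lt.1 fun hlt => ?_)
  have hc : Continuous fun y : Plane => γ ((L y) 0) - (L y) 1 :=
    (h.smooth.continuous.comp (by fun_prop)).sub (by fun_prop)
  have : S ∈ 𝓝 x := by
    filter_upwards [Metric.isOpen_ball.mem_nhds hx,
      (hc.tendsto x).eventually (lt_mem_nhds (sub_pos.2 hlt))] with y hy1 hy2
    exact (h.mem_iff y hy1).2 (sub_pos.1 hy2).le
  exact hxf.2 (mem_interior_iff_mem_nhds.2 this)

/-- The graph, as a curve in the plane. -/
noncomputable def curve (L : Plane ≃ₗᵢ[ℝ] Plane) (γ : ℝ → ℝ) (t : ℝ) : Plane := L.symm !₂[t, γ t]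

theorem continuous_curve (h : IsChart S p L γ ρ K) : Continuous (curve L γ) := by
  have : Continuous fun t : ℝ => (!₂[t, γ t] : Plane) :=
    (PiLp.continuous_toLp 2 _).comp (continuous_pi fun i => by
      fin_cases i
      · exact continuous_id
      · exact h.smooth.continuous)
  exact L.symm.continuous.comp this

theorem curve_coord (h : IsChart S p L γ ρ K) (hS : IsClosed S) {x : Plane}
    (hx : x ∈ Metric.ball p ρ) (hxf : x ∈ frontier S) : curve L γ ((L x) 0) = x := by
  rw [curve, ← h.mem_graph hS hx hxf, LinearIsometryEquiv.symm_apply_eq]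
  ext i; fin_cases i <;> simp

theorem lipschitz_curve (h : IsChart S p L γ ρ K) :
    LipschitzOnWith (1 + K) (curve L γ) (Icc ((L p) 0 - ρ) ((L p) 0 + ρ)) := by
  refine LipschitzOnWith.of_dist_le_mul fun s hs t ht => ?_
  rw [curve, curve, LinearIsometryEquiv.dist_map, EuclideanSpace.dist_eq]
  simp only [Fin.sum_univ_two, Matrix.cons_val_zero, Matrix.cons_val_one]
  have h1 := h.lip.dist_le_mul s hs t ht
  refine Real.sqrt_le_iff.2 ⟨by positivity, ?_⟩
  have h2 : dist (γ s) (γ t) ^ 2 ≤ (K * dist s t) ^ 2 := by gcongr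
  push_cast
  nlinarith [mul_nonneg (NNReal.coe_nonneg K) (sq_nonneg (dist s t))]

/-- The boundary inside the chart lies on a Lipschitz curve, and a Lipschitz map increases
one-dimensional Hausdorff measure at most by its constant. This domination replaces an exact formula
for arc length, which is not needed for upper bounds. -/
theorem hausdorffMeasure_le (h : IsChart S p L γ ρ K) (hS : IsClosed S) :
    (Measure.hausdorffMeasure 1 : Measure Plane).restrict (frontier S ∩ Metric.ball p ρ)
      ≤ ((1 + K : ℝ≥0) : ℝ≥0∞) •
        Measure.map (curve L γ) (volume.restrict (Icc ((L p) 0 - ρ) ((L p) 0 + ρ))) := by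
  refine Measure.le_iff.2 fun A hA => ?_
  have hm : Measurable (curve L γ) := h.continuous_curve.measurable
  rw [Measure.restrict_apply hA, Measure.smul_apply, Measure.map_apply hm hA,
    Measure.restrict_apply (hm hA)]
  have hsub : A ∩ (frontier S ∩ Metric.ball p ρ)
      ⊆ curve L γ '' (curve L γ ⁻¹' A ∩ Icc ((L p) 0 - ρ) ((L p) 0 + ρ)) := by
    rintro x ⟨hxA, hxf, hxb⟩
    have e := h.curve_coord hS hxb hxf
    exact ⟨(L x) 0, ⟨by rw [mem_preimage, e]; exact hxA, h.coord_mem hxb⟩, e⟩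
  refine (measure_mono hsub).trans ?_
  refine ((h.lipschitz_curve.mono inter_subset_right).hausdorffMeasure_image_le
    zero_le_one).trans (le_of_eq ?_)
  rw [hausdorffMeasure_real]
  simp

theorem linearIndependent_frame (L : Plane ≃ₗᵢ[ℝ] Plane) :
    LinearIndependent ℝ ![L.symm !₂[1, 0], L.symm !₂[0, 1]] := by
  rw [LinearIndependent.pair_iff]
  intro s t hst
  have h := congrArg L hst
  simp only [map_add, map_smul, LinearIsometryEquiv.apply_symm_apply, map_zero] at h
  have h0 := congrArg (fun v : Plane => v 0) h
  have h1 := congrArg (fun v : Plane => v 1) h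
  simp at h0 h1
  exact ⟨h0, h1⟩

/-- A vertical ray starting on the graph runs above it, hence in the fluid as long as it meets the
support of f. The ray estimate at each boundary point, integrated along the graph, yields the area
integral of |f||∇f|. -/
theorem exists_trace_bound (h : IsChart S p L γ ρ K) (hS : IsClosed S) :
    ∃ C : ℝ≥0∞, C ≠ ⊤ ∧ ∀ f : Plane → ℝ, ContDiff ℝ ∞ f → HasCompactSupport f →
      tsupport f ⊆ Metric.ball p ρ →
      eLpNorm f 2 (arcLength S) ≤ C * h1Norm Sᶜ f (fun j => pd j f) := by
  obtain ⟨c, hc0, hct, hc⟩ := exists_lintegral_coords (linearIndependent_frame L)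
  set e : Plane := L.symm !₂[0, 1] with he
  have he0 : e ≠ 0 := (linearIndependent_frame L).ne_zero 1
  set D : ℝ≥0∞ := ((1 + K : ℝ≥0) : ℝ≥0∞) * (2 * ‖e‖ₑ) * c⁻¹ with hD
  have hDt : D ≠ ⊤ := ENNReal.mul_ne_top (ENNReal.mul_ne_top (by simp) (by finiteness))
    (ENNReal.inv_ne_top.2 hc0)
  refine ⟨D + 1, by simp [hDt], fun f hf hfc hfT => ?_⟩
  have hcurve : ∀ t s : ℝ, curve L γ t + s • e = t • L.symm !₂[1, 0] + (γ t + s) • e := by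
    intro t s
    apply L.injective
    simp only [curve, he, map_add, map_smul, LinearIsometryEquiv.apply_symm_apply]
    ext i; fin_cases i <;> simp
  have hm : Measurable (curve L γ) := h.continuous_curve.measurable
  set k : Plane → ℝ≥0∞ := Sᶜ.indicator (energyDensity f) with hk
  have hkm : Measurable k := (measurable_energyDensity hf).indicator hS.measurableSet.compl
  have hpt : ∀ t : ℝ, ‖f (curve L γ t)‖ₑ ^ 2
      ≤ 2 * ‖e‖ₑ * ∫⁻ s : ℝ, k (t • L.symm !₂[1, 0] + s • e) := by
    intro t
    by_cases ht : curve L γ t ∈ tsupport f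
    swap
    · simp [image_eq_zero_of_notMem_tsupport ht]
    refine (sq_le_lintegral_ray (Ω := Sᶜ) hf hfc he0 (x := curve L γ t) fun s hs hmem => ?_).trans
      (le_of_eq ?_)
    · intro hin
      have h1 := (h.mem_iff _ (hfT hmem)).1 hin
      rw [hcurve] at h1
      simp [he] at h1
      linarith
    · congr 1
      simp only [hcurve]
      -- The integral runs over the entire vertical line, so starting at height γ t is a translation
      -- and does not change it.
      exact lintegral_add_left_eq_self (fun s : ℝ => k (t • L.symm !₂[1, 0] + s • e)) (γ t)
  have hsq : eLpNorm f 2 (arcLength S) ^ 2 ≤ ((D + 1) * h1Norm Sᶜ f (fun j => pd j f)) ^ 2 := by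
    rw [eLpNorm_two_sq]
    have hmf : Measurable fun x => ‖f x‖ₑ ^ 2 := hf.continuous.enorm.measurable.pow_const 2
    calc ∫⁻ x, ‖f x‖ₑ ^ 2 ∂arcLength S
        = ∫⁻ x in frontier S ∩ Metric.ball p ρ, ‖f x‖ₑ ^ 2 ∂(Measure.hausdorffMeasure 1) := by
          rw [arcLength, inter_comm, ← setLIntegral_indicator Metric.isOpen_ball.measurableSet]
          refine lintegral_congr fun x => ?_
          by_cases hx : x ∈ Metric.ball p ρ
          · rw [Set.indicator_of_mem hx]
          · rw [Set.indicator_of_notMem hx,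
              image_eq_zero_of_notMem_tsupport fun hm => hx (hfT hm)]
            simp
      _ ≤ ∫⁻ x, ‖f x‖ₑ ^ 2 ∂(((1 + K : ℝ≥0) : ℝ≥0∞) •
          Measure.map (curve L γ) (volume.restrict (Icc ((L p) 0 - ρ) ((L p) 0 + ρ)))) :=
          lintegral_mono' (h.hausdorffMeasure_le hS) le_rfl
      _ = ((1 + K : ℝ≥0) : ℝ≥0∞) *
          ∫⁻ t in Icc ((L p) 0 - ρ) ((L p) 0 + ρ), ‖f (curve L γ t)‖ₑ ^ 2 := by
          rw [lintegral_smul_measure, lintegral_map hmf hm, smul_eq_mul]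
      _ ≤ ((1 + K : ℝ≥0) : ℝ≥0∞) *
          ∫⁻ t : ℝ, 2 * ‖e‖ₑ * ∫⁻ s : ℝ, k (t • L.symm !₂[1, 0] + s • e) := by
          exact mul_le_mul_right ((setLIntegral_le_lintegral _ _).trans (lintegral_mono hpt)) _
      _ = ((1 + K : ℝ≥0) : ℝ≥0∞) * (2 * ‖e‖ₑ) * (c⁻¹ * (c * ∫⁻ s : ℝ, ∫⁻ t : ℝ,
          k (t • L.symm !₂[1, 0] + s • e))) := by
          have hp : Measurable fun q : ℝ × ℝ => k (q.1 • L.symm !₂[1, 0] + q.2 • e) :=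
            hkm.comp (by fun_prop)
          rw [lintegral_const_mul _ hp.lintegral_prod_right', ← mul_assoc c⁻¹,
            ENNReal.inv_mul_cancel hc0 hct, one_mul, lintegral_lintegral_swap hp.aemeasurable]
          ring
      _ = D * ∫⁻ x in Sᶜ, energyDensity f x := by
          rw [← hc k hkm, hk, lintegral_indicator hS.measurableSet.compl, hD]; ring
      _ ≤ (D + 1) ^ 2 * h1Norm Sᶜ f (fun j => pd j f) ^ 2 :=
          mul_le_mul' (le_self_add.trans (le_self_pow₀ le_add_self (by norm_num)))
            (lintegral_energyDensity_le _ hf)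
      _ = _ := by ring
  exact (ENNReal.pow_le_pow_left_iff (by norm_num)).1 hsq

end IsChart

theorem IsBody.isCompact_frontier {S : Set Plane} (hS : IsBody S) : IsCompact (frontier S) :=
  Metric.isCompact_of_isClosed_isBounded isClosed_frontier
    (hS.isBounded.subset hS.isClosed.frontier_subset)

theorem IsBody.hausdorffMeasure_frontier_lt_top {S : Set Plane} (hS : IsBody S) :
    (Measure.hausdorffMeasure 1 : Measure Plane) (frontier S) < ⊤ := by
  refine hS.isCompact_frontier.measure_lt_top_of_nhdsWithin fun p hp => ?_
  obtain ⟨L, γ, ρ, K, h⟩ := hS.exists_chart hp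
  refine ⟨frontier S ∩ Metric.ball p ρ,
    inter_mem_nhdsWithin _ (Metric.ball_mem_nhds p h.pos), ?_⟩
  have h1 := Measure.le_iff'.1 (h.hausdorffMeasure_le hS.isClosed) univ
  rw [Measure.restrict_apply_univ] at h1
  refine h1.trans_lt ?_
  rw [Measure.smul_apply, Measure.map_apply h.continuous_curve.measurable .univ, preimage_univ,
    Measure.restrict_apply_univ, Real.volume_Icc, smul_eq_mul]
  exact ENNReal.mul_lt_top (by simp) (by simp)

theorem IsBody.isFiniteMeasure_arcLength {S : Set Plane} (hS : IsBody S) :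
    IsFiniteMeasure (arcLength S) :=
  ⟨by rw [arcLength, Measure.restrict_apply_univ]; exact hS.hausdorffMeasure_frontier_lt_top⟩

/-- A set of finite one-dimensional Hausdorff measure is null for the two-dimensional one, of which
the area is a multiple. -/
theorem IsBody.volume_frontier {S : Set Plane} (hS : IsBody S) : volume (frontier S) = 0 := by
  have h2 : (Measure.hausdorffMeasure 2 : Measure Plane) (frontier S) = 0 :=
    (Measure.hausdorffMeasure_zero_or_top (by norm_num : (1 : ℝ) < 2) (frontier S)).resolve_right
      hS.hausdorffMeasure_frontier_lt_top.ne
  have hH : (Measure.hausdorffMeasure 2 : Measure Plane).IsAddHaarMeasure := by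
    have := isAddHaarMeasure_hausdorffMeasure (E := Plane)
    simpa using this
  have := Measure.isAddLeftInvariant_eq_smul (volume : Measure Plane) (Measure.hausdorffMeasure 2)
  rw [this, Measure.smul_apply, h2, smul_zero]

/-- Finitely many half-radius chart balls cover the compact boundary and, together with the fluid
domain itself, the closure of the fluid domain. A partition of unity subordinate to this cover has
one member away from the solid, indexed by `none`, and one for each chart. The trace bound is
recorded for the same partition so that both inequalities share the localization. -/
theorem IsBody.exists_conePartition {S : Set Plane} (hS : IsBody S) :
    ∃ (ι : Type) (_ : Fintype ι) (χ : ι → Plane → ℝ) (a b : ι → Plane), ConePartition Sᶜ χ a b ∧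
      ∀ i, ∃ C : ℝ≥0∞, C ≠ ⊤ ∧ ∀ f : Plane → ℝ, ContDiff ℝ ∞ f → HasCompactSupport f →
        tsupport f ⊆ tsupport (χ i) →
        eLpNorm f 2 (arcLength S) ≤ C * h1Norm Sᶜ f (fun j => pd j f) := by
  classical
  choose! L γ ρ K hch using fun p hp => hS.exists_chart (p := p) hp
  obtain ⟨t, ht, hcov⟩ := hS.isCompact_frontier.elim_nhds_subcover
    (fun p => Metric.ball p (ρ p / 2)) fun p hp => Metric.ball_mem_nhds p (half_pos (hch p hp).pos)
  let U : Option t → Set Plane := fun i => i.elim Sᶜ fun p => Metric.ball (p : Plane) (ρ p / 2)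
  obtain ⟨g, hg⟩ := SmoothPartitionOfUnity.exists_isSubordinate (modelWithCornersSelf ℝ Plane)
    (isClosed_closure (s := Sᶜ)) U
    (fun i => by cases i with
      | none => exact hS.isClosed.isOpen_compl
      | some p => exact Metric.isOpen_ball)
    (fun x hx => by
      rw [mem_iUnion]
      by_cases hxS : x ∈ S
      · have hxf : x ∈ frontier S := by
          rw [hS.isClosed.frontier_eq]
          refine ⟨hxS, ?_⟩
          rw [closure_compl] at hx
          exact hx
        obtain ⟨p, hp, hxp⟩ := mem_iUnion₂.1 (hcov hxf)
        exact ⟨some ⟨p, hp⟩, hxp⟩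
      · exact ⟨none, hxS⟩)
  have hsm : ∀ i, ContDiff ℝ ∞ (g i) := fun i => (g i).contMDiff.contDiff
  have hsum : ∀ x ∈ closure Sᶜ, ∑ i, g i x = 1 := fun x hx => by
    rw [← finsum_eq_sum_of_fintype]; exact g.sum_eq_one hx
  have hcomp : ∀ p : t, HasCompactSupport (g (some p)) := fun p =>
    (isCompact_closedBall (p : Plane) (ρ p / 2)).of_isClosed_subset (isClosed_tsupport _)
      ((hg (some p)).trans Metric.ball_subset_closedBall)
  have hbd : ∀ p : t, BoundedC1 (g (some p)) := fun p => boundedC1_of_compact (hsm _) (hcomp p)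
  refine ⟨Option t, inferInstance, fun i => g i, 
    fun i => i.elim (EuclideanSpace.single 0 1) fun p => IsChart.edge (L p) (K p) 1,
    fun i => i.elim (EuclideanSpace.single 1 1) fun p => IsChart.edge (L p) (K p) (-1),
    ⟨fun i => ?_, hsum, fun i => ?_, fun i => ?_⟩, fun i => ?_⟩
  · cases i with
    | some p => exact hbd p
    | none =>
      refine ⟨hsm _, ⟨1, fun x => ?_⟩, fun j => ?_⟩
      · rw [Real.norm_of_nonneg (g.nonneg _ _)]; exact g.le_one _ _
      -- The member `none` is not compactly supported. Its gradient is bounded because in the fluid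
      -- it is minus the sum of the gradients of the others, and elsewhere it vanishes.
      · choose D hD using fun p => (hbd p).bound_pd j
        refine ⟨∑ p, |D p|, fun x => ?_⟩
        by_cases hx : x ∈ Sᶜ
        · have h0 : ∑ i, pd j (g i) x = 0 := by
            rw [← pd_sum _ (fun i => (hsm i).differentiable_infty) j x]
            have : (fun y => ∑ i, g i y) =ᶠ[𝓝 x] fun _ => 1 := by
              filter_upwards [hS.isClosed.isOpen_compl.mem_nhds hx] with y hy
                using hsum y (subset_closure hy)
            rw [pd, this.fderiv_eq]; simp
          rw [Fintype.sum_option] at h0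
          rw [eq_neg_of_add_eq_zero_left h0, norm_neg]
          exact (norm_sum_le _ _).trans (Finset.sum_le_sum fun p _ => (hD p x).trans (le_abs_self _))
        · rw [pd_eq_zero_of_notMem fun h => hx (hg none h), norm_zero]
          positivity
  · cases i with
    | some p => exact IsChart.linearIndependent_edge _ _
    | none =>
      rw [LinearIndependent.pair_iff]
      intro s t hst
      exact ⟨by simpa using congrArg (fun v : Plane => v 0) hst,
        by simpa using congrArg (fun v : Plane => v 1) hst⟩
  · cases i with
    | some p => exact (hch p (ht p p.2)).coneCondition (hg (some p))
    -- The support lies in the fluid domain, so the condition holds for any pair of directions and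
    -- any δ.
    | none => exact ⟨1, one_pos, fun x _ s t _ _ hy _ => hg none hy⟩
  · cases i with
    | some p =>
      obtain ⟨C, hC, hb⟩ := (hch p (ht p p.2)).exists_trace_bound hS.isClosed
      exact ⟨C, hC, fun f hf hc hs => hb f hf hc ((hs.trans (hg (some p))).trans
        (Metric.ball_subset_ball (by linarith [(hch p (ht p p.2)).pos])))⟩
    | none =>
      refine ⟨0, by simp, fun f hf hc hs => ?_⟩
      rw [zero_mul, nonpos_iff_eq_zero]
      have : f =ᵐ[arcLength S] 0 := by
        filter_upwards [ae_restrict_mem isClosed_frontier.measurableSet] with x hx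
        exact image_eq_zero_of_notMem_tsupport fun h => hg none (hs h)
          (hS.isClosed.frontier_subset hx)
      rw [eLpNorm_congr_ae this, eLpNorm_zero]

/-! ### Limits of smooth functions in `H¹` -/

theorem h1Norm_congr {Ω : Set Plane} {φ φ' : Plane → ℝ} {G G' : Fin 2 → Plane → ℝ}
    (h1 : φ =ᵐ[volume.restrict Ω] φ') (h2 : ∀ j, G j =ᵐ[volume.restrict Ω] G' j) :
    h1Norm Ω φ G = h1Norm Ω φ' G' := by
  simp only [h1Norm, eLpNorm_congr_ae h1, fun j => eLpNorm_congr_ae (p := 2) (h2 j)]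

theorem h1Norm_add_le {Ω : Set Plane} {φ φ' : Plane → ℝ} {G G' : Fin 2 → Plane → ℝ}
    (hm : AEStronglyMeasurable φ (volume.restrict Ω))
    (hG : ∀ j, AEStronglyMeasurable (G j) (volume.restrict Ω))
    (hm' : AEStronglyMeasurable φ' (volume.restrict Ω))
    (hG' : ∀ j, AEStronglyMeasurable (G' j) (volume.restrict Ω)) :
    h1Norm Ω (φ + φ') (G + G') ≤ h1Norm Ω φ G + h1Norm Ω φ' G' := by
  calc h1Norm Ω (φ + φ') (G + G')
      ≤ (eLpNorm φ 2 (volume.restrict Ω) + eLpNorm φ' 2 (volume.restrict Ω)) +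
        ∑ j, (eLpNorm (G j) 2 (volume.restrict Ω) + eLpNorm (G' j) 2 (volume.restrict Ω)) :=
        add_le_add (eLpNorm_add_le hm hm' (by norm_num))
          (Finset.sum_le_sum fun j _ => eLpNorm_add_le (hG j) (hG' j) (by norm_num))
    _ = _ := by rw [Finset.sum_add_distrib, h1Norm, h1Norm]; ring

theorem h1Norm_smul (Ω : Set Plane) (c : ℝ) (φ : Plane → ℝ) (G : Fin 2 → Plane → ℝ) :
    h1Norm Ω (c • φ) (c • G) = ‖c‖ₑ * h1Norm Ω φ G := by
  simp only [h1Norm, Pi.smul_apply, eLpNorm_const_smul, mul_add, Finset.mul_sum]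

/-- `H¹` convergence in `Ω` of smooth compactly supported functions. -/
structure SmoothLimit (Ω : Set Plane) (f : ℕ → Plane → ℝ) (φ : Plane → ℝ)
    (G : Fin 2 → Plane → ℝ) : Prop where
  smooth : ∀ n, ContDiff ℝ ∞ (f n)
  compact : ∀ n, HasCompactSupport (f n)
  tendsto : Tendsto (fun n => h1Norm Ω (f n - φ) (fun j => pd j (f n) - G j)) atTop (𝓝 0)
  meas : AEStronglyMeasurable φ (volume.restrict Ω)
  meas_grad : ∀ j, AEStronglyMeasurable (G j) (volume.restrict Ω)

theorem SmoothLimit.of_tendsto {Ω : Set Plane} {f : ℕ → Plane → ℝ} {φ : Plane → ℝ}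
    {G : Fin 2 → Plane → ℝ} (h1 : ∀ n, ContDiff ℝ ∞ (f n)) (h2 : ∀ n, HasCompactSupport (f n))
    (h3 : Tendsto (fun n => eLpNorm (f n - φ) 2 (volume.restrict Ω)) atTop (𝓝 0))
    (h4 : ∀ j, Tendsto (fun n => eLpNorm (pd j (f n) - G j) 2 (volume.restrict Ω)) atTop (𝓝 0))
    (h5 : AEStronglyMeasurable φ (volume.restrict Ω))
    (h6 : ∀ j, AEStronglyMeasurable (G j) (volume.restrict Ω)) : SmoothLimit Ω f φ G :=
  ⟨h1, h2, by simpa [h1Norm] using h3.add (tendsto_finsetSum Finset.univ fun j _ => h4 j), h5, h6⟩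

theorem SmoothLimit.tendsto_fun {Ω : Set Plane} {f : ℕ → Plane → ℝ} {φ : Plane → ℝ}
    {G : Fin 2 → Plane → ℝ} (h : SmoothLimit Ω f φ G) :
    Tendsto (fun n => eLpNorm (f n - φ) 2 (volume.restrict Ω)) atTop (𝓝 0) :=
  tendsto_of_tendsto_of_tendsto_of_le_of_le tendsto_const_nhds h.tendsto (fun _ => zero_le)
    fun _ => le_self_add

theorem SmoothLimit.tendsto_pd {Ω : Set Plane} {f : ℕ → Plane → ℝ} {φ : Plane → ℝ}
    {G : Fin 2 → Plane → ℝ} (h : SmoothLimit Ω f φ G) (j : Fin 2) :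
    Tendsto (fun n => eLpNorm (pd j (f n) - G j) 2 (volume.restrict Ω)) atTop (𝓝 0) :=
  tendsto_of_tendsto_of_tendsto_of_le_of_le tendsto_const_nhds h.tendsto (fun _ => zero_le)
    fun n => (Finset.single_le_sum (f := fun j => eLpNorm (pd j (f n) - G j) 2 (volume.restrict Ω))
      (fun _ _ => zero_le) (Finset.mem_univ j)).trans le_add_self

theorem Approx.exists_smoothLimit {Ω : Set Plane} {φ : Plane → ℝ} {G : Fin 2 → Plane → ℝ}
    (h : Approx Ω φ G) (h5 : AEStronglyMeasurable φ (volume.restrict Ω))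
    (h6 : ∀ j, AEStronglyMeasurable (G j) (volume.restrict Ω)) : ∃ f, SmoothLimit Ω f φ G := by
  choose f h1 h2 h3 h4 using fun n : ℕ => h ((n : ℝ≥0∞) + 1)⁻¹
    (ENNReal.inv_ne_zero.2 (by finiteness))
  have ht : Tendsto (fun n : ℕ => ((n : ℝ≥0∞) + 1)⁻¹) atTop (𝓝 0) := by
    have := (tendsto_add_atTop_iff_nat 1).2 ENNReal.tendsto_inv_nat_nhds_zero
    simpa using this
  exact ⟨f, .of_tendsto h1 h2
    (tendsto_of_tendsto_of_tendsto_of_le_of_le tendsto_const_nhds ht (fun _ => zero_le) h3)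
    (fun j => tendsto_of_tendsto_of_tendsto_of_le_of_le tendsto_const_nhds ht (fun _ => zero_le)
      fun n => h4 n j) h5 h6⟩

/-- A bound for smooth functions extends to limits. -/
theorem SmoothLimit.le_of_tendsto {Ω : Set Plane} {f : ℕ → Plane → ℝ} {φ γ : Plane → ℝ}
    {G : Fin 2 → Plane → ℝ} (h : SmoothLimit Ω f φ G) {μ : Measure Plane} {p : ℝ≥0∞}
    (hp : 1 ≤ p) {C : ℝ≥0∞} (hC : C ≠ ⊤)
    (hb : ∀ f : Plane → ℝ, ContDiff ℝ ∞ f → HasCompactSupport f →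
      eLpNorm f p μ ≤ C * h1Norm Ω f (fun j => pd j f)) (hγm : AEStronglyMeasurable γ μ)
    (hγ : Tendsto (fun n => eLpNorm (f n - γ) p μ) atTop (𝓝 0)) :
    eLpNorm γ p μ ≤ C * h1Norm Ω φ G := by
  have hle : ∀ n, eLpNorm γ p μ ≤ eLpNorm (f n - γ) p μ
      + C * (h1Norm Ω φ G + h1Norm Ω (f n - φ) (fun j => pd j (f n) - G j)) := fun n => by
    have h1 : eLpNorm γ p μ ≤ eLpNorm (f n - γ) p μ + eLpNorm (f n) p μ := by
      have := eLpNorm_sub_le (p := p) (h.smooth n).continuous.aestronglyMeasurable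
        ((h.smooth n).continuous.aestronglyMeasurable.sub hγm) hp
      rw [sub_sub_cancel] at this
      rwa [add_comm]
    have h2 : h1Norm Ω (f n) (fun j => pd j (f n))
        ≤ h1Norm Ω φ G + h1Norm Ω (f n - φ) (fun j => pd j (f n) - G j) := by
      refine le_trans (le_of_eq ?_) (h1Norm_add_le h.meas h.meas_grad
        ((h.smooth n).continuous.aestronglyMeasurable.sub h.meas) fun j =>
        (contDiff_pd (h.smooth n) j).continuous.aestronglyMeasurable.sub (h.meas_grad j))
      congr 1
      · simp
      · ext j x; simp
    exact h1.trans (add_le_add le_rfl ((hb _ (h.smooth n) (h.compact n)).trans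
      (mul_le_mul_right h2 _)))
  have ht : Tendsto (fun n => eLpNorm (f n - γ) p μ
      + C * (h1Norm Ω φ G + h1Norm Ω (f n - φ) (fun j => pd j (f n) - G j))) atTop
      (𝓝 (0 + C * (h1Norm Ω φ G + 0))) :=
    hγ.add (ENNReal.Tendsto.const_mul (tendsto_const_nhds.add h.tendsto) (Or.inr hC))
  rw [zero_add, add_zero] at ht
  exact ge_of_tendsto' ht hle

theorem SmoothLimit.cauchy {Ω : Set Plane} {f : ℕ → Plane → ℝ} {φ : Plane → ℝ}
    {G : Fin 2 → Plane → ℝ} (h : SmoothLimit Ω f φ G) (n m : ℕ) :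
    h1Norm Ω (f n - f m) (fun j => pd j (f n - f m))
      ≤ h1Norm Ω (f n - φ) (fun j => pd j (f n) - G j)
        + h1Norm Ω (f m - φ) (fun j => pd j (f m) - G j) := by
  have hmeas : ∀ n, AEStronglyMeasurable (f n - φ) (volume.restrict Ω) := fun n =>
    (h.smooth n).continuous.aestronglyMeasurable.sub h.meas
  have hmeas' : ∀ n j, AEStronglyMeasurable (pd j (f n) - G j) (volume.restrict Ω) := fun n j =>
    (contDiff_pd (h.smooth n) j).continuous.aestronglyMeasurable.sub (h.meas_grad j)
  have e : h1Norm Ω (f m - φ) (fun j => pd j (f m) - G j)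
      = h1Norm Ω (φ - f m) (fun j => G j - pd j (f m)) := by
    simp only [h1Norm]
    rw [eLpNorm_sub_comm]
    simp only [fun j => eLpNorm_sub_comm (pd j (f m)) (G j) 2 (volume.restrict Ω)]
  rw [e]
  refine le_trans (le_of_eq ?_) (h1Norm_add_le (hmeas n) (hmeas' n)
    (φ' := φ - f m) (G' := fun j => G j - pd j (f m))
    (h.meas.sub (h.smooth m).continuous.aestronglyMeasurable) fun j =>
      (h.meas_grad j).sub (contDiff_pd (h.smooth m) j).continuous.aestronglyMeasurable)
  congr 1
  · simp
  · ext j x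
    have := pd_sub (h.smooth n).differentiable_infty (h.smooth m).differentiable_infty j x
    simp only [Pi.add_apply, Pi.sub_apply, sub_add_sub_cancel]
    exact this

/-- If smooth functions are bounded in `L^p(μ)` by their `H¹` norm, then limits in `H¹` give limits
in `L^p(μ)`. -/
theorem SmoothLimit.exists_limit {Ω : Set Plane} {f : ℕ → Plane → ℝ} {φ : Plane → ℝ}
    {G : Fin 2 → Plane → ℝ} (h : SmoothLimit Ω f φ G) {μ : Measure Plane} [IsFiniteMeasureOnCompacts μ] {p : ℝ≥0∞}
    [hp : Fact (1 ≤ p)] {C : ℝ≥0∞} (hC : C ≠ ⊤)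
    (hb : ∀ f : Plane → ℝ, ContDiff ℝ ∞ f → HasCompactSupport f →
      eLpNorm f p μ ≤ C * h1Norm Ω f (fun j => pd j f)) :
    ∃ γ, MemLp γ p μ ∧ Tendsto (fun n => eLpNorm (f n - γ) p μ) atTop (𝓝 0) := by
  have hm : ∀ n, MemLp (f n) p μ := fun n =>
    (h.smooth n).continuous.memLp_of_hasCompactSupport (h.compact n)
  have hcs : CauchySeq fun n => (hm n).toLp (f n) := by
    rw [EMetric.cauchySeq_iff]
    intro ε hε
    have ht : Tendsto (fun n => C * h1Norm Ω (f n - φ) (fun j => pd j (f n) - G j)) atTop (𝓝 0) := by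
      simpa using ENNReal.Tendsto.const_mul h.tendsto (Or.inr hC)
    have hε3 : 0 < ε / 2 := ENNReal.half_pos hε.ne'
    obtain ⟨N, hN⟩ := eventually_atTop.1 (ht.eventually (gt_mem_nhds hε3))
    refine ⟨N, fun m hmN n hnN => ?_⟩
    rw [Lp.edist_toLp_toLp]
    calc _ ≤ C * h1Norm Ω (f m - f n) (fun j => pd j (f m - f n)) :=
          hb _ ((h.smooth m).sub (h.smooth n)) ((h.compact m).sub (h.compact n))
      _ ≤ _ := mul_le_mul_right (h.cauchy m n) _
      _ < ε / 2 + ε / 2 := by rw [mul_add]; exact ENNReal.add_lt_add (hN m hmN) (hN n hnN)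
      _ = ε := ENNReal.add_halves ε
  obtain ⟨γ, hγ⟩ := cauchySeq_tendsto_of_complete hcs
  refine ⟨γ, Lp.memLp γ, ?_⟩
  rw [Lp.tendsto_Lp_iff_tendsto_eLpNorm'] at hγ
  refine hγ.congr fun n => eLpNorm_congr_ae ?_
  filter_upwards [(hm n).coeFn_toLp] with x hx
  simp [hx]

/-- The case of `L^p(Ω)`. -/
theorem SmoothLimit.tendsto_eLpNorm {Ω : Set Plane} {f : ℕ → Plane → ℝ} {φ : Plane → ℝ}
    {G : Fin 2 → Plane → ℝ} (h : SmoothLimit Ω f φ G) {p : ℝ≥0∞}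
    [hp : Fact (1 ≤ p)] {C : ℝ≥0∞} (hC : C ≠ ⊤)
    (hb : ∀ f : Plane → ℝ, ContDiff ℝ ∞ f → HasCompactSupport f →
      eLpNorm f p (volume.restrict Ω) ≤ C * h1Norm Ω f (fun j => pd j f)) :
    MemLp φ p (volume.restrict Ω) ∧
      Tendsto (fun n => eLpNorm (f n - φ) p (volume.restrict Ω)) atTop (𝓝 0) := by
  obtain ⟨γ, hγ, ht⟩ := h.exists_limit hC hb
  -- Both the L^p limit and the L² limit are limits in measure, hence equal almost everywhere.
  have h1 : TendstoInMeasure (volume.restrict Ω) f atTop γ :=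
    tendstoInMeasure_of_tendsto_eLpNorm (by have := hp.out; positivity)
      (fun n => (h.smooth n).continuous.aestronglyMeasurable) hγ.1 ht
  have h2 : TendstoInMeasure (volume.restrict Ω) f atTop φ :=
    tendstoInMeasure_of_tendsto_eLpNorm (by norm_num : (2 : ℝ≥0∞) ≠ 0)
      (fun n => (h.smooth n).continuous.aestronglyMeasurable) h.meas h.tendsto_fun
  have e : γ =ᵐ[volume.restrict Ω] φ := tendstoInMeasure_ae_unique h1 h2
  refine ⟨hγ.ae_eq e, ht.congr fun n => eLpNorm_congr_ae ?_⟩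
  filter_upwards [e] with x hx
  simp [hx]

theorem SmoothLimit.add {Ω : Set Plane} {f f' : ℕ → Plane → ℝ} {φ φ' : Plane → ℝ}
    {G G' : Fin 2 → Plane → ℝ} (h : SmoothLimit Ω f φ G) (h' : SmoothLimit Ω f' φ' G') :
    SmoothLimit Ω (fun n => f n + f' n) (φ + φ') (G + G') where
  smooth n := (h.smooth n).add (h'.smooth n)
  compact n := (h.compact n).add (h'.compact n)
  meas := h.meas.add h'.meas
  meas_grad j := (h.meas_grad j).add (h'.meas_grad j)
  tendsto := by
    refine tendsto_of_tendsto_of_tendsto_of_le_of_le tendsto_const_nhds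
      (by simpa using h.tendsto.add h'.tendsto) (fun _ => zero_le) fun n => ?_
    refine le_trans (le_of_eq ?_) (h1Norm_add_le
      ((h.smooth n).continuous.aestronglyMeasurable.sub h.meas)
      (fun j => (contDiff_pd (h.smooth n) j).continuous.aestronglyMeasurable.sub (h.meas_grad j))
      ((h'.smooth n).continuous.aestronglyMeasurable.sub h'.meas)
      fun j => (contDiff_pd (h'.smooth n) j).continuous.aestronglyMeasurable.sub (h'.meas_grad j))
    congr 1
    · abel
    · ext j x
      have := pd_add (h.smooth n).differentiable_infty (h'.smooth n).differentiable_infty j x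
      simp only [Pi.add_apply, Pi.sub_apply]
      rw [show pd j (f n + f' n) x = _ from this]; ring

theorem SmoothLimit.smul {Ω : Set Plane} {f : ℕ → Plane → ℝ} {φ : Plane → ℝ}
    {G : Fin 2 → Plane → ℝ} (h : SmoothLimit Ω f φ G) (c : ℝ) :
    SmoothLimit Ω (fun n => c • f n) (c • φ) (c • G) where
  smooth n := contDiff_const.smul (h.smooth n)
  compact n := (h.compact n).smul_left (f := fun _ => c)
  meas := h.meas.const_smul c
  meas_grad j := (h.meas_grad j).const_smul c
  tendsto := by
    have h1 := ENNReal.Tendsto.const_mul h.tendsto (a := ‖c‖ₑ) (Or.inr enorm_ne_top)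
    rw [mul_zero] at h1
    refine h1.congr fun n => ?_
    rw [← h1Norm_smul]
    congr 1
    · rw [smul_sub]
    · ext j x
      have := pd_const_mul (h.smooth n).differentiable_infty c j x
      simp only [Pi.smul_apply, Pi.sub_apply, smul_eq_mul]
      rw [show pd j (c • f n) x = _ from this]; ring

theorem SmoothLimit.congr {Ω : Set Plane} {f : ℕ → Plane → ℝ} {φ φ' : Plane → ℝ}
    {G G' : Fin 2 → Plane → ℝ} (h : SmoothLimit Ω f φ G) (h1 : φ =ᵐ[volume.restrict Ω] φ')
    (h2 : ∀ j, G j =ᵐ[volume.restrict Ω] G' j) : SmoothLimit Ω f φ' G' where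
  smooth := h.smooth
  compact := h.compact
  meas := h.meas.congr h1
  meas_grad j := (h.meas_grad j).congr (h2 j)
  tendsto := h.tendsto.congr fun n => h1Norm_congr
    (by filter_upwards [h1] with x hx; simp [hx])
    fun j => by filter_upwards [h2 j] with x hx; simp [hx]

/-! ### Rigid fields -/

@[simp] theorem perp_zero_apply (x : Plane) : perp x 0 = -x 1 := by simp [perp]

@[simp] theorem perp_one_apply (x : Plane) : perp x 1 = x 0 := by simp [perp]

theorem perp_add (x y : Plane) : perp (x + y) = perp x + perp y := by
  ext i; fin_cases i <;> simp [add_comm]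

theorem perp_smul (c : ℝ) (x : Plane) : perp (c • x) = c • perp x := by
  ext i; fin_cases i <;> simp

theorem continuous_perp : Continuous perp := by
  have : perp = fun x => (WithLp.toLp 2 ![-(x 1), x 0] : Plane) := rfl
  rw [this]
  exact (PiLp.continuous_toLp 2 _).comp (continuous_pi fun i => by fin_cases i <;> simp <;> fun_prop)

theorem norm_perp (x : Plane) : ‖perp x‖ = ‖x‖ := by
  simp [EuclideanSpace.norm_eq, Fin.sum_univ_two, add_comm]

theorem continuous_rigidField (p : Plane × ℝ) : Continuous (rigidField p) :=
  continuous_const.add (continuous_perp.const_smul p.2)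

theorem inner_eq_sum (x y : Plane) : inner ℝ x y = x 0 * y 0 + x 1 * y 1 := by
  simp [PiLp.inner_apply, Fin.sum_univ_two]; ring

theorem rigidField_injective_of_eqOn {p q : Plane × ℝ} {U : Set Plane} (hU : IsOpen U)
    (hne : U.Nonempty) (h : ∀ x ∈ U, rigidField p x = rigidField q x) : p = q := by
  obtain ⟨x, hx⟩ := hne
  obtain ⟨ε, hε, hb⟩ := Metric.isOpen_iff.1 hU x hx
  have hy : x + EuclideanSpace.single 0 (ε / 2) ∈ U := hb (by
    simp [Metric.mem_ball, dist_eq_norm, abs_of_pos hε]; linarith)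
  have h1 := h x hx
  have h2 := h _ hy
  have a1 := congrArg (fun v : Plane => v 1) h1
  have a2 := congrArg (fun v : Plane => v 1) h2
  simp [rigidField] at a1 a2
  have hr : p.2 = q.2 := by
    have : (p.2 - q.2) * (ε / 2) = 0 := by linarith
    rcases mul_eq_zero.1 this with h | h
    · linarith
    · linarith
  refine Prod.ext ?_ hr
  simpa [rigidField, hr] using h1

/-- A field on a ball which preserves distances to first order is rigid. -/
theorem exists_rigidField_of_inner_eq_zero {F : Plane → Plane} {c : Plane} {r : ℝ} (hr : 0 < r)
    (h : ∀ x ∈ Metric.ball c r, ∀ y ∈ Metric.ball c r, inner ℝ (F x - F y) (x - y) = 0) :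
    ∃ p, ∀ x ∈ Metric.ball c r, F x = rigidField p x := by
  set d := r / 2 with hd
  have hd0 : 0 < d := half_pos hr
  have hc : c ∈ Metric.ball c r := Metric.mem_ball_self hr
  have h1 : ∀ i, c + EuclideanSpace.single i d ∈ Metric.ball c r := fun i => by
    simp [Metric.mem_ball, dist_eq_norm, abs_of_pos hr, hd, hr]
  have e1 := h _ (h1 0) _ hc
  have e2 := h _ (h1 1) _ hc
  have e3 := h _ (h1 0) _ (h1 1)
  simp [inner_eq_sum] at e1 e2 e3
  set A := F c
  set A1 := F (c + EuclideanSpace.single 0 d)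
  set A2 := F (c + EuclideanSpace.single 1 d)
  -- The three pairs among c and its two displaced neighbours give the two diagonal entries and the
  -- antisymmetry of the discrete gradient; w₀ is the angular velocity.
  have a1 : A1 0 = A 0 := by
    rcases e1 with e | e
    · linarith
    · exact absurd e hd0.ne'
  have a2 : A2 1 = A 1 := by
    rcases e2 with e | e
    · linarith
    · exact absurd e hd0.ne'
  set w₀ := (A1 1 - A 1) / d with hw₀
  have a3 : A1 1 = A 1 + w₀ * d := by rw [hw₀]; field_simp; ring
  have a4 : A2 0 = A 0 - w₀ * d := by
    have : d * (A2 0 - (A 0 - w₀ * d)) = 0 := by rw [a1, a2, a3] at e3; linarith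
    rcases mul_eq_zero.1 this with e | e
    · exact absurd e hd0.ne'
    · linarith
  refine ⟨(A - w₀ • perp c, w₀), fun x hx => ?_⟩
  -- For general x, subtracting the condition at a displaced neighbour from the condition at c
  -- isolates one component of F x.
  have f0 := h _ hx _ hc
  have f1 := h _ hx _ (h1 0)
  have f2 := h _ hx _ (h1 1)
  simp [inner_eq_sum] at f0 f1 f2
  ext i
  fin_cases i
  · simp [rigidField]
    have : d * (F x 0 - (A 0 + w₀ * c 1 + -(w₀ * x 1))) = 0 := by
      change (F x 0 - A1 0) * _ + (F x 1 - A1 1) * _ = 0 at f1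
      rw [a1, a3] at f1
      linear_combination f0 - f1
    rcases mul_eq_zero.1 this with e | e
    · exact absurd e hd0.ne'
    · linarith
  · simp [rigidField]
    have : d * (F x 1 - (A 1 - w₀ * c 0 + w₀ * x 0)) = 0 := by
      change (F x 0 - A2 0) * _ + (F x 1 - A2 1) * _ = 0 at f2
      rw [a2, a4] at f2
      linear_combination f0 - f2
    rcases mul_eq_zero.1 this with e | e
    · exact absurd e hd0.ne'
    · linarith

theorem fderiv_apply_eq_sum (f : Plane → ℝ) (x v : Plane) :
    fderiv ℝ f x v = pd 0 f x * v 0 + pd 1 f x * v 1 := by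
  have hv : v = v 0 • EuclideanSpace.single 0 (1 : ℝ) + v 1 • EuclideanSpace.single 1 (1 : ℝ) := by
    ext i; fin_cases i <;> simp
  conv_lhs => rw [hv]
  rw [map_add, map_smul, map_smul, pd, pd, smul_eq_mul, smul_eq_mul]
  ring

/-- A smooth field without strain preserves distances to first order. -/
theorem inner_sub_eq_zero_of_strain {f : Fin 2 → Plane → ℝ} (hf : ∀ i, Differentiable ℝ (f i))
    {x y : Plane} (h : ∀ z ∈ segment ℝ y x, ∀ i j, pd j (f i) z + pd i (f j) z = 0) :
    (f 0 x - f 0 y) * (x 0 - y 0) + (f 1 x - f 1 y) * (x 1 - y 1) = 0 := by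
  set v := x - y with hv
  let g : ℝ → ℝ := fun t => f 0 (y + t • v) * v 0 + f 1 (y + t • v) * v 1
  have hg : ∀ t, HasDerivAt g (fderiv ℝ (f 0) (y + t • v) v * v 0
      + fderiv ℝ (f 1) (y + t • v) v * v 1) t := fun t => by
    have h1 : HasDerivAt (fun t : ℝ => y + t • v) v t := by
      simpa using ((hasDerivAt_id t).smul_const v).const_add y
    exact (((hf 0 _).hasFDerivAt.comp_hasDerivAt t h1).mul_const _).add
      (((hf 1 _).hasFDerivAt.comp_hasDerivAt t h1).mul_const _)
  have hz : ∀ t ∈ Ico (0 : ℝ) 1, HasDerivWithinAt g 0 (Ici t) t := fun t ht => by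
    have hseg : y + t • v ∈ segment ℝ y x := by
      rw [segment_eq_image']
      exact ⟨t, ⟨ht.1, ht.2.le⟩, rfl⟩
    have := (hg t).hasDerivWithinAt (s := Ici t)
    rw [fderiv_apply_eq_sum, fderiv_apply_eq_sum] at this
    refine this.congr_deriv ?_
    have h00 := h _ hseg 0 0
    have h11 := h _ hseg 1 1
    have h01 := h _ hseg 0 1
    -- The derivative along the segment is the quadratic form of the gradient evaluated at v, and
    -- only the symmetric part of the gradient enters.
    linear_combination ((v 0) ^ 2 / 2) * h00 + (v 1) ^ 2 / 2 * h11 + v 0 * v 1 * h01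
  have hconst := constant_of_has_deriv_right_zero
    (fun t _ => (hg t).continuousAt.continuousWithinAt) hz 1 (by simp)
  simp only [g, hv, one_smul, zero_smul, add_zero, add_sub_cancel, PiLp.sub_apply] at hconst
  linarith

theorem coord_memLp (φ : L2) (i : Fin 2) : MemLp (fun x => φ x i) 2 (volume : Measure Plane) :=
  (EuclideanSpace.proj i : Plane →L[ℝ] ℝ).comp_memLp' (Lp.memLp φ)

theorem isTest_translate_kernel {ρ : Plane → ℝ} (hρ : IsKernel ρ) {Ω : Set Plane} {x : Plane} {ε : ℝ}
    (hs : ∀ y ∈ tsupport ρ, ‖y‖ < ε) (hb : Metric.ball x ε ⊆ Ω) : IsTest Ω fun z => ρ (z - x) := by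
  refine ⟨hρ.smooth.comp (contDiff_id.sub contDiff_const), ?_, fun z hz => hb ?_⟩
  · simpa [Function.comp_def, sub_eq_add_neg] using
      hρ.compact.comp_homeomorph (Homeomorph.addRight (-x))
  · have := tsupport_comp_subset_preimage ρ (f := fun z : Plane => z - x) (by fun_prop) hz
    rw [Metric.mem_ball, dist_eq_norm]
    exact hs _ this

theorem exists_seq_tendsto_ae_pair {f : ℕ → Fin 2 → Plane → ℝ} {g : Fin 2 → Plane → ℝ}
    (hf : ∀ n i, AEStronglyMeasurable (f n i) volume) (hg : ∀ i, AEStronglyMeasurable (g i) volume)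
    (h : ∀ i, Tendsto (fun n => eLpNorm (fun x => f n i x - g i x) 2 volume) atTop (𝓝 0)) :
    ∃ ns : ℕ → ℕ, StrictMono ns ∧
      ∀ᵐ x ∂(volume : Measure Plane), ∀ i, Tendsto (fun k => f (ns k) i x) atTop (𝓝 (g i x)) := by
  have h1 : ∀ i, TendstoInMeasure volume (fun n => f n i) atTop (g i) := fun i =>
    tendstoInMeasure_of_tendsto_eLpNorm (by norm_num : (2 : ℝ≥0∞) ≠ 0) (fun n => hf n i) (hg i) (h i)
  obtain ⟨n1, hn1, ha1⟩ := (h1 0).exists_seq_tendsto_ae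
  obtain ⟨n2, hn2, ha2⟩ := ((h1 1).comp hn1.tendsto_atTop).exists_seq_tendsto_ae
  refine ⟨n1 ∘ n2, hn1.comp hn2, ?_⟩
  filter_upwards [ha1, ha2] with x hx1 hx2 i
  fin_cases i
  · exact hx1.comp hn2.tendsto_atTop
  · exact hx2

theorem linearIndependent_single :
    LinearIndependent ℝ ![(EuclideanSpace.single 0 1 : Plane), EuclideanSpace.single 1 1] := by
  rw [LinearIndependent.pair_iff]
  intro s t hst
  exact ⟨by simpa using congrArg (fun v : Plane => v 0) hst,
    by simpa using congrArg (fun v : Plane => v 1) hst⟩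

/-- A field without strain is locally rigid. -/
theorem StrainFree.locally_rigid {Ω : Set Plane} (hΩ : IsOpen Ω) {φ : L2} (h : StrainFree Ω φ)
    {c : Plane} (hc : c ∈ Ω) : ∃ ε > 0, Metric.ball c ε ⊆ Ω ∧
      ∃ p, ∀ᵐ x ∂volume.restrict (Metric.ball c ε), φ x = rigidField p x := by
  obtain ⟨ε', hε', hb⟩ := Metric.isOpen_iff.1 hΩ c hc
  set ε := ε' / 2 with hε
  have hε0 : 0 < ε := half_pos hε'
  refine ⟨ε, hε0, (Metric.ball_subset_ball (by linarith)).trans hb, ?_⟩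
  obtain ⟨ρ, hρ, -, hρ0⟩ := exists_kernels (exists_ball_subset_cone linearIndependent_single)
  have hl : ∀ i, LocallyIntegrable fun x => φ x i := fun i =>
    (coord_memLp φ i).locallyIntegrable (by norm_num)
  have hsm : ∀ δ > 0, ∀ᶠ n in atTop, ∀ y, ρ n y ≠ 0 → ‖y‖ < δ := fun δ hδ => by
    filter_upwards [hρ0 δ hδ] with n hn y hy using hn y (subset_tsupport _ hy)
  let f : ℕ → Fin 2 → Plane → ℝ := fun n i => moll (ρ n) fun x => φ x i
  have hf : ∀ n i, ContDiff ℝ ∞ (f n i) := fun n i => contDiff_moll (hρ n) (hl i)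
  obtain ⟨ns, hns, hae⟩ := exists_seq_tendsto_ae_pair (f := f) (g := fun i x => φ x i)
    (fun n i => (hf n i).continuous.aestronglyMeasurable) (fun i => (coord_memLp φ i).1)
    fun i => tendsto_moll hρ hsm (coord_memLp φ i)
  -- At points of the ball of half the radius, the translated kernel is an admissible test function
  -- for small supports; so the mollified field has no strain there and is rigid.
  have hrig : ∀ᶠ n in atTop, ∃ p, ∀ x ∈ Metric.ball c ε,
      (!₂[f n 0 x, f n 1 x] : Plane) = rigidField p x := by
    filter_upwards [hρ0 ε hε0] with n hn
    refine exists_rigidField_of_inner_eq_zero (F := fun x => !₂[f n 0 x, f n 1 x]) hε0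
      fun x hx y hy => ?_
    rw [inner_eq_sum]
    simp only [PiLp.sub_apply, Matrix.cons_val_zero, Matrix.cons_val_one]
    refine inner_sub_eq_zero_of_strain (fun i => (hf n i).differentiable_infty) fun z hz i j => ?_
    have hzb : z ∈ Metric.ball c ε := (convex_ball c ε).segment_subset hy hx hz
    have ht : IsTest Ω fun w => ρ n (w - z) := by
      refine isTest_translate_kernel (hρ n) hn fun w hw => hb ?_
      rw [Metric.mem_ball] at hw hzb ⊢
      linarith [dist_triangle w z c]
    have := h _ ht i j
    simp only [f, pd_moll (hρ n) (hl _)]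
    simp only [pd_comp_sub, mul_comm (φ _ _)] at this
    linarith
  set B := Metric.ball c ε with hB
  have haeB : ∀ᵐ x ∂volume.restrict B, ∀ i, Tendsto (fun k => f (ns k) i x) atTop (𝓝 (φ x i)) :=
    ae_restrict_of_ae hae
  have hne : (ae (volume.restrict B)).NeBot := by
    rw [ae_neBot, Ne, Measure.restrict_eq_zero]
    exact (Metric.measure_ball_pos volume c hε0).ne'
  have hmem := ae_restrict_mem (μ := (volume : Measure Plane)) (Metric.isOpen_ball (x := c) (ε := ε)).measurableSet
  obtain ⟨x, hx, hxB⟩ := (haeB.and hmem).exists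
  have hnex : ∀ᵐ y ∂volume.restrict B, y ≠ x :=
    ae_restrict_of_ae (measure_eq_zero_iff_ae_notMem.1 (measure_singleton x))
  obtain ⟨y, ⟨hy, hyB⟩, hyx⟩ := ((haeB.and hmem).and hnex).exists
  obtain ⟨N, hN⟩ := eventually_atTop.1 (hns.tendsto_atTop.eventually hrig)
  choose! p hp using hN
  have hd : (y 0 - x 0) ^ 2 + (y 1 - x 1) ^ 2 ≠ 0 := by
    intro h0
    apply hyx
    have h1 : y 0 = x 0 := by nlinarith [sq_nonneg (y 0 - x 0), sq_nonneg (y 1 - x 1)]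
    have h2 : y 1 = x 1 := by nlinarith [sq_nonneg (y 0 - x 0), sq_nonneg (y 1 - x 1)]
    ext i; fin_cases i
    · exact h1
    · exact h2
  have hcoord : ∀ k ≥ N, ∀ z ∈ B, f (ns k) 0 z = (p k).1 0 - (p k).2 * z 1 ∧
      f (ns k) 1 z = (p k).1 1 + (p k).2 * z 0 := fun k hk z hz => by
    have := hp k hk z hz
    have h0 := congrArg (fun v : Plane => v 0) this
    have h1 := congrArg (fun v : Plane => v 1) this
    simp [rigidField] at h0 h1
    exact ⟨by linarith, h1⟩
  -- A rigid motion is determined by its values at two distinct points. This is the formula for its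
  -- angular velocity, applied to the limit; convergence at x and y therefore forces the parameters
  -- to converge.
  set R : ℝ := ((φ y 1 - φ x 1) * (y 0 - x 0) - (φ y 0 - φ x 0) * (y 1 - x 1))
    / ((y 0 - x 0) ^ 2 + (y 1 - x 1) ^ 2)
  have hR : Tendsto (fun k => (p k).2) atTop (𝓝 R) := by
    refine (((((hy 1).sub (hx 1)).mul_const (y 0 - x 0)).sub
      (((hy 0).sub (hx 0)).mul_const (y 1 - x 1))).div_const _).congr' ?_
    filter_upwards [eventually_ge_atTop N] with k hk
    rw [(hcoord k hk x hxB).1, (hcoord k hk x hxB).2, (hcoord k hk y hyB).1, (hcoord k hk y hyB).2]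
    field_simp
    ring
  have hL0 : Tendsto (fun k => (p k).1 0) atTop (𝓝 (φ x 0 + R * x 1)) := by
    refine ((hx 0).add (hR.mul_const (x 1))).congr' ?_
    filter_upwards [eventually_ge_atTop N] with k hk
    rw [(hcoord k hk x hxB).1]; ring
  have hL1 : Tendsto (fun k => (p k).1 1) atTop (𝓝 (φ x 1 - R * x 0)) := by
    refine ((hx 1).sub (hR.mul_const (x 0))).congr' ?_
    filter_upwards [eventually_ge_atTop N] with k hk
    rw [(hcoord k hk x hxB).2]; ring
  refine ⟨(!₂[φ x 0 + R * x 1, φ x 1 - R * x 0], R), ?_⟩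
  filter_upwards [haeB, hmem] with z hz hzB
  have g0 : φ z 0 = (φ x 0 + R * x 1) - R * z 1 := by
    refine tendsto_nhds_unique (hz 0) ((hL0.sub (hR.mul_const (z 1))).congr' ?_)
    filter_upwards [eventually_ge_atTop N] with k hk
    rw [(hcoord k hk z hzB).1]
  have g1 : φ z 1 = (φ x 1 - R * x 0) + R * z 0 := by
    refine tendsto_nhds_unique (hz 1) ((hL1.add (hR.mul_const (z 0))).congr' ?_)
    filter_upwards [eventually_ge_atTop N] with k hk
    rw [(hcoord k hk z hzB).2]
  ext i; fin_cases i
  · simp [rigidField, g0]; ring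
  · simp [rigidField, g1]

/-! ### The rigid part -/

theorem eq_of_rigidField_ae_eq {U : Set Plane} (hU : IsOpen U) (hne : U.Nonempty)
    {p q : Plane × ℝ} (h : ∀ᵐ x ∂volume.restrict U, rigidField p x = rigidField q x) : p = q :=
  rigidField_injective_of_eqOn hU hne fun _ hx =>
    Measure.eqOn_open_of_ae_eq h hU (continuous_rigidField p).continuousOn
      (continuous_rigidField q).continuousOn hx

/-- A set that is null near each of its points is null, the plane being second countable. -/
theorem ae_restrict_of_locally {s : Set Plane} {P : Plane → Prop}
    (h : ∀ x ∈ s, ∃ U ∈ 𝓝 x, ∀ᵐ z ∂volume.restrict (U ∩ s), P z) (hs : MeasurableSet s) :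
    ∀ᵐ z ∂(volume : Measure Plane).restrict s, P z := by
  rw [ae_restrict_iff' hs]
  have : (volume : Measure Plane) {z | z ∈ s ∧ ¬ P z} = 0 := by
    refine measure_null_of_locally_null _ fun x hx => ?_
    obtain ⟨U, hU, hae⟩ := h x hx.1
    obtain ⟨V, hVU, hVo, hxV⟩ := mem_nhds_iff.1 hU
    refine ⟨V ∩ {z | z ∈ s ∧ ¬ P z}, inter_mem (mem_nhdsWithin_of_mem_nhds (hVo.mem_nhds hxV)) self_mem_nhdsWithin, ?_⟩
    have h2 := ae_restrict_of_ae_restrict_of_subset (inter_subset_inter_left s hVU) hae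
    rw [ae_restrict_iff' (hVo.measurableSet.inter hs)] at h2
    refine measure_mono_null (fun z hz => ?_) (ae_iff.1 h2)
    simp only [mem_ofPred_eq, Classical.not_imp]
    exact ⟨⟨hz.1, hz.2.1⟩, hz.2.2⟩
  rw [ae_iff]
  simpa only [Classical.not_imp] using this

namespace IsChart
variable {S : Set Plane} {p : Plane} {L : Plane ≃ₗᵢ[ℝ] Plane} {γ : ℝ → ℝ} {ρ : ℝ} {K : ℝ≥0}

theorem mem_interior (h : IsChart S p L γ ρ K) {x : Plane} (hx : x ∈ Metric.ball p ρ)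
    (hlt : (L x) 1 < γ ((L x) 0)) : x ∈ interior S := by
  have hc : Continuous fun y : Plane => γ ((L y) 0) - (L y) 1 :=
    (h.smooth.continuous.comp (by fun_prop)).sub (by fun_prop)
  rw [mem_interior_iff_mem_nhds]
  filter_upwards [Metric.isOpen_ball.mem_nhds hx,
    (hc.tendsto x).eventually (lt_mem_nhds (sub_pos.2 hlt))] with y hy1 hy2
  exact (h.mem_iff y hy1).2 (sub_pos.1 hy2).le

/-- Points of the solid move into its interior when they are moved down. -/
theorem sub_mem_interior (h : IsChart S p L γ ρ K) {x : Plane} (hx : x ∈ Metric.ball p ρ)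
    (hxS : x ∈ S) {s : ℝ} (hs : 0 < s) (hxs : x - s • L.symm !₂[0, 1] ∈ Metric.ball p ρ) :
    x - s • L.symm !₂[0, 1] ∈ interior S := by
  refine h.mem_interior hxs ?_
  have := (h.mem_iff x hx).1 hxS
  simp
  linarith

theorem norm_down (L : Plane ≃ₗᵢ[ℝ] Plane) : ‖(L.symm !₂[0, 1] : Plane)‖ = 1 := by
  rw [LinearIsometryEquiv.norm_map]
  simp [EuclideanSpace.norm_eq]

end IsChart

/-- A boundary point pushed down in its chart by any small amount is interior. -/
theorem IsBody.subset_closure_interior {S : Set Plane} (hS : IsBody S) :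
    S ⊆ closure (interior S) := by
  intro x hx
  by_cases hxi : x ∈ interior S
  · exact subset_closure hxi
  have hxf : x ∈ frontier S := by rw [hS.isClosed.frontier_eq]; exact ⟨hx, hxi⟩
  obtain ⟨L, γ, ρ, K, h⟩ := hS.exists_chart hxf
  rw [Metric.mem_closure_iff]
  intro ε hε
  have hm : 0 < min ε ρ / 2 := half_pos (lt_min hε h.pos)
  have hd : dist x (x - (min ε ρ / 2) • L.symm !₂[0, 1]) = min ε ρ / 2 := by
    rw [dist_eq_norm, sub_sub_cancel, norm_smul, IsChart.norm_down, mul_one,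
      Real.norm_of_nonneg hm.le]
  refine ⟨_, h.sub_mem_interior (Metric.mem_ball_self h.pos) hx hm ?_, ?_⟩
  · rw [Metric.mem_ball, dist_comm, hd]; linarith [min_le_right ε ρ]
  · rw [hd]; linarith [min_le_left ε ρ]

/-- Local rigid motions exist around interior points only, whereas connectedness is assumed for the
solid and not for its interior. The local motions are therefore first extended to neighbourhoods of
boundary points, using that near such a point the interior is one piece from the viewpoint of the
chart, and then compared along the connected solid. -/
theorem IsBody.exists_rigid {S : Set Plane} (hS : IsBody S) {φ : L2} (hφ : φ ∈ spaceH S) :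
    ∃ p, ∀ᵐ x ∂volume.restrict S, φ x = rigidField p x := by
  have hloc := fun c (hc : c ∈ interior S) => hφ.2.locally_rigid isOpen_interior hc
  choose! ε hε hεS P hP using hloc
  -- Neighbouring balls overlap in a nonempty open set, where two rigid fields agreeing almost
  -- everywhere coincide; thus the parameters are locally constant on W.
  have hPW : ∀ W ⊆ interior S, IsPreconnected W → ∀ x ∈ W, ∀ y ∈ W, P x = P y := by
    intro W hWS hW x hx y hy
    refine hW.induction₂ (fun x y => P x = P y) (fun x hx => ?_)
      (fun _ _ _ _ _ _ h1 h2 => h1.trans h2) (fun _ _ _ _ h => h.symm) hx hy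
    filter_upwards [self_mem_nhdsWithin,
      mem_nhdsWithin_of_mem_nhds (Metric.ball_mem_nhds x (hε x (hWS hx)))] with y hy hyx
    refine eq_of_rigidField_ae_eq (Metric.isOpen_ball.inter Metric.isOpen_ball)
      ⟨y, hyx, Metric.mem_ball_self (hε y (hWS hy))⟩ ?_
    filter_upwards [ae_restrict_of_ae_restrict_of_subset inter_subset_left (hP x (hWS hx)),
      ae_restrict_of_ae_restrict_of_subset inter_subset_right (hP y (hWS hy))] with z h1 h2
    rw [← h1, h2]
  have hmS := hS.isClosed.measurableSet
  have hnull : ∀ᵐ z ∂(volume : Measure Plane), z ∉ frontier S :=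
    measure_eq_zero_iff_ae_notMem.1 hS.volume_frontier
  have hpt : ∀ x ∈ S, ∃ p, ∃ U ∈ 𝓝 x, IsOpen U ∧
      ∀ᵐ z ∂volume.restrict (U ∩ S), φ z = rigidField p z := by
    intro x hx
    by_cases hxi : x ∈ interior S
    · exact ⟨P x, _, Metric.ball_mem_nhds x (hε x hxi), Metric.isOpen_ball,
        ae_restrict_of_ae_restrict_of_subset inter_subset_left (hP x hxi)⟩
    have hxf : x ∈ frontier S := by rw [hS.isClosed.frontier_eq]; exact ⟨hx, hxi⟩
    obtain ⟨L, γ, ρ, K, h⟩ := hS.exists_chart hxf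
    set e : Plane := L.symm !₂[0, 1] with he
    have hne : ‖e‖ = 1 := IsChart.norm_down L
    have hρ := h.pos
    set q := x - (ρ / 2) • e with hq
    have hdown : ∀ y ∈ Metric.ball x (ρ / 4), ∀ s, 0 ≤ s → s ≤ ρ / 2 →
        y - s • e ∈ Metric.ball x ρ := by
      intro y hy s hs0 hs
      rw [Metric.mem_ball, dist_eq_norm] at hy ⊢
      calc ‖y - s • e - x‖ = ‖(y - x) - s • e‖ := by congr 1; abel
        _ ≤ ‖y - x‖ + ‖s • e‖ := norm_sub_le _ _
        _ < ρ := by rw [norm_smul, hne, Real.norm_of_nonneg hs0]; linarith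
    have hx4 : x ∈ Metric.ball x (ρ / 4) := Metric.mem_ball_self (by linarith)
    have hqS : q ∈ interior S := h.sub_mem_interior (Metric.mem_ball_self hρ) hx (by linarith)
      (hdown x hx4 _ (by linarith) le_rfl)
    obtain ⟨r, hr, hrS⟩ := Metric.isOpen_iff.1 isOpen_interior q hqS
    set U := Metric.ball x (min r (ρ / 4)) with hU
    have hUP : ∀ y ∈ U ∩ interior S, P y = P q := by
      rintro y ⟨hyU, hyS⟩
      have hy4 : y ∈ Metric.ball x (ρ / 4) := Metric.ball_subset_ball (min_le_right _ _) hyU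
      have hyr : y ∈ Metric.ball x r := Metric.ball_subset_ball (min_le_left _ _) hyU
      have hend : y - (ρ / 2) • e ∈ Metric.ball q r := by
        rw [Metric.mem_ball, dist_eq_norm] at hyr ⊢
        rw [hq]; simpa using hyr
      -- An interior point near x is joined to a fixed interior ball around q, below x, by moving
      -- straight down; the path stays in the interior.
      refine hPW (segment ℝ y (y - (ρ / 2) • e) ∪ Metric.ball q r) (union_subset ?_ hrS)
        (IsPreconnected.union _ (right_mem_segment ℝ _ _) hend (convex_segment _ _).isPreconnected
          (convex_ball q r).isPreconnected) y (Or.inl (left_mem_segment ℝ _ _)) q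
        (Or.inr (Metric.mem_ball_self hr))
      intro z hz
      rw [segment_eq_image'] at hz
      obtain ⟨θ, ⟨hθ0, hθ1⟩, rfl⟩ := hz
      rcases hθ0.eq_or_lt with rfl | hθ0
      · simpa using hyS
      have ez : y + θ • (y - (ρ / 2) • e - y) = y - (θ * (ρ / 2)) • e := by
        rw [mul_smul]; simp [sub_eq_add_neg]
      dsimp only
      rw [ez]
      exact h.sub_mem_interior (Metric.ball_subset_ball (by linarith) hy4) (interior_subset hyS)
        (by positivity) (hdown y hy4 _ (by positivity) (by nlinarith))
    refine ⟨P q, U, Metric.ball_mem_nhds x (lt_min hr (by linarith)), Metric.isOpen_ball, ?_⟩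
    have h1 : ∀ᵐ z ∂volume.restrict (U ∩ interior S), φ z = rigidField (P q) z := by
      refine ae_restrict_of_locally (fun y hy => ⟨_, Metric.ball_mem_nhds y (hε y hy.2), ?_⟩)
        (Metric.isOpen_ball.inter isOpen_interior).measurableSet
      rw [← hUP y hy]
      exact ae_restrict_of_ae_restrict_of_subset inter_subset_left (hP y hy.2)
    rw [ae_restrict_iff' (Metric.isOpen_ball.inter isOpen_interior).measurableSet] at h1
    rw [ae_restrict_iff' (Metric.isOpen_ball.measurableSet.inter hmS)]
    -- Passing from the interior to the solid costs only the boundary, which has area zero.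
    filter_upwards [h1, hnull] with z hz1 hz2 hz
    refine hz1 ⟨hz.1, ?_⟩
    rw [hS.isClosed.frontier_eq] at hz2
    by_contra hzi
    exact hz2 ⟨hz.2, hzi⟩
  choose! p U hU hUo hUp using hpt
  obtain ⟨x₀, hx₀⟩ := hS.isConnected.nonempty
  have hconst : ∀ x ∈ S, p x = p x₀ := fun x hx => by
    refine hS.isConnected.isPreconnected.induction₂ (fun x y => p x = p y) (fun x hx => ?_)
      (fun _ _ _ _ _ _ h1 h2 => h1.trans h2) (fun _ _ _ _ h => h.symm) hx hx₀
    filter_upwards [self_mem_nhdsWithin, mem_nhdsWithin_of_mem_nhds (hU x hx)] with y hy hyx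
    have ho : IsOpen (U x ∩ U y) := (hUo x hx).inter (hUo y hy)
    -- The overlap of the two neighbourhoods contains a point of the solid, hence interior points,
    -- so it carries enough area to compare the rigid fields.
    have hne : (U x ∩ U y ∩ interior S).Nonempty :=
      mem_closure_iff.1 (hS.subset_closure_interior hy) _ ho ⟨hyx, mem_of_mem_nhds (hU y hy)⟩
    refine eq_of_rigidField_ae_eq (ho.inter isOpen_interior) hne ?_
    filter_upwards [ae_restrict_of_ae_restrict_of_subset
      (inter_subset_inter inter_subset_left interior_subset) (hUp x hx),
      ae_restrict_of_ae_restrict_of_subset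
      (inter_subset_inter inter_subset_right interior_subset) (hUp y hy)] with z h1 h2
    rw [← h1, h2]
  exact ⟨p x₀, ae_restrict_of_locally (fun x hx => ⟨U x, hU x hx, hconst x hx ▸ hUp x hx⟩) hmS⟩

theorem IsBody.ae_eq_solidPart {S : Set Plane} (hS : IsBody S) {φ : L2} (hφ : φ ∈ spaceH S) :
    ∀ᵐ x ∂volume.restrict S, φ x = solidPart S φ x := by
  have h := hS.exists_rigid hφ
  rw [solidPart, rigidPart, dif_pos h]
  exact h.choose_spec

theorem IsBody.interior_nonempty {S : Set Plane} (hS : IsBody S) : (interior S).Nonempty := by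
  obtain ⟨x, hx⟩ := hS.isConnected.nonempty
  exact closure_nonempty_iff.1 ⟨x, hS.subset_closure_interior hx⟩

/-- The interior is nonempty, so the rigid motion is unique and the choice made in `rigidPart` is
immaterial. Its linearity in φ is a consequence. -/
theorem IsBody.rigidPart_eq {S : Set Plane} (hS : IsBody S) {φ : L2} (hφ : φ ∈ spaceH S)
    {p : Plane × ℝ} (h : ∀ᵐ x ∂volume.restrict S, φ x = rigidField p x) : rigidPart S φ = p := by
  refine eq_of_rigidField_ae_eq isOpen_interior hS.interior_nonempty ?_
  filter_upwards [ae_restrict_of_ae_restrict_of_subset interior_subset h,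
    ae_restrict_of_ae_restrict_of_subset interior_subset (hS.ae_eq_solidPart hφ)] with x h1 h2
  rw [← h1, h2, solidPart]

theorem rigidField_add (p q : Plane × ℝ) (x : Plane) :
    rigidField (p + q) x = rigidField p x + rigidField q x := by
  simp only [rigidField, Prod.fst_add, Prod.snd_add, add_smul]; abel

theorem rigidField_smul (c : ℝ) (p : Plane × ℝ) (x : Plane) :
    rigidField (c • p) x = c • rigidField p x := by
  simp only [rigidField, Prod.smul_fst, Prod.smul_snd, smul_add, smul_smul, smul_eq_mul]

theorem IsBody.rigidPart_add {S : Set Plane} (hS : IsBody S) {φ ψ : L2} (hφ : φ ∈ spaceH S)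
    (hψ : ψ ∈ spaceH S) : rigidPart S (φ + ψ : L2) = rigidPart S φ + rigidPart S ψ := by
  refine hS.rigidPart_eq ((spaceH S).add_mem hφ hψ) ?_
  filter_upwards [hS.ae_eq_solidPart hφ, hS.ae_eq_solidPart hψ,
    ae_restrict_of_ae (Lp.coeFn_add φ ψ)] with x h1 h2 h3
  rw [h3, Pi.add_apply, h1, h2, rigidField_add, solidPart, solidPart]

theorem IsBody.rigidPart_smul {S : Set Plane} (hS : IsBody S) {φ : L2} (hφ : φ ∈ spaceH S)
    (c : ℝ) : rigidPart S (c • φ : L2) = c • rigidPart S φ := by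
  refine hS.rigidPart_eq ((spaceH S).smul_mem c hφ) ?_
  filter_upwards [hS.ae_eq_solidPart hφ, ae_restrict_of_ae (Lp.coeFn_smul c φ)] with x h1 h3
  rw [h3, Pi.smul_apply, h1, rigidField_smul, solidPart]

/-! ### Weak gradients -/

/-- The fundamental lemma of the calculus of variations, entry by entry. It frees `weakGrad` from
the choice in its definition. -/
theorem IsWeakGrad.unique {Ω : Set Plane} (hΩ : IsOpen Ω) {φ : Plane → Plane}
    {G G' : Plane → Fin 2 → Fin 2 → ℝ} (h : IsWeakGrad Ω φ G) (h' : IsWeakGrad Ω φ G') :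
    ∀ᵐ x ∂volume.restrict Ω, G x = G' x := by
  have hij : ∀ i j, ∀ᵐ x ∂volume.restrict Ω, G x i j = G' x i j := fun i j => by
    rw [ae_restrict_iff' hΩ.measurableSet]
    have := hΩ.ae_eq_zero_of_integral_contDiff_smul_eq_zero ((h i j).1.sub (h' i j).1)
      fun g hg hc hs => ?_
    · filter_upwards [this] with x hx hxΩ using sub_eq_zero.1 (hx hxΩ)
    · have ht : IsTest Ω g := ⟨hg, hc, hs⟩
      have e := ((h i j).2 g ht).symm.trans ((h' i j).2 g ht)
      have i1 := integrable_grad (h i j).1 ht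
      have i2 := integrable_grad (h' i j).1 ht
      have e2 : ∫ x, g x • ((fun x => G x i j) - fun x => G' x i j) x
          = ∫ x in Ω, (G x i j * g x - G' x i j * g x) := by
        rw [← setIntegral_eq_integral_of_forall_compl_eq_zero (s := Ω)]
        · congr 1; ext x; simp; ring
        · intro x hx
          rw [image_eq_zero_of_notMem_tsupport fun hm => hx (hs hm), zero_smul]
      rw [e2, integral_sub i1 i2]
      linarith
  filter_upwards [ae_all_iff.2 fun i => ae_all_iff.2 fun j => hij i j] with x hx
  ext i j
  exact hx i j

theorem isWeakGrad_weakGrad {Ω : Set Plane} {φ : Plane → Plane} (h : ∃ G, IsWeakGrad Ω φ G) :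
    IsWeakGrad Ω φ (weakGrad Ω φ) := by
  rw [weakGrad, dif_pos h]
  exact h.choose_spec

theorem weakGrad_add {Ω : Set Plane} (hΩ : IsOpen Ω) {φ ψ : L2} (h : ∃ G, IsWeakGrad Ω φ G)
    (h' : ∃ G, IsWeakGrad Ω ψ G) : ∀ᵐ x ∂volume.restrict Ω,
      weakGrad Ω (φ + ψ : L2) x = weakGrad Ω φ x + weakGrad Ω ψ x :=
  have hs := (isWeakGrad_weakGrad h).add (isWeakGrad_weakGrad h')
  (isWeakGrad_weakGrad ⟨_, hs⟩).unique hΩ hs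

theorem weakGrad_smul {Ω : Set Plane} (hΩ : IsOpen Ω) {φ : L2} (h : ∃ G, IsWeakGrad Ω φ G)
    (c : ℝ) : ∀ᵐ x ∂volume.restrict Ω, weakGrad Ω (c • φ : L2) x = c • weakGrad Ω φ x :=
  have hs := (isWeakGrad_weakGrad h).smul c
  (isWeakGrad_weakGrad ⟨_, hs⟩).unique hΩ hs

theorem memLp_weakGrad_of_mem {S : Set Plane} (hS : IsClosed S) {κ : Plane → ℝ} {φ : L2}
    (h : φ ∈ weightedSpace S κ) (i j : Fin 2) :
    MemLp (fun y => κ y * weakGrad Sᶜ φ y i j) 2 (volume.restrict Sᶜ) := by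
  obtain ⟨-, G, hG, hL⟩ := h
  refine (hL i j).ae_eq ?_
  filter_upwards [hG.unique hS.isOpen_compl (isWeakGrad_weakGrad ⟨G, hG⟩)] with x hx
  rw [hx]

/-! ### Hölder's inequality for products of three functions -/

instance holderTriple_four_four_two : ENNReal.HolderTriple 4 4 2 :=
  ⟨by
    have h1 : (4 : ℝ≥0∞)⁻¹ = 2⁻¹ * 2⁻¹ := by
      rw [← ENNReal.mul_inv (by simp) (by simp)]; norm_num
    rw [h1, ← mul_add, ENNReal.inv_two_add_inv_two, mul_one]⟩

theorem abs_integral_le_eLpNorm {μ : Measure Plane} (f : Plane → ℝ) :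
    |∫ x, f x ∂μ| ≤ (eLpNorm f 1 μ).toReal := by
  rw [← Real.norm_eq_abs]
  refine (norm_integral_le_lintegral_norm f).trans (le_of_eq ?_)
  rw [eLpNorm_one_eq_lintegral_enorm]
  simp only [ofReal_norm]

/-- The real `L^p` norm. -/
noncomputable def lp (p : ℝ≥0∞) (μ : Measure Plane) (f : Plane → ℝ) : ℝ := (eLpNorm f p μ).toReal

theorem lp_nonneg (p : ℝ≥0∞) (μ : Measure Plane) (f : Plane → ℝ) : 0 ≤ lp p μ f :=
  ENNReal.toReal_nonneg

theorem memLp_one_mul {μ : Measure Plane} {f g : Plane → ℝ} (hf : MemLp f 2 μ) (hg : MemLp g 2 μ) :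
    MemLp (fun x => f x * g x) 1 μ := MemLp.mul hg hf

theorem eLpNorm_one_mul_le {μ : Measure Plane} {f g : Plane → ℝ} (hf : MemLp f 2 μ)
    (hg : MemLp g 2 μ) : eLpNorm (fun x => f x * g x) 1 μ ≤ eLpNorm f 2 μ * eLpNorm g 2 μ :=
  eLpNorm_smul_le_mul_eLpNorm (φ := f) (f := g) hg.1 hf.1

theorem abs_integral_mul_le {μ : Measure Plane} {f g : Plane → ℝ} (hf : MemLp f 2 μ)
    (hg : MemLp g 2 μ) : |∫ x, f x * g x ∂μ| ≤ lp 2 μ f * lp 2 μ g := by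
  refine (abs_integral_le_eLpNorm _).trans ?_
  rw [lp, lp, ← ENNReal.toReal_mul]
  exact ENNReal.toReal_mono (ENNReal.mul_ne_top hf.2.ne hg.2.ne) (eLpNorm_one_mul_le hf hg)

theorem memLp_two_mul {μ : Measure Plane} {f g : Plane → ℝ} (hf : MemLp f 4 μ) (hg : MemLp g 4 μ) :
    MemLp (fun x => f x * g x) 2 μ := MemLp.mul hg hf

theorem eLpNorm_two_mul_le {μ : Measure Plane} {f g : Plane → ℝ} (hf : MemLp f 4 μ)
    (hg : MemLp g 4 μ) : eLpNorm (fun x => f x * g x) 2 μ ≤ eLpNorm f 4 μ * eLpNorm g 4 μ :=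
  eLpNorm_smul_le_mul_eLpNorm (φ := f) (f := g) hg.1 hf.1

theorem memLp_mul_mul {μ : Measure Plane} {f g h : Plane → ℝ} (hf : MemLp f 4 μ) (hg : MemLp g 2 μ)
    (hh : MemLp h 4 μ) : MemLp (fun x => f x * g x * h x) 1 μ := by
  refine (memLp_one_mul (memLp_two_mul hf hh) hg).ae_eq (ae_of_all _ fun x => ?_)
  dsimp only; ring

theorem eLpNorm_mul_mul_le {μ : Measure Plane} {f g h : Plane → ℝ} (hf : MemLp f 4 μ)
    (hg : MemLp g 2 μ) (hh : MemLp h 4 μ) :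
    eLpNorm (fun x => f x * g x * h x) 1 μ ≤ eLpNorm f 4 μ * eLpNorm g 2 μ * eLpNorm h 4 μ := by
  calc eLpNorm (fun x => f x * g x * h x) 1 μ = eLpNorm (fun x => f x * h x * g x) 1 μ := by
        congr 1; ext x; ring
    _ ≤ eLpNorm (fun x => f x * h x) 2 μ * eLpNorm g 2 μ :=
        eLpNorm_one_mul_le (memLp_two_mul hf hh) hg
    _ ≤ (eLpNorm f 4 μ * eLpNorm h 4 μ) * eLpNorm g 2 μ := by
        gcongr; exact eLpNorm_two_mul_le hf hh
    _ = _ := by ring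

theorem abs_integral_mul_mul_le {μ : Measure Plane} {f g h : Plane → ℝ} (hf : MemLp f 4 μ)
    (hg : MemLp g 2 μ) (hh : MemLp h 4 μ) :
    |∫ x, f x * g x * h x ∂μ| ≤ lp 4 μ f * lp 2 μ g * lp 4 μ h := by
  refine (abs_integral_le_eLpNorm _).trans ?_
  rw [lp, lp, lp, ← ENNReal.toReal_mul, ← ENNReal.toReal_mul]
  exact ENNReal.toReal_mono (ENNReal.mul_ne_top (ENNReal.mul_ne_top hf.2.ne hg.2.ne) hh.2.ne)
    (eLpNorm_mul_mul_le hf hg hh)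

theorem lp_two_sq {μ : Measure Plane} {f : Plane → ℝ} (hf : MemLp f 2 μ) :
    lp 2 μ f ^ 2 = ∫ x, f x ^ 2 ∂μ := by
  rw [lp, ← ENNReal.toReal_pow, eLpNorm_two_sq, integral_eq_lintegral_of_nonneg_ae
    (ae_of_all _ fun x => sq_nonneg _) (hf.1.pow 2)]
  congr 1
  refine lintegral_congr fun x => ?_
  rw [← enorm_pow, Real.enorm_of_nonneg (sq_nonneg _)]

theorem lp_le_of_abs_le {μ : Measure Plane} {p : ℝ≥0∞} {f g : Plane → ℝ} {B : ℝ} (hB : 0 ≤ B)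
    (h : ∀ᵐ x ∂μ, |f x| ≤ B * |g x|) (hg : MemLp g p μ) : lp p μ f ≤ B * lp p μ g := by
  have h1 := eLpNorm_le_mul_eLpNorm_of_ae_le_mul (f := f) (g := g) (c := B) (μ := μ) h p
  have h2 := ENNReal.toReal_mono (ENNReal.mul_ne_top ENNReal.ofReal_ne_top hg.2.ne) h1
  rwa [ENNReal.toReal_mul, ENNReal.toReal_ofReal hB] at h2

/-! ### The norms control the pieces -/

section Norms
variable {S : Set Plane} {m J : ℝ}

theorem memLp_coord (S : Set Plane) (φ : L2) (i : Fin 2) :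
    MemLp (fun x => φ x i) 2 (volume.restrict Sᶜ) := (coord_memLp φ i).restrict _

theorem innerH_self (S : Set Plane) (m J : ℝ) (φ : L2) :
    innerH S m J φ φ = lp 2 (volume.restrict Sᶜ) (fun x => φ x 0) ^ 2
      + lp 2 (volume.restrict Sᶜ) (fun x => φ x 1) ^ 2 + m * ‖ell S φ‖ ^ 2 + J * rot S φ ^ 2 := by
  rw [lp_two_sq (memLp_coord S φ 0), lp_two_sq (memLp_coord S φ 1), innerH,
    ← integral_add (memLp_coord S φ 0).integrable_sq (memLp_coord S φ 1).integrable_sq,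
    real_inner_self_eq_norm_sq, sq (rot S φ)]
  congr 3
  ext x
  rw [inner_eq_sum]; ring

theorem normH_sq (hm : 0 < m) (hJ : 0 < J) (φ : L2) :
    normH S m J φ ^ 2 = lp 2 (volume.restrict Sᶜ) (fun x => φ x 0) ^ 2
      + lp 2 (volume.restrict Sᶜ) (fun x => φ x 1) ^ 2 + m * ‖ell S φ‖ ^ 2 + J * rot S φ ^ 2 := by
  rw [normH, Real.sq_sqrt, innerH_self]
  rw [innerH_self]; positivity

theorem normH_nonneg (S : Set Plane) (m J : ℝ) (φ : Plane → Plane) : 0 ≤ normH S m J φ :=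
  Real.sqrt_nonneg _

theorem lp_le_normH (hm : 0 < m) (hJ : 0 < J) (φ : L2) (i : Fin 2) :
    lp 2 (volume.restrict Sᶜ) (fun x => φ x i) ≤ normH S m J φ := by
  refine abs_le_of_sq_le_sq' ?_ (normH_nonneg _ _ _ _) |>.2
  rw [normH_sq hm hJ]
  fin_cases i
  · have : 0 ≤ lp 2 (volume.restrict Sᶜ) (fun x => φ x 1) ^ 2 + m * ‖ell S φ‖ ^ 2
      + J * rot S φ ^ 2 := by positivity
    simp only [Fin.zero_eta]; linarith
  · have : 0 ≤ lp 2 (volume.restrict Sᶜ) (fun x => φ x 0) ^ 2 + m * ‖ell S φ‖ ^ 2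
      + J * rot S φ ^ 2 := by positivity
    simp only [Fin.mk_one]; linarith

theorem norm_ell_le (hm : 0 < m) (hJ : 0 < J) (φ : L2) :
    ‖ell S φ‖ ≤ (1 / Real.sqrt m) * normH S m J φ := by
  have hs : 0 < Real.sqrt m := Real.sqrt_pos.2 hm
  have h : (Real.sqrt m * ‖ell S φ‖) ^ 2 ≤ normH S m J φ ^ 2 := by
    rw [normH_sq hm hJ, mul_pow, Real.sq_sqrt hm.le]
    have : 0 ≤ lp 2 (volume.restrict Sᶜ) (fun x => φ x 0) ^ 2
      + lp 2 (volume.restrict Sᶜ) (fun x => φ x 1) ^ 2 + J * rot S φ ^ 2 := by positivity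
    linarith
  have h2 := (abs_le_of_sq_le_sq' h (normH_nonneg _ _ _ _)).2
  rw [one_div, ← div_eq_inv_mul, le_div_iff₀ hs]
  linarith

theorem abs_rot_le (hm : 0 < m) (hJ : 0 < J) (φ : L2) :
    |rot S φ| ≤ (1 / Real.sqrt J) * normH S m J φ := by
  have hs : 0 < Real.sqrt J := Real.sqrt_pos.2 hJ
  have h : (Real.sqrt J * |rot S φ|) ^ 2 ≤ normH S m J φ ^ 2 := by
    rw [normH_sq hm hJ, mul_pow, Real.sq_sqrt hJ.le, sq_abs]
    have : 0 ≤ lp 2 (volume.restrict Sᶜ) (fun x => φ x 0) ^ 2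
      + lp 2 (volume.restrict Sᶜ) (fun x => φ x 1) ^ 2 + m * ‖ell S φ‖ ^ 2 := by positivity
    linarith
  have h2 := (abs_le_of_sq_le_sq' h (normH_nonneg _ _ _ _)).2
  rw [one_div, ← div_eq_inv_mul, le_div_iff₀ hs]
  linarith

/-- A constant that bounds the rigid part. -/
theorem exists_rigid_bound (S : Set Plane) (hm : 0 < m) (hJ : 0 < J) :
    ∃ c : ℝ, 0 < c ∧ ∀ φ : L2, ‖ell S φ‖ ≤ c * normH S m J φ ∧ |rot S φ| ≤ c * normH S m J φ := by
  refine ⟨1 / Real.sqrt m + 1 / Real.sqrt J, by positivity, fun φ => ⟨?_, ?_⟩⟩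
  · refine (norm_ell_le hm hJ φ).trans ?_
    have := normH_nonneg S m J φ
    gcongr
    exact le_add_of_nonneg_right (by positivity)
  · refine (abs_rot_le hm hJ φ).trans ?_
    have := normH_nonneg S m J φ
    gcongr
    exact le_add_of_nonneg_left (by positivity)

theorem sqrt_weight_pos (y : Plane) : 0 < Real.sqrt (1 + ‖y‖ ^ 2) := Real.sqrt_pos.2 (by positivity)

theorem one_le_sqrt_weight (y : Plane) : 1 ≤ Real.sqrt (1 + ‖y‖ ^ 2) :=
  Real.one_le_sqrt.2 (by nlinarith [sq_nonneg ‖y‖])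

theorem norm_le_sqrt_weight (y : Plane) : ‖y‖ ≤ Real.sqrt (1 + ‖y‖ ^ 2) :=
  Real.le_sqrt_of_sq_le (by linarith)

theorem lp_weightedGrad_le {κ : Plane → ℝ} {φ : Plane → Plane}
    (h : ∀ i j, MemLp (fun y => κ y * weakGrad Sᶜ φ y i j) 2 (volume.restrict Sᶜ)) (i j : Fin 2) :
    lp 2 (volume.restrict Sᶜ) (fun y => κ y * weakGrad Sᶜ φ y i j)
      ≤ Real.sqrt (∫ y in Sᶜ, gradSq S φ y * κ y ^ 2) := by
  refine Real.le_sqrt_of_sq_le ?_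
  rw [lp_two_sq (h i j)]
  have e : ∀ y, gradSq S φ y * κ y ^ 2 = ∑ i, ∑ j, (κ y * weakGrad Sᶜ φ y i j) ^ 2 := fun y => by
    simp only [gradSq, Finset.sum_mul, mul_pow]
    refine Finset.sum_congr rfl fun i _ => Finset.sum_congr rfl fun j _ => mul_comm _ _
  simp only [e]
  refine integral_mono (h i j).integrable_sq
    (integrable_finsetSum _ fun i _ => integrable_finsetSum _ fun j _ => (h i j).integrable_sq)
    fun y => ?_
  exact (Finset.single_le_sum (f := fun j => (κ y * weakGrad Sᶜ φ y i j) ^ 2)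
    (fun _ _ => sq_nonneg _) (Finset.mem_univ j)).trans
    (Finset.single_le_sum (f := fun i => ∑ j, (κ y * weakGrad Sᶜ φ y i j) ^ 2)
    (fun _ _ => Finset.sum_nonneg fun _ _ => sq_nonneg _) (Finset.mem_univ i))

theorem memLp_grad_of_mem_spaceVlow (hS : IsClosed S) {φ : L2} (h : φ ∈ spaceVlow S) (i j : Fin 2) :
    MemLp (fun y => weakGrad Sᶜ φ y i j) 2 (volume.restrict Sᶜ) := by
  simpa using memLp_weakGrad_of_mem hS h i j

theorem lp_grad_le_normVlow (hS : IsClosed S) {φ : L2} (h : φ ∈ spaceVlow S) (i j : Fin 2) :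
    lp 2 (volume.restrict Sᶜ) (fun y => weakGrad Sᶜ φ y i j) ≤ normVlow S m J φ := by
  have := lp_weightedGrad_le (κ := fun _ => 1) (memLp_weakGrad_of_mem hS h) i j
  simp only [one_mul, one_pow, mul_one] at this
  exact this.trans (le_add_of_nonneg_left (normH_nonneg _ _ _ _))

theorem lp_grad_le_normV (hS : IsClosed S) {φ : L2} (h : φ ∈ spaceV S) (i j : Fin 2) :
    lp 2 (volume.restrict Sᶜ) (fun y => Real.sqrt (1 + ‖y‖ ^ 2) * weakGrad Sᶜ φ y i j)
      ≤ normV S m J φ := by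
  have := lp_weightedGrad_le (memLp_weakGrad_of_mem hS h) i j
  simp only [fun y : Plane => Real.sq_sqrt (by positivity : 0 ≤ 1 + ‖y‖ ^ 2)] at this
  exact this.trans (le_add_of_nonneg_left (normH_nonneg _ _ _ _))

theorem normH_le_normVlow (S : Set Plane) (m J : ℝ) (φ : Plane → Plane) :
    normH S m J φ ≤ normVlow S m J φ := le_add_of_nonneg_right (Real.sqrt_nonneg _)

theorem normH_le_normV (S : Set Plane) (m J : ℝ) (φ : Plane → Plane) :
    normH S m J φ ≤ normV S m J φ := le_add_of_nonneg_right (Real.sqrt_nonneg _)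

theorem normVlow_nonneg (S : Set Plane) (m J : ℝ) (φ : Plane → Plane) : 0 ≤ normVlow S m J φ :=
  (normH_nonneg _ _ _ _).trans (normH_le_normVlow _ _ _ _)

theorem normV_nonneg (S : Set Plane) (m J : ℝ) (φ : Plane → Plane) : 0 ≤ normV S m J φ :=
  (normH_nonneg _ _ _ _).trans (normH_le_normV _ _ _ _)

theorem spaceV_le_spaceVlow (S : Set Plane) : spaceV S ≤ spaceVlow S := by
  rintro φ ⟨h, G, hG, hL⟩
  refine ⟨h, G, hG, fun i j => (hL i j).mono ?_ (ae_of_all _ fun y => ?_)⟩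
  · simp only [one_mul]
    have := (hG i j).1.aestronglyMeasurable
    exact this
  · rw [one_mul, norm_mul, Real.norm_of_nonneg (Real.sqrt_nonneg _)]
    exact le_mul_of_one_le_left (norm_nonneg _) (one_le_sqrt_weight y)

theorem memLp_grad_of_mem_spaceV (hS : IsClosed S) {φ : L2} (h : φ ∈ spaceV S) (i j : Fin 2) :
    MemLp (fun y => weakGrad Sᶜ φ y i j) 2 (volume.restrict Sᶜ) :=
  memLp_grad_of_mem_spaceVlow hS (spaceV_le_spaceVlow S h) i j

theorem lp_plainGrad_le_normV (hS : IsClosed S) {φ : L2} (h : φ ∈ spaceV S) (i j : Fin 2) :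
    lp 2 (volume.restrict Sᶜ) (fun y => weakGrad Sᶜ φ y i j) ≤ normV S m J φ := by
  have := lp_le_of_abs_le (μ := volume.restrict Sᶜ) (p := 2) (f := fun y => weakGrad Sᶜ φ y i j)
    zero_le_one (ae_of_all _ fun y => ?_) (memLp_weakGrad_of_mem hS h i j)
  · rw [one_mul] at this
    exact this.trans (lp_grad_le_normV hS h i j)
  · rw [one_mul, abs_mul, abs_of_nonneg (Real.sqrt_nonneg _)]
    exact le_mul_of_one_le_left (abs_nonneg _) (one_le_sqrt_weight y)

/-! ### Sobolev and trace inequalities -/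

theorem IsBody.exists_smoothLimit (hS : IsBody S) {φ : L2} (h : φ ∈ spaceVlow S) (i : Fin 2) :
    ∃ f, SmoothLimit Sᶜ f (fun x => φ x i) (fun j x => weakGrad Sᶜ φ x i j) := by
  obtain ⟨ι, hι, χ, a, b, hp, -⟩ := hS.exists_conePartition
  have hw := isWeakGrad_weakGrad (Ω := Sᶜ) (φ := φ) ⟨_, h.2.choose_spec.1⟩
  have hG := memLp_grad_of_mem_spaceVlow hS.isClosed h
  exact (hp.approx hS.isClosed.isOpen_compl (fun j ψ hψ => (hw i j).2 ψ hψ) (memLp_coord S φ i)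
    (hG i)).exists_smoothLimit (memLp_coord S φ i).1 fun j => (hG i j).1

theorem IsBody.exists_bound_eLpNorm_four (hS : IsBody S) :
    ∃ C : ℝ≥0∞, C ≠ ⊤ ∧ ∀ f : Plane → ℝ, ContDiff ℝ ∞ f → HasCompactSupport f →
      eLpNorm f 4 (volume.restrict Sᶜ) ≤ C * h1Norm Sᶜ f (fun j => pd j f) := by
  obtain ⟨ι, hι, χ, a, b, hp, -⟩ := hS.exists_conePartition
  exact hp.exists_eLpNorm_four_le hS.isClosed.isOpen_compl

theorem IsBody.frontier_subset_closure_compl (S : Set Plane) : frontier S ⊆ closure Sᶜ := by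
  rw [← frontier_compl]; exact frontier_subset_closure

theorem IsBody.exists_bound_trace (hS : IsBody S) :
    ∃ C : ℝ≥0∞, C ≠ ⊤ ∧ ∀ f : Plane → ℝ, ContDiff ℝ ∞ f → HasCompactSupport f →
      eLpNorm f 2 (arcLength S) ≤ C * h1Norm Sᶜ f (fun j => pd j f) := by
  obtain ⟨ι, hι, χ, a, b, hp, ht⟩ := hS.exists_conePartition
  refine hp.exists_eLpNorm_le (by norm_num) ?_ ht
  filter_upwards [ae_restrict_mem isClosed_frontier.measurableSet] with x hx
    using IsBody.frontier_subset_closure_compl S hx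

theorem h1Norm_le_normVlow (hS : IsClosed S) (hm : 0 < m) (hJ : 0 < J) {φ : L2}
    (h : φ ∈ spaceVlow S) (i : Fin 2) :
    h1Norm Sᶜ (fun x => φ x i) (fun j x => weakGrad Sᶜ φ x i j)
      ≤ ENNReal.ofReal (3 * normVlow S m J φ) := by
  have h1 := (lp_le_normH (S := S) hm hJ φ i).trans (normH_le_normVlow S m J φ)
  have h2 := fun j => lp_grad_le_normVlow (m := m) (J := J) hS h i j
  have hG := memLp_grad_of_mem_spaceVlow hS h
  have e : h1Norm Sᶜ (fun x => φ x i) (fun j x => weakGrad Sᶜ φ x i j)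
      = ENNReal.ofReal (lp 2 (volume.restrict Sᶜ) (fun x => φ x i)
        + (lp 2 (volume.restrict Sᶜ) (fun y => weakGrad Sᶜ φ y i 0)
        + lp 2 (volume.restrict Sᶜ) (fun y => weakGrad Sᶜ φ y i 1))) := by
    rw [ENNReal.ofReal_add (lp_nonneg _ _ _) (add_nonneg (lp_nonneg _ _ _) (lp_nonneg _ _ _)),
      ENNReal.ofReal_add (lp_nonneg _ _ _) (lp_nonneg _ _ _), lp, lp, lp,
      ENNReal.ofReal_toReal (memLp_coord S φ i).2.ne, ENNReal.ofReal_toReal (hG i 0).2.ne,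
      ENNReal.ofReal_toReal (hG i 1).2.ne, h1Norm, Fin.sum_univ_two]
  rw [e]
  exact ENNReal.ofReal_le_ofReal (by linarith [h2 0, h2 1])

instance fact_one_le_four : Fact ((1 : ℝ≥0∞) ≤ 4) := ⟨by norm_num⟩

theorem IsBody.memLp_four (hS : IsBody S) {φ : L2} (h : φ ∈ spaceVlow S) (i : Fin 2) :
    MemLp (fun x => φ x i) 4 (volume.restrict Sᶜ) := by
  obtain ⟨C, hC, hb⟩ := hS.exists_bound_eLpNorm_four
  obtain ⟨f, hf⟩ := hS.exists_smoothLimit h i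
  exact (hf.tendsto_eLpNorm hC hb).1

theorem IsBody.exists_lp_four_le (hS : IsBody S) (hm : 0 < m) (hJ : 0 < J) :
    ∃ C : ℝ, 0 < C ∧ ∀ φ ∈ spaceVlow S, ∀ i,
      lp 4 (volume.restrict Sᶜ) (fun x => φ x i) ≤ C * normVlow S m J φ := by
  obtain ⟨C, hC, hb⟩ := hS.exists_bound_eLpNorm_four
  refine ⟨C.toReal * 3 + 1, by positivity, fun φ h i => ?_⟩
  obtain ⟨f, hf⟩ := hS.exists_smoothLimit h i
  have h1 := (hf.le_of_tendsto (by norm_num) hC hb (memLp_coord S φ i).1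
    (hf.tendsto_eLpNorm hC hb).2).trans
      (mul_le_mul_right (h1Norm_le_normVlow (m := m) (J := J) hS.isClosed hm hJ h i) _)
  have h2 := ENNReal.toReal_mono (ENNReal.mul_ne_top hC ENNReal.ofReal_ne_top) h1
  have hn := normVlow_nonneg S m J φ
  rw [ENNReal.toReal_mul, ENNReal.toReal_ofReal (by positivity)] at h2
  rw [lp]
  nlinarith

end Norms

section FormB
variable {S : Set Plane} {m J : ℝ}

/-! ### Bounds for the form `b` -/

/-- The terms of the integrand of `b`. -/
theorem bIntegrand_eq (S : Set Plane) (u v w : Plane → Plane) : bIntegrand S u v w =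
    fun x => (∑ i, ∑ j, (u x j * weakGrad Sᶜ w x i j * v x i
      - solidPart S u x j * weakGrad Sᶜ w x i j * v x i))
      - rot S u * (v x 0 * w x 1 - v x 1 * w x 0) := by
  ext x
  rw [bIntegrand, inner_eq_sum]
  simp only [sub_mul, Fin.sum_univ_two, perp_zero_apply, perp_one_apply]
  ring

theorem abs_coord_le (x : Plane) (i : Fin 2) : |x i| ≤ ‖x‖ := PiLp.norm_apply_le x i

/-- The linear growth of a rigid field is dominated by the square root of the weight in the norm of
𝓥, so the product with ∇w is square integrable. -/
theorem abs_solidPart_le (S : Set Plane) (u : Plane → Plane) (x : Plane) (j : Fin 2) :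
    |solidPart S u x j| ≤ (‖ell S u‖ + |rot S u|) * Real.sqrt (1 + ‖x‖ ^ 2) := by
  have h1 : ‖solidPart S u x‖ ≤ ‖ell S u‖ + |rot S u| * ‖x‖ := by
    rw [solidPart, rigidField]
    refine (norm_add_le _ _).trans ?_
    rw [norm_smul, norm_perp, Real.norm_eq_abs]; rfl
  refine (abs_coord_le _ j).trans (h1.trans ?_)
  rw [add_mul]
  gcongr
  · exact le_mul_of_one_le_right (norm_nonneg _) (one_le_sqrt_weight x)
  · exact norm_le_sqrt_weight x

theorem continuous_solidPart_coord (S : Set Plane) (u : Plane → Plane) (j : Fin 2) :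
    Continuous fun x => solidPart S u x j :=
  (EuclideanSpace.proj j : Plane →L[ℝ] ℝ).continuous.comp (continuous_rigidField _)

/-- The terms with the rigid field, for a weighted square integrable gradient. -/
theorem solidPart_term {κ : Plane → ℝ} (hκ : ∀ y, κ y = Real.sqrt (1 + ‖y‖ ^ 2))
    (u : Plane → Plane) {g : Plane → ℝ} {v : L2} (i j : Fin 2)
    (hg : MemLp (fun y => κ y * g y) 2 (volume.restrict Sᶜ))
    (hgm : AEStronglyMeasurable g (volume.restrict Sᶜ)) :
    MemLp (fun x => solidPart S u x j * g x * v x i) 1 (volume.restrict Sᶜ) ∧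
      |∫ x in Sᶜ, solidPart S u x j * g x * v x i|
        ≤ (‖ell S u‖ + |rot S u|) * lp 2 (volume.restrict Sᶜ) (fun y => κ y * g y)
          * lp 2 (volume.restrict Sᶜ) (fun x => v x i) := by
  have hB : 0 ≤ ‖ell S u‖ + |rot S u| := by positivity
  have hle : ∀ x, |solidPart S u x j * g x| ≤ (‖ell S u‖ + |rot S u|) * |κ x * g x| := fun x => by
    rw [abs_mul, abs_mul, hκ, abs_of_pos (sqrt_weight_pos x), ← mul_assoc]
    gcongr
    exact abs_solidPart_le S u x j
  have h1 : MemLp (fun x => solidPart S u x j * g x) 2 (volume.restrict Sᶜ) :=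
    hg.of_le_mul ((continuous_solidPart_coord S u j).aestronglyMeasurable.mul hgm)
      (ae_of_all _ hle)
  refine ⟨memLp_one_mul h1 (memLp_coord S v i), (abs_integral_mul_le h1 (memLp_coord S v i)).trans ?_⟩
  gcongr
  · exact lp_nonneg _ _ _
  · exact lp_le_of_abs_le hB (ae_of_all _ hle) hg

/-- Integrability and a bound for `b`, from integrability and bounds for the separate terms. -/
theorem bForm_bound (hm : 0 < m) (hJ : 0 < J) {u v w : L2} {X Y : ℝ}
    (hX : ∀ i j, MemLp (fun x => u x j * weakGrad Sᶜ w x i j * v x i) 1 (volume.restrict Sᶜ) ∧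
      |∫ x in Sᶜ, u x j * weakGrad Sᶜ w x i j * v x i| ≤ X)
    (hY : ∀ i j, MemLp (fun x => solidPart S u x j * weakGrad Sᶜ w x i j * v x i) 1
      (volume.restrict Sᶜ) ∧
      |∫ x in Sᶜ, solidPart S u x j * weakGrad Sᶜ w x i j * v x i| ≤ Y) :
    IntegrableOn (bIntegrand S u v w) Sᶜ ∧
      |bForm S m u v w| ≤ 4 * X + 4 * Y + 2 * |rot S u| * normH S m J v * normH S m J w
        + m * |rot S u| * ‖ell S v‖ * ‖ell S w‖ := by
  set μ := (volume : Measure Plane).restrict Sᶜ with hμ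
  have iX := fun i j => memLp_one_iff_integrable.1 (hX i j).1
  have iY := fun i j => memLp_one_iff_integrable.1 (hY i j).1
  have p01 := memLp_one_iff_integrable.1 (memLp_one_mul (memLp_coord S v 0) (memLp_coord S w 1))
  have p10 := memLp_one_iff_integrable.1 (memLp_one_mul (memLp_coord S v 1) (memLp_coord S w 0))
  have iR : Integrable (fun x => rot S u * (v x 0 * w x 1 - v x 1 * w x 0)) μ :=
    (p01.sub p10).const_mul _
  have iE : Integrable (fun x => ∑ i, ∑ j, (u x j * weakGrad Sᶜ w x i j * v x i
      - solidPart S u x j * weakGrad Sᶜ w x i j * v x i)) μ :=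
    integrable_finsetSum _ fun i _ => integrable_finsetSum _ fun j _ => (iX i j).sub (iY i j)
  have iXY : ∀ i j, Integrable (fun x => u x j * weakGrad Sᶜ w x i j * v x i
      - solidPart S u x j * weakGrad Sᶜ w x i j * v x i) μ := fun i j => (iX i j).sub (iY i j)
  have hint : IntegrableOn (bIntegrand S u v w) Sᶜ := by
    rw [bIntegrand_eq]; exact iE.sub iR
  refine ⟨hint, ?_⟩
  have e : ∫ x in Sᶜ, bIntegrand S u v w x = (∑ i, ∑ j,
      ((∫ x in Sᶜ, u x j * weakGrad Sᶜ w x i j * v x i)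
        - ∫ x in Sᶜ, solidPart S u x j * weakGrad Sᶜ w x i j * v x i))
      - rot S u * ((∫ x in Sᶜ, v x 0 * w x 1) - ∫ x in Sᶜ, v x 1 * w x 0) := by
    rw [bIntegrand_eq, integral_sub iE iR, integral_const_mul, integral_sub p01 p10,
      integral_finsetSum _ fun i _ => integrable_finsetSum _ fun j _ => iXY i j]
    congr 1
    refine Finset.sum_congr rfl fun i _ => ?_
    rw [integral_finsetSum _ fun j _ => iXY i j]
    exact Finset.sum_congr rfl fun j _ => integral_sub (iX i j) (iY i j)
  have hE : |∑ i : Fin 2, ∑ j : Fin 2,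
      ((∫ x in Sᶜ, u x j * weakGrad Sᶜ w x i j * v x i)
        - ∫ x in Sᶜ, solidPart S u x j * weakGrad Sᶜ w x i j * v x i)| ≤ 4 * X + 4 * Y := by
    calc _ ≤ ∑ i : Fin 2, ∑ j : Fin 2, (X + Y) := by
          refine (Finset.abs_sum_le_sum_abs _ _).trans (Finset.sum_le_sum fun i _ => ?_)
          refine (Finset.abs_sum_le_sum_abs _ _).trans (Finset.sum_le_sum fun j _ => ?_)
          exact (abs_sub _ _).trans (add_le_add (hX i j).2 (hY i j).2)
      _ = _ := by simp; ring
  have hprod : ∀ i j, |∫ x in Sᶜ, v x i * w x j| ≤ normH S m J v * normH S m J w := fun i j =>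
    (abs_integral_mul_le (memLp_coord S v i) (memLp_coord S w j)).trans
      (mul_le_mul (lp_le_normH hm hJ v i) (lp_le_normH hm hJ w j) (lp_nonneg _ _ _)
        (normH_nonneg _ _ _ _))
  have hinner : |inner ℝ (perp (ell S v)) (ell S w)| ≤ ‖ell S v‖ * ‖ell S w‖ := by
    have := abs_real_inner_le_norm (perp (ell S v)) (ell S w)
    rwa [norm_perp] at this
  rw [bForm, bOn, e]
  have hr := abs_nonneg (rot S u)
  have t1 : |rot S u * ((∫ x in Sᶜ, v x 0 * w x 1) - ∫ x in Sᶜ, v x 1 * w x 0)|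
      ≤ |rot S u| * (2 * (normH S m J v * normH S m J w)) := by
    rw [abs_mul]
    gcongr
    refine (abs_sub _ _).trans ?_
    linarith [hprod 0 1, hprod 1 0]
  have t2 : |m * rot S u * inner ℝ (perp (ell S v)) (ell S w)|
      ≤ m * |rot S u| * (‖ell S v‖ * ‖ell S w‖) := by
    rw [abs_mul, abs_mul, abs_of_pos hm]
    gcongr
  refine (abs_sub _ _).trans ?_
  have := abs_sub (∑ i : Fin 2, ∑ j : Fin 2,
      ((∫ x in Sᶜ, u x j * weakGrad Sᶜ w x i j * v x i)
        - ∫ x in Sᶜ, solidPart S u x j * weakGrad Sᶜ w x i j * v x i))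
      (rot S u * ((∫ x in Sᶜ, v x 0 * w x 1) - ∫ x in Sᶜ, v x 1 * w x 0))
  linarith

theorem aestronglyMeasurable_grad (hS : IsClosed S) {w : L2} (hw : w ∈ spaceV S) (i j : Fin 2) :
    AEStronglyMeasurable (fun x => weakGrad Sᶜ w x i j) (volume.restrict Sᶜ) :=
  (memLp_grad_of_mem_spaceV hS hw i j).1

/-- The bound for the terms with the rigid field, in terms of the norms. -/
theorem solidPart_term_le (hS : IsClosed S) (hm : 0 < m) (hJ : 0 < J) {c : ℝ} (hc : 0 < c)
    (hcb : ∀ φ : L2, ‖ell S φ‖ ≤ c * normH S m J φ ∧ |rot S φ| ≤ c * normH S m J φ) (u v : L2)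
    {w : L2} (hw : w ∈ spaceV S) (i j : Fin 2) :
    MemLp (fun x => solidPart S u x j * weakGrad Sᶜ w x i j * v x i) 1 (volume.restrict Sᶜ) ∧
      |∫ x in Sᶜ, solidPart S u x j * weakGrad Sᶜ w x i j * v x i|
        ≤ 2 * c * (normH S m J u * normH S m J v * normV S m J w) := by
  have h := solidPart_term (S := S) (fun _ => rfl) u (v := v) i j
    (memLp_weakGrad_of_mem hS hw i j) (aestronglyMeasurable_grad hS hw i j)
  refine ⟨h.1, h.2.trans ?_⟩
  have h1 := lp_grad_le_normV (m := m) (J := J) hS hw i j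
  have h2 := lp_le_normH (S := S) hm hJ v i
  have hu := normH_nonneg S m J u
  calc _ ≤ (c * normH S m J u + c * normH S m J u) * normV S m J w * normH S m J v := by
        have := normV_nonneg S m J w
        gcongr
        · exact lp_nonneg _ _ _
        · exact lp_nonneg _ _ _
        · exact (hcb u).1
        · exact (hcb u).2
    _ = _ := by ring

theorem zero_order_le (hm : 0 < m) {c : ℝ}
    (hcb : ∀ φ : L2, ‖ell S φ‖ ≤ c * normH S m J φ ∧ |rot S φ| ≤ c * normH S m J φ) (hc : 0 < c)
    (u v w : L2) :
    2 * |rot S u| * normH S m J v * normH S m J w + m * |rot S u| * ‖ell S v‖ * ‖ell S w‖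
      ≤ (2 * c + m * c ^ 3) * (normH S m J u * normH S m J v * normH S m J w) := by
  have hu := normH_nonneg S m J u
  have hv := normH_nonneg S m J v
  have hw := normH_nonneg S m J w
  calc _ ≤ 2 * (c * normH S m J u) * normH S m J v * normH S m J w
        + m * (c * normH S m J u) * (c * normH S m J v) * (c * normH S m J w) := by
        gcongr
        · exact (hcb u).2
        · exact (hcb u).2
        · exact (hcb v).1
        · exact (hcb w).1
    _ = _ := by ring

/-- L⁴·L²·L⁴ for the part with u, and the weighted gradient paired with v in L² for the part with
u_S; only the latter needs more than the plain gradient of w. -/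
theorem IsBody.exists_bForm_bound (hS : IsBody S) (hm : 0 < m) (hJ : 0 < J) :
    ∃ C : ℝ, 0 < C ∧ ∀ u ∈ spaceVlow S, ∀ v ∈ spaceVlow S, ∀ w ∈ spaceV S,
      IntegrableOn (bIntegrand S u v w) Sᶜ ∧
      |bForm S m u v w| ≤ C * normVlow S m J u * normVlow S m J v * normV S m J w := by
  obtain ⟨c, hc, hcb⟩ := exists_rigid_bound S hm hJ
  obtain ⟨D, hD, hDb⟩ := hS.exists_lp_four_le hm hJ
  refine ⟨4 * D ^ 2 + 4 * (2 * c) + (2 * c + m * c ^ 3), by positivity, fun u hu v hv w hw => ?_⟩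
  have nu := normVlow_nonneg S m J u
  have nv := normVlow_nonneg S m J v
  have nw := normV_nonneg S m J w
  obtain ⟨h1, h2⟩ := bForm_bound hm hJ (u := u) (v := v) (w := w)
    (X := D ^ 2 * (normVlow S m J u * normVlow S m J v * normV S m J w))
    (fun i j => ⟨memLp_mul_mul (hS.memLp_four hu j) (memLp_grad_of_mem_spaceV hS.isClosed hw i j)
      (hS.memLp_four hv i), by
      refine (abs_integral_mul_mul_le (hS.memLp_four hu j)
        (memLp_grad_of_mem_spaceV hS.isClosed hw i j) (hS.memLp_four hv i)).trans ?_
      calc _ ≤ (D * normVlow S m J u) * normV S m J w * (D * normVlow S m J v) := by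
            gcongr
            · exact lp_nonneg _ _ _
            · exact lp_nonneg _ _ _
            · exact hDb u hu j
            · exact lp_plainGrad_le_normV hS.isClosed hw i j
            · exact hDb v hv i
        _ = _ := by ring⟩)
    (fun i j => solidPart_term_le hS.isClosed hm hJ hc hcb u v hw i j)
  refine ⟨h1, h2.trans ?_⟩
  have h3 := zero_order_le hm hcb hc u v w
  have h4 : normH S m J u * normH S m J v ≤ normVlow S m J u * normVlow S m J v :=
    mul_le_mul (normH_le_normVlow _ _ _ _) (normH_le_normVlow _ _ _ _) (normH_nonneg _ _ _ _) nu
  have h5 : normH S m J u * normH S m J v * normV S m J w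
      ≤ normVlow S m J u * normVlow S m J v * normV S m J w := by gcongr
  have h6 : normH S m J u * normH S m J v * normH S m J w
      ≤ normVlow S m J u * normVlow S m J v * normV S m J w :=
    mul_le_mul h4 (normH_le_normV _ _ _ _) (normH_nonneg _ _ _ _) (by positivity)
  calc _ ≤ 4 * (D ^ 2 * (normVlow S m J u * normVlow S m J v * normV S m J w))
        + 4 * (2 * c * (normVlow S m J u * normVlow S m J v * normV S m J w))
        + (2 * c + m * c ^ 3) * (normVlow S m J u * normVlow S m J v * normV S m J w) := by
        have h7 : 2 * c * (normH S m J u * normH S m J v * normV S m J w)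
          ≤ 2 * c * (normVlow S m J u * normVlow S m J v * normV S m J w) := by gcongr
        have h8 : (2 * c + m * c ^ 3) * (normH S m J u * normH S m J v * normH S m J w)
          ≤ (2 * c + m * c ^ 3) * (normVlow S m J u * normVlow S m J v * normV S m J w) := by gcongr
        linarith
    _ = _ := by ring

/-! ### Lipschitz fields -/

/-- The weak gradient of a Lipschitz field is bounded by its Lipschitz constant. -/
theorem HasLipConst.abs_grad_le (hS : IsClosed S) {w : L2} (hw : ∃ G, IsWeakGrad Sᶜ w G) {K : ℝ}
    (h : HasLipConst S w K) (i j : Fin 2) : ∀ᵐ x ∂volume.restrict Sᶜ, |weakGrad Sᶜ w x i j| ≤ K := by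
  obtain ⟨hK, g, hg, he⟩ := h
  have hlip : ∀ i, LipschitzOnWith K.toNNReal (fun x => g x i) (closure Sᶜ) := fun i =>
    LipschitzOnWith.of_dist_le_mul fun x hx y hy => by
      rw [Real.coe_toNNReal K hK, dist_eq_norm, dist_eq_norm]
      exact (PiLp.norm_apply_le (g x - g y) i).trans (hg x hx y hy)
  -- Each component extends to a Lipschitz function on the plane. Its directional derivatives are
  -- bounded by the same constant, and integration by parts shows that they form a weak gradient in
  -- the fluid.
  choose f hf hfe using fun i => (hlip i).extend_real
  have hae : ∀ i, (fun x => w x i) =ᵐ[volume.restrict Sᶜ] f i := fun i => by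
    filter_upwards [he, ae_restrict_mem hS.measurableSet.compl] with x hx hxS
    rw [hx]; exact hfe i (subset_closure hxS)
  let e : Fin 2 → Plane := fun j => EuclideanSpace.single j 1
  have hb : ∀ i j x, |lineDeriv ℝ (f i) x (e j)| ≤ K := fun i j x => by
    have := norm_lineDeriv_le_of_lipschitz (𝕜 := ℝ) (hf i) (x₀ := x) (v := e j)
    simpa [e, Real.coe_toNNReal K hK] using this
  have hm : ∀ i j, AEStronglyMeasurable (fun x => lineDeriv ℝ (f i) x (e j)) volume := fun i j =>
    (stronglyMeasurable_lineDeriv (hf i).continuous).aestronglyMeasurable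
  have hG : IsWeakGrad Sᶜ w fun x i j => lineDeriv ℝ (f i) x (e j) := by
    intro i j
    refine ⟨?_, fun ψ hψ => ?_⟩
    · have : LocallyIntegrable (fun x => lineDeriv ℝ (f i) x (e j)) (volume : Measure Plane) := by
        have : MemLp (fun x => lineDeriv ℝ (f i) x (e j)) ⊤ (volume : Measure Plane) :=
          memLp_top_of_bound (hm i j) K (ae_of_all _ (hb i j))
        exact this.locallyIntegrable le_top
      exact this.locallyIntegrableOn _
    · obtain ⟨D, hD⟩ : ∃ D, LipschitzWith D ψ :=
        ContDiff.lipschitzWith_of_hasCompactSupport hψ.compact hψ.smooth (by simp)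
      have key := LipschitzWith.integral_lineDeriv_mul_eq (μ := (volume : Measure Plane)) (hf i) hD
        hψ.compact (e j)
      have e1 : ∫ x in Sᶜ, w x i * pd j ψ x = ∫ x, f i x * pd j ψ x := by
        have e0 : ∫ x in Sᶜ, f i x * pd j ψ x = ∫ x, f i x * pd j ψ x :=
          setIntegral_eq_integral_of_forall_compl_eq_zero fun x hx => by
            rw [pd_eq_zero_of_notMem fun hm => hx (hψ.subset hm), mul_zero]
        rw [← e0]
        refine integral_congr_ae ?_
        filter_upwards [hae i] with x hx
        rw [hx]
      have e2 : ∫ x in Sᶜ, lineDeriv ℝ (f i) x (e j) * ψ x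
          = ∫ x, lineDeriv ℝ (f i) x (e j) * ψ x :=
        setIntegral_eq_integral_of_forall_compl_eq_zero fun x hx => by
          rw [image_eq_zero_of_notMem_tsupport fun hm => hx (hψ.subset hm), mul_zero]
      rw [e1, e2, key, ← integral_neg]
      congr 1
      ext x
      rw [(hψ.smooth.differentiable_infty x).lineDeriv_eq_fderiv, map_neg, pd]
      ring
  filter_upwards [hG.unique hS.isOpen_compl (isWeakGrad_weakGrad hw)] with x hx
  rw [← hx]
  exact hb i j x

/-- A bounded gradient of w lets u and v stay in L² in the convective term. The terms with u_S are
estimated as before, since they never used more than L² of v. -/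
theorem IsBody.exists_bForm_bound_lip (hS : IsBody S) (hm : 0 < m) (hJ : 0 < J) :
    ∃ C : ℝ, 0 < C ∧ ∀ (u v : L2), ∀ w ∈ spaceVhat S,
      IntegrableOn (bIntegrand S u v w) Sᶜ ∧
      |bForm S m u v w| ≤ C * normH S m J u * normH S m J v * normVhat S m J w := by
  obtain ⟨c, hc, hcb⟩ := exists_rigid_bound S hm hJ
  refine ⟨4 + 4 * (2 * c) + (2 * c + m * c ^ 3), by positivity, fun u v w hw => ?_⟩
  have nu := normH_nonneg S m J u
  have nv := normH_nonneg S m J v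
  have nw := normV_nonneg S m J w
  have hex : ∃ G, IsWeakGrad Sᶜ w G := ⟨_, hw.1.2.choose_spec.1⟩
  have key : ∀ K, HasLipConst S w K → IntegrableOn (bIntegrand S u v w) Sᶜ ∧
      |bForm S m u v w| ≤ 4 * (K * (normH S m J u * normH S m J v))
        + (4 * (2 * c) + (2 * c + m * c ^ 3))
          * (normH S m J u * normH S m J v * normV S m J w) := by
    intro K hK
    have hgu : ∀ i j, MemLp (fun x => u x j * weakGrad Sᶜ w x i j) 2 (volume.restrict Sᶜ) ∧
        lp 2 (volume.restrict Sᶜ) (fun x => u x j * weakGrad Sᶜ w x i j) ≤ K * normH S m J u := by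
      intro i j
      have hle : ∀ᵐ x ∂volume.restrict Sᶜ, |u x j * weakGrad Sᶜ w x i j| ≤ K * |u x j| := by
        filter_upwards [hK.abs_grad_le hS.isClosed hex i j] with x hx
        rw [abs_mul, mul_comm]; gcongr
      refine ⟨(memLp_coord S u j).of_le_mul ((memLp_coord S u j).1.mul
        (aestronglyMeasurable_grad hS.isClosed hw.1 i j)) hle, ?_⟩
      refine (lp_le_of_abs_le hK.1 hle (memLp_coord S u j)).trans ?_
      have := hK.1
      gcongr
      exact lp_le_normH hm hJ u j
    obtain ⟨h1, h2⟩ := bForm_bound hm hJ (u := u) (v := v) (w := w)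
      (X := K * (normH S m J u * normH S m J v))
      (fun i j => ⟨memLp_one_mul (hgu i j).1 (memLp_coord S v i), by
        refine (abs_integral_mul_le (hgu i j).1 (memLp_coord S v i)).trans ?_
        calc _ ≤ (K * normH S m J u) * normH S m J v := by
              have := hK.1
              gcongr
              · exact lp_nonneg _ _ _
              · exact (hgu i j).2
              · exact lp_le_normH hm hJ v i
          _ = _ := by ring⟩)
      (fun i j => solidPart_term_le hS.isClosed hm hJ hc hcb u v hw.1 i j)
    refine ⟨h1, h2.trans ?_⟩
    have h3 := zero_order_le hm hcb hc u v w
    have h6 : normH S m J u * normH S m J v * normH S m J w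
        ≤ normH S m J u * normH S m J v * normV S m J w := by
      gcongr; exact normH_le_normV _ _ _ _
    have h8 : (2 * c + m * c ^ 3) * (normH S m J u * normH S m J v * normH S m J w)
          ≤ (2 * c + m * c ^ 3) * (normH S m J u * normH S m J v * normV S m J w) := by gcongr
    linarith
  obtain ⟨K₀, hK₀⟩ := hw.2
  refine ⟨(key K₀ hK₀).1, ?_⟩
  set P := normH S m J u * normH S m J v with hP
  have hP0 : 0 ≤ P := mul_nonneg nu nv
  set I := sInf {K | HasLipConst S w K} with hI
  have hbdd : BddBelow {K | HasLipConst S w K} := ⟨0, fun K hK => hK.1⟩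
  have hI0 : 0 ≤ I := Real.sInf_nonneg fun K hK => hK.1
  have hfin : |bForm S m u v w| ≤ 4 * (I * P)
      + (4 * (2 * c) + (2 * c + m * c ^ 3)) * (P * normV S m J w) := by
    refine le_of_forall_pos_le_add fun ε hε => ?_
    -- Constants arbitrarily close to the infimum suffice, so attainment is not needed; P + 1 in
    -- place of P keeps the denominator positive.
    obtain ⟨K, hK, hlt⟩ := exists_lt_of_csInf_lt (⟨K₀, hK₀⟩ : {K | HasLipConst S w K}.Nonempty)
      (lt_add_of_pos_right I (div_pos hε (by positivity : 0 < 4 * (P + 1))))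
    have h1 := (key K hK).2
    have h2 : K * P ≤ (I + ε / (4 * (P + 1))) * P := by gcongr
    have h3 : ε / (4 * (P + 1)) * P ≤ ε / 4 := by
      rw [div_mul_eq_mul_div, div_le_div_iff₀ (by positivity) (by norm_num)]
      nlinarith
    linarith
  have hlip : I ≤ lipNorm S w := le_add_of_nonneg_left ENNReal.toReal_nonneg
  rw [normVhat]
  have hc3 : 0 ≤ 4 * (2 * c) + (2 * c + m * c ^ 3) := by positivity
  calc |bForm S m u v w| ≤ 4 * (I * P)
        + (4 * (2 * c) + (2 * c + m * c ^ 3)) * (P * normV S m J w) := hfin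
    _ ≤ 4 * ((normV S m J w + lipNorm S w) * P)
        + (4 * (2 * c) + (2 * c + m * c ^ 3)) * (P * (normV S m J w + lipNorm S w)) := by
        gcongr
        · linarith
        · linarith
    _ = _ := by rw [hP]; ring

end FormB

section Trilinear
variable {S : Set Plane} {m J : ℝ}

/-! ### Trilinearity of `b` -/

/-- A map that respects combinations `c • x + y`, as a linear map. -/
def linearOfCombination {V W : Type*} [AddCommGroup V] [Module ℝ V] [AddCommGroup W] [Module ℝ W]
    (f : V → W) (h : ∀ (c : ℝ) x y, f (c • x + y) = c • f x + f y) : V →ₗ[ℝ] W where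
  toFun := f
  map_add' x y := by simpa using h 1 x y
  map_smul' c x := by
    have h0 : f 0 = 0 := by simpa using h 1 0 0
    simpa [h0] using h c x 0

theorem coeFn_combination (c : ℝ) (φ ψ : L2) :
    ∀ᵐ x, (c • φ + ψ : L2) x = c • φ x + ψ x := by
  filter_upwards [Lp.coeFn_add (c • φ) ψ, Lp.coeFn_smul c φ] with x h1 h2
  rw [h1, Pi.add_apply, h2, Pi.smul_apply]

theorem IsBody.rigidPart_combination (hS : IsBody S) {φ ψ : L2} (hφ : φ ∈ spaceH S)
    (hψ : ψ ∈ spaceH S) (c : ℝ) :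
    rigidPart S (c • φ + ψ : L2) = c • rigidPart S φ + rigidPart S ψ := by
  rw [hS.rigidPart_add ((spaceH S).smul_mem c hφ) hψ, hS.rigidPart_smul hφ]

theorem weakGrad_combination {Ω : Set Plane} (hΩ : IsOpen Ω) {φ ψ : L2}
    (h : ∃ G, IsWeakGrad Ω φ G) (h' : ∃ G, IsWeakGrad Ω ψ G) (c : ℝ) : ∀ᵐ x ∂volume.restrict Ω,
      weakGrad Ω (c • φ + ψ : L2) x = c • weakGrad Ω φ x + weakGrad Ω ψ x := by
  filter_upwards [weakGrad_add hΩ ⟨_, (isWeakGrad_weakGrad h).smul c⟩ h',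
    weakGrad_smul hΩ h c] with x h1 h2
  rw [h1, h2]

theorem IsBody.ell_combination (hS : IsBody S) {φ ψ : L2} (hφ : φ ∈ spaceH S)
    (hψ : ψ ∈ spaceH S) (c : ℝ) : ell S (c • φ + ψ : L2) = c • ell S φ + ell S ψ := by
  rw [ell, hS.rigidPart_combination hφ hψ]; rfl

theorem IsBody.rot_combination (hS : IsBody S) {φ ψ : L2} (hφ : φ ∈ spaceH S)
    (hψ : ψ ∈ spaceH S) (c : ℝ) : rot S (c • φ + ψ : L2) = c * rot S φ + rot S ψ := by
  rw [rot, hS.rigidPart_combination hφ hψ]; rfl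

theorem IsBody.solidPart_combination (hS : IsBody S) {φ ψ : L2} (hφ : φ ∈ spaceH S)
    (hψ : ψ ∈ spaceH S) (c : ℝ) (x : Plane) :
    solidPart S (c • φ + ψ : L2) x = c • solidPart S φ x + solidPart S ψ x := by
  rw [solidPart, hS.rigidPart_combination hφ hψ, rigidField_add, rigidField_smul]; rfl

/-- Linearity of `b_A`, from linearity of the integrand and of the boundary term. -/
theorem bForm_combination {u₁ v₁ w₁ u₂ v₂ w₂ u₃ v₃ w₃ : Plane → Plane} {c : ℝ}
    (h₁ : IntegrableOn (bIntegrand S u₁ v₁ w₁) Sᶜ) (h₂ : IntegrableOn (bIntegrand S u₂ v₂ w₂) Sᶜ)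
    (h : ∀ᵐ x ∂volume.restrict Sᶜ,
      bIntegrand S u₃ v₃ w₃ x = c * bIntegrand S u₁ v₁ w₁ x + bIntegrand S u₂ v₂ w₂ x)
    (h' : rot S u₃ * inner ℝ (perp (ell S v₃)) (ell S w₃) =
      c * (rot S u₁ * inner ℝ (perp (ell S v₁)) (ell S w₁))
        + rot S u₂ * inner ℝ (perp (ell S v₂)) (ell S w₂)) :
    bForm S m u₃ v₃ w₃ = c * bForm S m u₁ v₁ w₁ + bForm S m u₂ v₂ w₂ := by
  simp only [bForm, bOn]
  rw [integral_congr_ae h, integral_add (h₁.const_mul c) h₂, integral_const_mul,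
    mul_assoc m, h']
  ring

theorem bIntegrand_combination_left {u₁ u₂ u₃ : Plane → Plane} (v w : Plane → Plane) {c : ℝ}
    {x : Plane} (h1 : u₃ x = c • u₁ x + u₂ x)
    (h2 : solidPart S u₃ x = c • solidPart S u₁ x + solidPart S u₂ x)
    (h3 : rot S u₃ = c * rot S u₁ + rot S u₂) :
    bIntegrand S u₃ v w x = c * bIntegrand S u₁ v w x + bIntegrand S u₂ v w x := by
  simp only [bIntegrand, h1, h2, h3, PiLp.add_apply, PiLp.smul_apply, smul_eq_mul,
    Fin.sum_univ_two]
  ring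

theorem bIntegrand_combination_mid {v₁ v₂ v₃ : Plane → Plane} (u w : Plane → Plane) {c : ℝ}
    {x : Plane} (h1 : v₃ x = c • v₁ x + v₂ x) :
    bIntegrand S u v₃ w x = c * bIntegrand S u v₁ w x + bIntegrand S u v₂ w x := by
  simp only [bIntegrand, h1, perp_add, perp_smul, inner_add_left, real_inner_smul_left,
    PiLp.add_apply, PiLp.smul_apply, smul_eq_mul, Fin.sum_univ_two]
  ring

theorem bIntegrand_combination_right {w₁ w₂ w₃ : Plane → Plane} (u v : Plane → Plane) {c : ℝ}
    {x : Plane} (h1 : w₃ x = c • w₁ x + w₂ x)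
    (h2 : weakGrad Sᶜ w₃ x = c • weakGrad Sᶜ w₁ x + weakGrad Sᶜ w₂ x) :
    bIntegrand S u v w₃ x = c * bIntegrand S u v w₁ x + bIntegrand S u v w₂ x := by
  simp only [bIntegrand, h1, h2, inner_add_right, real_inner_smul_right,
    Pi.add_apply, Pi.smul_apply, smul_eq_mul, Fin.sum_univ_two]
  ring

/-- The integrand is linear in each argument only almost everywhere, since sums in L² and weak
gradients are determined only up to null sets. Integrability then transfers linearity to the
integral. The three subspaces are left free so that one argument serves several triples of spaces.
-/
theorem IsBody.exists_trilinear (hS : IsBody S) {U V W : Submodule ℝ L2} (hU : U ≤ spaceH S)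
    (hV : V ≤ spaceH S) (hW : W ≤ spaceH S) (hG : ∀ w ∈ W, ∃ G, IsWeakGrad Sᶜ w G)
    (hI : ∀ u ∈ U, ∀ v ∈ V, ∀ w ∈ W, IntegrableOn (bIntegrand S u v w) Sᶜ) :
    ∃ B : U →ₗ[ℝ] V →ₗ[ℝ] W →ₗ[ℝ] ℝ, ∀ (u : U) (v : V) (w : W), B u v w = bForm S m u v w := by
  refine ⟨linearOfCombination (fun u : U => linearOfCombination (fun v : V => linearOfCombination
    (fun w : W => bForm S m u v w) ?_) ?_) ?_, fun u v w => rfl⟩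
  · intro c w₁ w₂
    refine bForm_combination (hI u u.2 v v.2 w₁ w₁.2) (hI u u.2 v v.2 w₂ w₂.2) ?_ ?_
    · filter_upwards [ae_restrict_of_ae (coeFn_combination c (w₁ : L2) w₂),
        weakGrad_combination hS.isClosed.isOpen_compl (hG w₁ w₁.2) (hG w₂ w₂.2) c] with x h1 h2
      exact bIntegrand_combination_right _ _ h1 h2
    · have := hS.ell_combination (hW w₁.2) (hW w₂.2) c
      simp only [Submodule.coe_add, Submodule.coe_smul, this, inner_add_right,
        real_inner_smul_right]
      ring
  · intro c v₁ v₂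
    ext w
    refine bForm_combination (hI u u.2 v₁ v₁.2 w w.2) (hI u u.2 v₂ v₂.2 w w.2) ?_ ?_
    · filter_upwards [ae_restrict_of_ae (coeFn_combination c (v₁ : L2) v₂)] with x h1
      exact bIntegrand_combination_mid _ _ h1
    · have := hS.ell_combination (hV v₁.2) (hV v₂.2) c
      simp only [Submodule.coe_add, Submodule.coe_smul, this, perp_add, perp_smul, inner_add_left,
        real_inner_smul_left]
      ring
  · intro c u₁ u₂
    ext v w
    have h3 := hS.rot_combination (hU u₁.2) (hU u₂.2) c
    refine bForm_combination (hI u₁ u₁.2 v v.2 w w.2) (hI u₂ u₂.2 v v.2 w w.2) ?_ ?_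
    · filter_upwards [ae_restrict_of_ae (coeFn_combination c (u₁ : L2) u₂)] with x h1
      exact bIntegrand_combination_left _ _ h1
        (hS.solidPart_combination (hU u₁.2) (hU u₂.2) c x) h3
    · simp only [Submodule.coe_add, Submodule.coe_smul, h3]
      ring

end Trilinear

/-! ### Passage to the limit in products -/

theorem lp_add_le {μ : Measure Plane} {p : ℝ≥0∞} (hp : 1 ≤ p) {f g : Plane → ℝ} (hf : MemLp f p μ)
    (hg : MemLp g p μ) : lp p μ (fun x => f x + g x) ≤ lp p μ f + lp p μ g := by
  rw [lp, lp, lp, ← ENNReal.toReal_add hf.2.ne hg.2.ne]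
  exact ENNReal.toReal_mono (ENNReal.add_ne_top.2 ⟨hf.2.ne, hg.2.ne⟩) (eLpNorm_add_le hf.1 hg.1 hp)

theorem tendsto_integral_mul_mul {μ : Measure Plane} {f g h : Plane → ℝ} {F G H : ℕ → Plane → ℝ}
    (hf : MemLp f 4 μ) (hg : MemLp g 2 μ) (hh : MemLp h 4 μ) (hF : ∀ n, MemLp (F n) 4 μ)
    (hG : ∀ n, MemLp (G n) 2 μ) (hH : ∀ n, MemLp (H n) 4 μ)
    (tF : Tendsto (fun n => eLpNorm (F n - f) 4 μ) atTop (𝓝 0))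
    (tG : Tendsto (fun n => eLpNorm (G n - g) 2 μ) atTop (𝓝 0))
    (tH : Tendsto (fun n => eLpNorm (H n - h) 4 μ) atTop (𝓝 0)) :
    Tendsto (fun n => ∫ x, F n x * G n x * H n x ∂μ) atTop (𝓝 (∫ x, f x * g x * h x ∂μ)) := by
  have tF' : Tendsto (fun n => lp 4 μ (F n - f)) atTop (𝓝 0) :=
    (ENNReal.tendsto_toReal ENNReal.zero_ne_top).comp tF
  have tG' : Tendsto (fun n => lp 2 μ (G n - g)) atTop (𝓝 0) :=
    (ENNReal.tendsto_toReal ENNReal.zero_ne_top).comp tG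
  have tH' : Tendsto (fun n => lp 4 μ (H n - h)) atTop (𝓝 0) :=
    (ENNReal.tendsto_toReal ENNReal.zero_ne_top).comp tH
  rw [tendsto_iff_norm_sub_tendsto_zero]
  have hlim : Tendsto (fun n => lp 4 μ (F n - f) * (lp 2 μ (G n - g) + lp 2 μ g)
      * (lp 4 μ (H n - h) + lp 4 μ h) + lp 4 μ f * lp 2 μ (G n - g) * (lp 4 μ (H n - h) + lp 4 μ h)
      + lp 4 μ f * lp 2 μ g * lp 4 μ (H n - h)) atTop (𝓝 0) := by
    have := ((tF'.mul (tG'.add_const (lp 2 μ g))).mul (tH'.add_const (lp 4 μ h))).add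
      (((tG'.const_mul (lp 4 μ f)).mul (tH'.add_const (lp 4 μ h))).add
        (tH'.const_mul (lp 4 μ f * lp 2 μ g)))
    simpa [add_assoc] using this
  refine squeeze_zero (fun _ => norm_nonneg _) (fun n => ?_) hlim
  have dF := (hF n).sub hf
  have dG := (hG n).sub hg
  have dH := (hH n).sub hh
  have bG : lp 2 μ (G n) ≤ lp 2 μ (G n - g) + lp 2 μ g := by
    simpa using lp_add_le (by norm_num) dG hg
  have bH : lp 4 μ (H n) ≤ lp 4 μ (H n - h) + lp 4 μ h := by
    simpa using lp_add_le (by norm_num) dH hh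
  have i1 := memLp_one_iff_integrable.1 (memLp_mul_mul dF (hG n) (hH n))
  have i2 := memLp_one_iff_integrable.1 (memLp_mul_mul hf dG (hH n))
  have i3 := memLp_one_iff_integrable.1 (memLp_mul_mul hf hg dH)
  have iA := memLp_one_iff_integrable.1 (memLp_mul_mul (hF n) (hG n) (hH n))
  have iB := memLp_one_iff_integrable.1 (memLp_mul_mul hf hg hh)
  -- Telescoping: the factors are replaced by their limits one at a time.
  have e : (∫ x, F n x * G n x * H n x ∂μ) - ∫ x, f x * g x * h x ∂μ
      = (∫ x, (F n - f) x * G n x * H n x ∂μ) + (∫ x, f x * (G n - g) x * H n x ∂μ)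
        + ∫ x, f x * g x * (H n - h) x ∂μ := by
    have i12 : Integrable (fun x => (F n - f) x * G n x * H n x + f x * (G n - g) x * H n x) μ :=
      i1.add i2
    rw [← integral_sub iA iB, ← integral_add i1 i2, ← integral_add i12 i3]
    congr 1
    ext x
    simp only [Pi.sub_apply]; ring
  have := lp_nonneg 4 μ f
  have := lp_nonneg 2 μ g
  have := lp_nonneg 4 μ (F n - f)
  have := lp_nonneg 2 μ (G n - g)
  rw [e, Real.norm_eq_abs]
  refine (abs_add_three _ _ _).trans (add_le_add (add_le_add ?_ ?_) ?_)
  · refine (abs_integral_mul_mul_le dF (hG n) (hH n)).trans ?_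
    gcongr
    exact lp_nonneg _ _ _
  · refine (abs_integral_mul_mul_le hf dG (hH n)).trans ?_
    gcongr
  · exact abs_integral_mul_mul_le hf hg dH

/-! ### Transport identities for divergence-free fields -/

section Transport
variable {S : Set Plane} {m J : ℝ}

/-- The weak form of `∫ U · ∇(χ φ²) = 0`. -/
theorem SmoothLimit.transport_eq {Ω : Set Plane} {f : ℕ → Plane → ℝ} {φ : Plane → ℝ}
    {G : Fin 2 → Plane → ℝ} (h : SmoothLimit Ω f φ G) (hφ : MemLp φ 4 (volume.restrict Ω))
    (hG : ∀ j, MemLp (G j) 2 (volume.restrict Ω))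
    (ht : Tendsto (fun n => eLpNorm (f n - φ) 4 (volume.restrict Ω)) atTop (𝓝 0))
    {U : Plane → Plane} {χ : Plane → ℝ} (hχ : ContDiff ℝ ∞ χ)
    (hP : ∀ j, MemLp (fun x => χ x * U x j) 4 (volume.restrict Ω))
    (hQ : ∀ j, MemLp (fun x => U x j * pd j χ x) 2 (volume.restrict Ω))
    (hdiv : ∀ g, ContDiff ℝ ∞ g → HasCompactSupport g →
      ∫ x in Ω, ∑ j, U x j * pd j (fun y => χ y * g y) x = 0) :
    ∑ j, (2 * (∫ x in Ω, (χ x * U x j) * G j x * φ x)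
      + ∫ x in Ω, φ x * (U x j * pd j χ x) * φ x) = 0 := by
  set μ := (volume : Measure Plane).restrict Ω
  have hf4 : ∀ n, MemLp (f n) 4 μ := fun n =>
    (h.smooth n).continuous.memLp_of_hasCompactSupport (h.compact n)
  have hpd : ∀ n j, MemLp (pd j (f n)) 2 μ := fun n j =>
    (contDiff_pd (h.smooth n) j).continuous.memLp_of_hasCompactSupport
      (compact_pd (isTest_univ (h.smooth n) (h.compact n)) j)
  -- The identity is the hypothesis `hdiv` for g = (f n)², expanded by the product rule.
  have hn : ∀ n, ∑ j, (2 * (∫ x in Ω, (χ x * U x j) * pd j (f n) x * f n x)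
      + ∫ x in Ω, f n x * (U x j * pd j χ x) * f n x) = 0 := fun n => by
    have hd := (h.smooth n).differentiable_infty
    have i1 := fun j => memLp_one_iff_integrable.1 (memLp_mul_mul (hP j) (hpd n j) (hf4 n))
    have i2 := fun j => memLp_one_iff_integrable.1 (memLp_mul_mul (hf4 n) (hQ j) (hf4 n))
    rw [← hdiv (fun x => f n x * f n x) ((h.smooth n).mul (h.smooth n)) (h.compact n).mul_left]
    have hp : ∀ j x, pd j (fun y => χ y * (f n y * f n y)) x
        = 2 * (χ x * pd j (f n) x * f n x) + f n x * pd j χ x * f n x := fun j x => by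
      rw [pd_mul (g := fun y => f n y * f n y) hχ.differentiable_infty (hd.mul hd), pd_mul hd hd]
      ring
    simp only [hp]
    rw [integral_finsetSum]
    · refine Finset.sum_congr rfl fun j _ => ?_
      rw [← integral_const_mul, ← integral_add ((i1 j).const_mul 2) (i2 j)]
      congr 1; ext x; ring
    · intro j _
      refine (((i1 j).const_mul 2).add (i2 j)).congr (ae_of_all _ fun x => ?_)
      simp only [Pi.add_apply]; ring
  have hz : ∀ (p : ℝ≥0∞) (k : Plane → ℝ), Tendsto (fun _ : ℕ => eLpNorm (k - k) p μ) atTop (𝓝 0) :=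
    fun p k => by simp
  have hl := tendsto_finsetSum (Finset.univ : Finset (Fin 2)) fun j _ =>
    ((tendsto_integral_mul_mul (hP j) (hG j) hφ (fun _ => hP j) (fun n => hpd n j) hf4
      (hz 4 _) (h.tendsto_pd j) ht).const_mul 2).add
    (tendsto_integral_mul_mul hφ (hQ j) hφ hf4 (fun _ => hQ j) hf4 ht (hz 2 _) ht)
  exact tendsto_nhds_unique hl (tendsto_const_nhds.congr fun n => (hn n).symm)

/-- The expression `[(U · ∇) v] · v`. -/
noncomputable def convection (S : Set Plane) (U v : Plane → Plane) (x : Plane) : ℝ :=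
  ∑ i, ∑ j, U x j * weakGrad Sᶜ v x i j * v x i

/-- The scalar identity summed over the components of v: up to the factor 2, convection of v along U
against χ is minus the flux of |v|² through the region where χ varies. No boundary term appears,
because `hdiv` allows g to be arbitrary on the boundary. -/
theorem IsBody.transport_eq (hS : IsBody S) {v : L2} (hv : v ∈ spaceVlow S)
    {U : Plane → Plane} {χ : Plane → ℝ} (hχ : ContDiff ℝ ∞ χ)
    (hP : ∀ j, MemLp (fun x => χ x * U x j) 4 (volume.restrict Sᶜ))
    (hQ : ∀ j, MemLp (fun x => U x j * pd j χ x) 2 (volume.restrict Sᶜ))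
    (hdiv : ∀ g, ContDiff ℝ ∞ g → HasCompactSupport g →
      ∫ x in Sᶜ, ∑ j, U x j * pd j (fun y => χ y * g y) x = 0) :
    2 * (∫ x in Sᶜ, χ x * convection S U v x)
      + ∑ i, ∫ x in Sᶜ, (∑ j, U x j * pd j χ x) * v x i ^ 2 = 0 := by
  have hG := memLp_grad_of_mem_spaceVlow hS.isClosed hv
  have key : ∀ i, ∑ j, (2 * (∫ x in Sᶜ, (χ x * U x j) * weakGrad Sᶜ v x i j * v x i)
      + ∫ x in Sᶜ, v x i * (U x j * pd j χ x) * v x i) = 0 := fun i => by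
    obtain ⟨C, hC, hb⟩ := hS.exists_bound_eLpNorm_four
    obtain ⟨f, hf⟩ := hS.exists_smoothLimit hv i
    exact hf.transport_eq (hS.memLp_four hv i) (hG i) (hf.tendsto_eLpNorm hC hb).2 hχ hP hQ hdiv
  have i1 := fun i j => memLp_one_iff_integrable.1 (memLp_mul_mul (hP j) (hG i j) (hS.memLp_four hv i))
  have i2 := fun i j => memLp_one_iff_integrable.1
    (memLp_mul_mul (hS.memLp_four hv i) (hQ j) (hS.memLp_four hv i))
  have e1 : ∫ x in Sᶜ, χ x * convection S U v x
      = ∑ i, ∑ j, ∫ x in Sᶜ, (χ x * U x j) * weakGrad Sᶜ v x i j * v x i := by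
    calc _ = ∫ x in Sᶜ, ∑ i, ∑ j, (χ x * U x j) * weakGrad Sᶜ v x i j * v x i := by
          simp only [convection, Finset.mul_sum, mul_assoc]
      _ = ∑ i, ∫ x in Sᶜ, ∑ j, (χ x * U x j) * weakGrad Sᶜ v x i j * v x i :=
          integral_finsetSum _ fun i _ => integrable_finsetSum _ fun j _ => i1 i j
      _ = _ := Finset.sum_congr rfl fun i _ => integral_finsetSum _ fun j _ => i1 i j
  have e2 : ∀ i, ∫ x in Sᶜ, (∑ j, U x j * pd j χ x) * v x i ^ 2
      = ∑ j, ∫ x in Sᶜ, v x i * (U x j * pd j χ x) * v x i := fun i => by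
    rw [← integral_finsetSum _ fun j _ => i2 i j]
    congr 1
    ext x
    rw [Finset.sum_mul]
    exact Finset.sum_congr rfl fun j _ => by ring
  have k0 := key 0
  have k1 := key 1
  simp only [e1, e2]
  simp only [Fin.sum_univ_two] at k0 k1 ⊢
  linarith

/-! ### Fields without divergence -/

theorem integral_affine_mul_pd (a : ℝ) (L : Plane →L[ℝ] ℝ) {j : Fin 2}
    (hL : L (EuclideanSpace.single j 1) = 0) {ψ : Plane → ℝ} (hψ : IsTest univ ψ) :
    ∫ x, (a + L x) * pd j ψ x = 0 := by
  have hf : ∀ x, HasFDerivAt (fun x => a + L x) L x := fun x => L.hasFDerivAt.const_add a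
  have hc : Continuous fun x => a + L x := by fun_prop
  have h := integral_mul_fderiv_eq_neg_fderiv_mul_of_integrable (μ := (volume : Measure Plane))
    (f := fun x => a + L x) (g := ψ) (v := EuclideanSpace.single j 1) ?_ ?_ ?_
    (fun x _ => (hf x).differentiableAt) fun x _ => hψ.smooth.differentiable_infty x
  · simpa only [(hf _).fderiv, hL, zero_mul, integral_zero, neg_zero, pd] using h
  · simp only [(hf _).fderiv, hL, zero_mul]
    exact integrable_zero _ _ _
  · exact (hc.mul (continuous_pd hψ j)).integrable_of_hasCompactSupport (compact_pd hψ j).mul_left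
  · exact (hc.mul hψ.smooth.continuous).integrable_of_hasCompactSupport hψ.compact.mul_left

theorem integrable_rigidField_mul_pd (p : Plane × ℝ) {ψ : Plane → ℝ} (hψ : IsTest univ ψ)
    (j : Fin 2) : Integrable fun x => rigidField p x j * pd j ψ x :=
  (((EuclideanSpace.proj j : Plane →L[ℝ] ℝ).continuous.comp (continuous_rigidField p)).mul
    (continuous_pd hψ j)).integrable_of_hasCompactSupport (compact_pd hψ j).mul_left

/-- The j-th component of a rigid field does not depend on the j-th coordinate, so each term
vanishes separately. -/
theorem integral_rigidField_mul_pd (p : Plane × ℝ) {ψ : Plane → ℝ} (hψ : IsTest univ ψ)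
    (j : Fin 2) : ∫ x, rigidField p x j * pd j ψ x = 0 := by
  fin_cases j
  · have := integral_affine_mul_pd (p.1 0) (-p.2 • (EuclideanSpace.proj 1 : Plane →L[ℝ] ℝ))
      (j := 0) (by simp) hψ
    simpa [rigidField] using this
  · have := integral_affine_mul_pd (p.1 1) (p.2 • (EuclideanSpace.proj 0 : Plane →L[ℝ] ℝ))
      (j := 1) (by simp) hψ
    simpa [rigidField] using this

/-- The relative velocity `u - u_𝓢` has no divergence in the fluid domain and no flux through the
boundary. -/
theorem IsBody.integral_relative_eq_zero (hS : IsBody S) {u : L2} (hu : u ∈ spaceH S)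
    {ψ : Plane → ℝ} (hψ : IsTest univ ψ) :
    ∫ x in Sᶜ, ∑ j, (u x - solidPart S u x) j * pd j ψ x = 0 := by
  have i1 : ∀ j, Integrable fun x => u x j * pd j ψ x := fun j =>
    integrable_coord u j (continuous_pd hψ j) (compact_pd hψ j)
  have i2 : ∀ j, Integrable fun x => solidPart S u x j * pd j ψ x :=
    integrable_rigidField_mul_pd _ hψ
  -- In the solid the relative velocity vanishes, so the fluid integral is an integral over the
  -- plane, where both u and u_S have no divergence.
  have hz : ∫ x in S, ∑ j, (u x - solidPart S u x) j * pd j ψ x = 0 := by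
    refine integral_eq_zero_of_ae ?_
    filter_upwards [hS.ae_eq_solidPart hu] with x hx
    simp [hx]
  have e : ∀ x, ∑ j, (u x - solidPart S u x) j * pd j ψ x
      = ∑ j, (u x j * pd j ψ x - solidPart S u x j * pd j ψ x) := fun x => by
    simp only [PiLp.sub_apply, sub_mul]
  have hint : Integrable fun x => ∑ j, (u x - solidPart S u x) j * pd j ψ x := by
    simp only [e]
    exact integrable_finsetSum _ fun j _ => (i1 j).sub (i2 j)
  have h := integral_add_compl hS.isClosed.measurableSet hint
  rw [hz, zero_add] at h
  rw [h]
  simp only [e]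
  have i12 : ∀ j, Integrable fun x => u x j * pd j ψ x - solidPart S u x j * pd j ψ x :=
    fun j => (i1 j).sub (i2 j)
  rw [integral_finsetSum _ fun j _ => i12 j]
  have : ∀ j, ∫ x, (u x j * pd j ψ x - solidPart S u x j * pd j ψ x) = ∫ x, u x j * pd j ψ x :=
    fun j => by
      rw [integral_sub (i1 j) (i2 j), solidPart, integral_rigidField_mul_pd _ hψ, sub_zero]
  simp only [this]
  exact hu.1 ψ hψ

/-- A rotation has no divergence. -/
theorem integral_perp_eq_zero {S : Set Plane} {ψ : Plane → ℝ}
    (hψ : IsTest univ ψ) (h0 : ∀ x ∈ S, ∀ j, pd j ψ x = 0) :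
    ∫ x in Sᶜ, ∑ j, perp x j * pd j ψ x = 0 := by
  have e : ∀ x j, perp x j = rigidField (0, 1) x j := fun x j => by simp [rigidField]
  rw [setIntegral_eq_integral_of_forall_compl_eq_zero fun x hx => ?_]
  · simp only [e]
    rw [integral_finsetSum _ fun j _ => integrable_rigidField_mul_pd _ hψ j]
    exact Finset.sum_eq_zero fun j _ => integral_rigidField_mul_pd _ hψ j
  · exact Finset.sum_eq_zero fun j _ => by rw [h0 x (not_not.1 hx), mul_zero]

end Transport

/-! ### Vanishing of the form on the diagonal, and the behaviour at infinity -/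

section Vanishing
variable {S : Set Plane} {m J : ℝ}

theorem memLp_mul_of_hasCompactSupport {μ : Measure Plane} {p : ℝ≥0∞} {χ f : Plane → ℝ}
    (hχ : Continuous χ) (hc : HasCompactSupport χ) (hf : MemLp f p μ) :
    MemLp (fun x => χ x * f x) p μ := by
  obtain ⟨C, hC⟩ := hc.exists_bound_of_continuous hχ
  refine hf.of_le_mul (c := C) (hχ.aestronglyMeasurable.mul hf.1) (ae_of_all _ fun x => ?_)
  rw [norm_mul]
  exact mul_le_mul_of_nonneg_right (hC x) (norm_nonneg _)

theorem continuous_coord {U : Plane → Plane} (hU : Continuous U) (j : Fin 2) :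
    Continuous fun x => U x j := (EuclideanSpace.proj j : Plane →L[ℝ] ℝ).continuous.comp hU

theorem memLp_mul_coord {μ : Measure Plane} [IsFiniteMeasureOnCompacts μ] {p : ℝ≥0∞}
    {χ : Plane → ℝ} {U : Plane → Plane} (hχ : Continuous χ) (hc : HasCompactSupport χ)
    (hU : Continuous U) (j : Fin 2) : MemLp (fun x => χ x * U x j) p μ :=
  (hχ.mul (continuous_coord hU j)).memLp_of_hasCompactSupport hc.mul_right

theorem IsBody.integrable_mul_convection (hS : IsBody S) {v : L2} (hv : v ∈ spaceVlow S)
    {U : Plane → Plane} {χ : Plane → ℝ}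
    (hP : ∀ j, MemLp (fun x => χ x * U x j) 4 (volume.restrict Sᶜ)) :
    IntegrableOn (fun x => χ x * convection S U v x) Sᶜ := by
  have hG := memLp_grad_of_mem_spaceVlow hS.isClosed hv
  have h : Integrable (fun x => ∑ i, ∑ j, (χ x * U x j) * weakGrad Sᶜ v x i j * v x i)
      (volume.restrict Sᶜ) :=
    integrable_finsetSum _ fun i _ => integrable_finsetSum _ fun j _ =>
      memLp_one_iff_integrable.1 (memLp_mul_mul (hP j) (hG i j) (hS.memLp_four hv i))
  refine h.congr (ae_of_all _ fun x => ?_)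
  simp only [convection, Finset.mul_sum, mul_assoc]

theorem IsBody.integrable_mul_convection_perp (hS : IsBody S) {v : L2} (hv : v ∈ spaceVlow S)
    {χ : Plane → ℝ} (hχ : Continuous χ) (hc : HasCompactSupport χ) :
    IntegrableOn (fun x => χ x * convection S perp v x) Sᶜ :=
  hS.integrable_mul_convection hv fun j => memLp_mul_coord hχ hc continuous_perp j

theorem IsBody.integrableOn_convection_perp (hS : IsBody S) {v : L2} (hv : v ∈ spaceVlow S)
    (R : ℝ) : IntegrableOn (convection S perp v) (Sᶜ ∩ Metric.ball 0 R) := by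
  have hR : 0 < max R 1 := lt_max_of_lt_right one_pos
  refine ((hS.integrable_mul_convection_perp hv (contDiff_cut _).continuous
    (hasCompactSupport_cut hR)).mono_set inter_subset_left).congr_fun (fun x hx => ?_)
    (hS.isClosed.measurableSet.compl.inter measurableSet_ball)
  have hx' : ‖x‖ ≤ max R 1 := (mem_ball_zero_iff.1 hx.2).le.trans (le_max_left _ _)
  simp only [cut_eq_one hR hx', one_mul]

/-- The integral of the rotational part against a radial cut-off does not depend on the cut-off. -/
theorem IsBody.integral_radial_mul_convection_perp (hS : IsBody S) {v : L2}
    (hv : v ∈ spaceVlow S) {θ₁ θ₂ : ℝ → ℝ} (h₁ : ContDiff ℝ ∞ θ₁) (h₂ : ContDiff ℝ ∞ θ₂)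
    {M₁ M₂ : ℝ} (hM₁ : ∀ s, M₁ ≤ s → θ₁ s = 0) (hM₂ : ∀ s, M₂ ≤ s → θ₂ s = 0) {R : ℝ}
    (hR : ∀ x ∈ S, ‖x‖ < R) (he : ∀ s ≤ R ^ 2, θ₁ s = θ₂ s) :
    ∫ x in Sᶜ, θ₁ (‖x‖ ^ 2) * convection S perp v x
      = ∫ x in Sᶜ, θ₂ (‖x‖ ^ 2) * convection S perp v x := by
  have c₁ := hasCompactSupport_radial hM₁
  have c₂ := hasCompactSupport_radial hM₂
  have i₁ := hS.integrable_mul_convection_perp hv (contDiff_radial h₁).continuous c₁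
  have i₂ := hS.integrable_mul_convection_perp hv (contDiff_radial h₂).continuous c₂
  set χ : Plane → ℝ := fun x => θ₁ (‖x‖ ^ 2) - θ₂ (‖x‖ ^ 2) with hχ
  have hs : ContDiff ℝ ∞ χ := (contDiff_radial h₁).sub (contDiff_radial h₂)
  have hc : HasCompactSupport χ := c₁.sub c₂
  have hpd : ∀ j x, pd j χ x = 2 * x j * deriv (fun s => θ₁ s - θ₂ s) (‖x‖ ^ 2) := fun j x =>
    pd_radial (h₁.sub h₂) j x
  have hz : ∀ x, ∑ j, perp x j * pd j χ x = 0 := fun x => by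
    simp only [hpd, Fin.sum_univ_two, perp_zero_apply, perp_one_apply]; ring
  have key := hS.transport_eq hv (U := perp) hs
    (fun j => memLp_mul_coord hs.continuous hc continuous_perp j)
    (fun j => by
      have := memLp_mul_coord (μ := volume.restrict Sᶜ) (p := 2)
        (continuous_pd (isTest_univ hs hc) j) (compact_pd (isTest_univ hs hc) j) continuous_perp j
      simpa only [mul_comm] using this)
    -- x^⊥ is in general not tangent to the boundary. This does no harm, because the difference of
    -- the two cut-offs vanishes in a neighbourhood of the solid.
    (fun g hg hgc => integral_perp_eq_zero (isTest_univ (hs.mul hg) hc.mul_right) fun x hx j => by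
      have hev : (fun y => χ y * g y) =ᶠ[𝓝 x] fun _ => 0 := by
        filter_upwards [continuous_norm.continuousAt.eventually (gt_mem_nhds (hR x hx))] with y hy
        have : ‖y‖ ^ 2 ≤ R ^ 2 := by gcongr
        simp only [hχ, he _ this, sub_self, zero_mul]
      rw [pd, hev.fderiv_eq]; simp)
  simp only [hz, zero_mul, integral_zero, Finset.sum_const_zero, add_zero] at key
  simp only [hχ, sub_mul] at key
  rw [integral_sub i₁ i₂] at key
  linarith

/-- The indicator of the disc is a pointwise limit of smooth radial cut-offs, and these all give the
same integral. The truncated integral is thus constant for R > R₀, whether or not the integrand is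
integrable over the whole fluid. -/
theorem IsBody.setIntegral_convection_perp (hS : IsBody S) {v : L2} (hv : v ∈ spaceVlow S)
    {R₀ R : ℝ} (hR₀ : 0 < R₀) (hR : R₀ < R) (hSR : ∀ x ∈ S, ‖x‖ < R₀) :
    ∫ x in Sᶜ ∩ Metric.ball 0 R, convection S perp v x
      = ∫ x in Sᶜ, cut R₀ x * convection S perp v x := by
  have hRR : R₀ ^ 2 < R ^ 2 := by gcongr
  -- These profiles vanish from R² on and converge to 1 below it; for large n they equal 1 up to
  -- R₀², as the comparison with `cut R₀` requires.
  set θ : ℕ → ℝ → ℝ := fun n s => Real.smoothTransition (n * (R ^ 2 - s)) with hθ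
  have hs : ∀ n, ContDiff ℝ ∞ (θ n) := fun n =>
    Real.smoothTransition.contDiff.comp (contDiff_const.mul (contDiff_const.sub contDiff_id))
  have hzero : ∀ n s, R ^ 2 ≤ s → θ n s = 0 := fun n s h =>
    Real.smoothTransition.zero_of_nonpos (mul_nonpos_of_nonneg_of_nonpos n.cast_nonneg
      (by linarith))
  have hone : ∀ s, s < R ^ 2 → ∀ᶠ n in atTop, ∀ s' ≤ s, θ n s' = 1 := fun s h => by
    obtain ⟨N, hN⟩ := exists_nat_gt (R ^ 2 - s)⁻¹
    filter_upwards [eventually_ge_atTop N] with n hn s' hs'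
    refine Real.smoothTransition.one_of_one_le ?_
    have h1 : 0 < R ^ 2 - s := by linarith
    have h2 : (R ^ 2 - s)⁻¹ ≤ n := hN.le.trans (by exact_mod_cast hn)
    calc (1 : ℝ) = (R ^ 2 - s)⁻¹ * (R ^ 2 - s) := (inv_mul_cancel₀ h1.ne').symm
      _ ≤ n * (R ^ 2 - s') := by gcongr
  have hb := hS.integrableOn_convection_perp hv R
  have hm : MeasurableSet (Metric.ball (0 : Plane) R) := measurableSet_ball
  have hbi : Integrable ((Metric.ball (0 : Plane) R).indicator (convection S perp v))
      (volume.restrict Sᶜ) := by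
    rwa [integrable_indicator_iff hm, IntegrableOn, Measure.restrict_restrict hm, inter_comm]
  have hlim : Tendsto (fun n => ∫ x in Sᶜ, θ n (‖x‖ ^ 2) * convection S perp v x) atTop
      (𝓝 (∫ x in Sᶜ, (Metric.ball (0 : Plane) R).indicator (convection S perp v) x)) := by
    refine tendsto_integral_of_dominated_convergence
      (fun x => ‖(Metric.ball (0 : Plane) R).indicator (convection S perp v) x‖) (fun n => ?_)
      hbi.norm (fun n => ae_of_all _ fun x => ?_) (ae_of_all _ fun x => ?_)
    · exact (hS.integrable_mul_convection_perp hv (contDiff_radial (hs n)).continuous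
        (hasCompactSupport_radial (hzero n))).1
    · by_cases hx : ‖x‖ < R
      · rw [indicator_of_mem (mem_ball_zero_iff.2 hx), norm_mul,
          Real.norm_of_nonneg (Real.smoothTransition.nonneg _)]
        exact mul_le_of_le_one_left (norm_nonneg _) (Real.smoothTransition.le_one _)
      · rw [hzero n _ (by have := hR₀.trans hR; push Not at hx; gcongr), zero_mul, norm_zero]
        exact norm_nonneg _
    · by_cases hx : ‖x‖ < R
      · rw [indicator_of_mem (mem_ball_zero_iff.2 hx)]
        refine tendsto_const_nhds.congr' ?_
        filter_upwards [hone (‖x‖ ^ 2) (by gcongr)] with n hn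
        rw [hn _ le_rfl, one_mul]
      · rw [indicator_of_notMem (fun h => hx (mem_ball_zero_iff.1 h))]
        refine tendsto_const_nhds.congr fun n => ?_
        rw [hzero n _ (by have := hR₀.trans hR; push Not at hx; gcongr), zero_mul]
  have hconst : ∀ᶠ n in atTop, ∫ x in Sᶜ, cut R₀ x * convection S perp v x
      = ∫ x in Sᶜ, θ n (‖x‖ ^ 2) * convection S perp v x := by
    filter_upwards [hone _ hRR] with n hn
    exact hS.integral_radial_mul_convection_perp hv (contDiff_cutProfile R₀) (hs n)
      (cutProfile_eq_zero hR₀) (hzero n) hSR fun s h => by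
        rw [cutProfile_eq_one hR₀ s h, hn s h]
  have := tendsto_nhds_unique (tendsto_const_nhds.congr' hconst) hlim
  rw [this, integral_indicator hm, Measure.restrict_restrict hm, inter_comm]

/-! ### The form `b` vanishes on the diagonal -/

/-- The velocity in the frame translated with the solid. -/
theorem convection_relative (S : Set Plane) (u v : Plane → Plane) (x : Plane) :
    convection S (fun x => u x - solidPart S u x) v x
      = convection S (fun x => u x - ell S u) v x - rot S u * convection S perp v x := by
  have h : ∀ j, solidPart S u x j = ell S u j + rot S u * perp x j := fun j => by
    simp [solidPart, rigidField, ell, rot]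
  simp only [convection, PiLp.sub_apply, h, Fin.sum_univ_two]
  ring

theorem inner_perp_self (x : Plane) : inner ℝ (perp x) x = 0 := by
  rw [inner_eq_sum, perp_zero_apply, perp_one_apply]; ring

/-- The zero-order term drops out because v^⊥ is orthogonal to v. What remains is split into a
translated part, integrable over the whole fluid, and a rotational part, which is controlled only
after truncation. -/
theorem bIntegrand_diagonal (S : Set Plane) (u v : Plane → Plane) : bIntegrand S u v v
    = fun x => convection S (fun x => u x - ell S u) v x - rot S u * convection S perp v x := by
  ext x
  rw [← convection_relative, bIntegrand, inner_perp_self, mul_zero, sub_zero, convection]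
  rfl

/-- No weight is needed here: u contributes L⁴·L²·L⁴, and the constant ℓ contributes L²·L². -/
theorem IsBody.integrable_convection_translated (hS : IsBody S) {u v : L2}
    (hu : u ∈ spaceVlow S) (hv : v ∈ spaceVlow S) (ℓ : Plane) :
    IntegrableOn (convection S (fun x => u x - ℓ) v) Sᶜ := by
  have hG := memLp_grad_of_mem_spaceVlow hS.isClosed hv
  have h : Integrable (fun x => ∑ i, ∑ j, (u x j * weakGrad Sᶜ v x i j * v x i
      - ℓ j * (weakGrad Sᶜ v x i j * v x i))) (volume.restrict Sᶜ) :=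
    integrable_finsetSum _ fun i _ => integrable_finsetSum _ fun j _ =>
      (memLp_one_iff_integrable.1 (memLp_mul_mul (hS.memLp_four hu j) (hG i j)
        (hS.memLp_four hv i))).sub
      ((memLp_one_iff_integrable.1 (memLp_one_mul (hG i j) (memLp_coord S v i))).const_mul _)
  refine h.congr (ae_of_all _ fun x => ?_)
  simp only [convection, PiLp.sub_apply, sub_mul, mul_assoc]

theorem IsBody.integral_cut_mul_convection (hS : IsBody S) {u v : L2} (hu : u ∈ spaceVlow S)
    (hv : v ∈ spaceVlow S) {N : ℝ} (hN : 0 < N) :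
    2 * (∫ x in Sᶜ, cut N x * convection S (fun x => u x - solidPart S u x) v x)
      + ∑ i, ∫ x in Sᶜ, (∑ j, (u x - ell S u) j * pd j (cut N) x) * v x i ^ 2 = 0 := by
  have hs := contDiff_cut N
  have hc := hasCompactSupport_cut hN
  have ht := isTest_univ hs hc
  have key := hS.transport_eq hv (U := fun x => u x - solidPart S u x) hs (fun j => by
      have := (memLp_mul_of_hasCompactSupport hs.continuous hc (hS.memLp_four hu j)).sub
        (memLp_mul_coord (μ := volume.restrict Sᶜ) hs.continuous hc
          (continuous_rigidField (rigidPart S u)) j)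
      refine this.ae_eq (ae_of_all _ fun x => ?_)
      simp only [Pi.sub_apply, PiLp.sub_apply, mul_sub, solidPart])
    (fun j => by
      have := (memLp_mul_of_hasCompactSupport (continuous_pd ht j) (compact_pd ht j)
        (memLp_coord S u j)).sub (memLp_mul_coord (μ := volume.restrict Sᶜ) (continuous_pd ht j)
          (compact_pd ht j) (continuous_rigidField (rigidPart S u)) j)
      refine this.ae_eq (ae_of_all _ fun x => ?_)
      simp only [Pi.sub_apply, PiLp.sub_apply, solidPart]
      ring)
    (fun g hg hgc => hS.integral_relative_eq_zero hu.1 (isTest_univ (hs.mul hg) hc.mul_right))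
  -- The gradient of the cut-off is radial, so the rotational part of u_S, which would grow
  -- linearly, disappears from the flux.
  have e : ∀ x, ∑ j, (u x - solidPart S u x) j * pd j (cut N) x
      = ∑ j, (u x - ell S u) j * pd j (cut N) x := fun x => by
    have hpd : ∀ j, pd j (cut N) x = 2 * x j * deriv (cutProfile N) (‖x‖ ^ 2) := fun j =>
      pd_radial (contDiff_cutProfile N) j x
    simp [hpd, Fin.sum_univ_two, solidPart, rigidField, ell]
    ring
  simpa only [e] using key

/-- The function |u - ℓ||v|² is integrable, as v is in L⁴ and in L², and the gradient of the cut-off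
is O(1/N). -/
theorem IsBody.exists_flux_bound (hS : IsBody S) {u v : L2} (hv : v ∈ spaceVlow S)
    (ℓ : Plane) : ∃ K, ∀ N, 0 < N →
      ‖∑ i, ∫ x in Sᶜ, (∑ j, (u x - ℓ) j * pd j (cut N) x) * v x i ^ 2‖ ≤ K / N := by
  obtain ⟨D, hD, hb⟩ := exists_bound_pd_cut
  have i1 : ∀ i j, Integrable (fun x => |(u x - ℓ) j| * v x i ^ 2) (volume.restrict Sᶜ) := by
    intro i j
    have h4 := hS.memLp_four hv i
    have h : Integrable (fun x => u x j * (v x i * v x i) - ℓ j * v x i ^ 2)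
        (volume.restrict Sᶜ) :=
      (memLp_one_iff_integrable.1 (memLp_one_mul (memLp_coord S u j) (memLp_two_mul h4 h4))).sub
        ((memLp_coord S v i).integrable_sq.const_mul _)
    refine h.norm.congr (ae_of_all _ fun x => ?_)
    simp only [PiLp.sub_apply]
    rw [← sq, ← sub_mul, norm_mul, Real.norm_eq_abs, Real.norm_of_nonneg (sq_nonneg _)]
  refine ⟨∑ i, ∫ x in Sᶜ, D * ∑ j, |(u x - ℓ) j| * v x i ^ 2, fun N hN => ?_⟩
  rw [Finset.sum_div]
  refine (norm_sum_le _ _).trans (Finset.sum_le_sum fun i _ => ?_)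
  rw [← integral_div]
  refine norm_integral_le_of_norm_le (((integrable_finsetSum _ fun j _ => i1 i j).const_mul _).div_const _)
    (ae_of_all _ fun x => ?_)
  rw [norm_mul, Real.norm_of_nonneg (sq_nonneg _), ← Finset.sum_mul, mul_div_right_comm, ← mul_assoc,
    Finset.mul_sum]
  gcongr
  refine (norm_sum_le _ _).trans (Finset.sum_le_sum fun j _ => ?_)
  rw [norm_mul, mul_comm]
  gcongr
  · exact hb N hN j x
  · exact le_rfl

/-- In the transport identity with `cut N` the rotational term is independent of N for large N, the
flux tends to zero, and the translated term converges by dominated convergence. The limit is the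
stated balance of the two parts. -/
theorem IsBody.integral_convection_translated (hS : IsBody S) {u v : L2} (hu : u ∈ spaceVlow S)
    (hv : v ∈ spaceVlow S) {R₀ : ℝ} (hR₀ : 0 < R₀) (hSR : ∀ x ∈ S, ‖x‖ < R₀) :
    ∫ x in Sᶜ, convection S (fun x => u x - ell S u) v x
      = rot S u * ∫ x in Sᶜ, cut R₀ x * convection S perp v x := by
  set c := ∫ x in Sᶜ, cut R₀ x * convection S perp v x
  have hE := hS.integrable_convection_translated hu hv (ell S u)
  obtain ⟨K, hK⟩ := hS.exists_flux_bound (u := u) hv (ell S u)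
  have hcut : ∀ N, R₀ ≤ N → 0 < N → ∫ x in Sᶜ, cut N x * convection S perp v x = c :=
    fun N hN hN0 => hS.integral_radial_mul_convection_perp hv (contDiff_cutProfile N)
      (contDiff_cutProfile R₀) (cutProfile_eq_zero hN0) (cutProfile_eq_zero hR₀) hSR fun s hs => by
        rw [cutProfile_eq_one hR₀ s hs, cutProfile_eq_one hN0 s (hs.trans (by gcongr))]
  have hEc : ∀ N, IntegrableOn (fun x => cut N x * convection S (fun x => u x - ell S u) v x)
      Sᶜ := fun N => by
    refine Integrable.mono hE ((contDiff_cut N).continuous.aestronglyMeasurable.mul hE.1)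
      (ae_of_all _ fun x => ?_)
    rw [norm_mul, Real.norm_of_nonneg (cut_nonneg N x)]
    exact mul_le_of_le_one_left (norm_nonneg _) (cut_le_one N x)
  have hid : ∀ N, R₀ ≤ N → 0 < N →
      ∫ x in Sᶜ, cut N x * convection S (fun x => u x - ell S u) v x
        = rot S u * c - 2⁻¹ * ∑ i, ∫ x in Sᶜ, (∑ j, (u x - ell S u) j * pd j (cut N) x)
          * v x i ^ 2 := fun N hN hN0 => by
    have h := hS.integral_cut_mul_convection hu hv hN0
    have e : ∀ x, cut N x * convection S (fun x => u x - solidPart S u x) v x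
        = cut N x * convection S (fun x => u x - ell S u) v x
          - rot S u * (cut N x * convection S perp v x) := fun x => by
      rw [convection_relative]; ring
    simp only [e] at h
    rw [integral_sub (hEc N) ((hS.integrable_mul_convection_perp hv (contDiff_cut N).continuous
      (hasCompactSupport_cut hN0)).const_mul _), integral_const_mul, hcut N hN hN0] at h
    linarith
  have hpos : ∀ᶠ n : ℕ in atTop, R₀ ≤ n ∧ (0 : ℝ) < n := by
    filter_upwards [tendsto_natCast_atTop_atTop.eventually_ge_atTop R₀] with n hn
    exact ⟨hn, hR₀.trans_le hn⟩
  have hq : Tendsto (fun n : ℕ => ∑ i, ∫ x in Sᶜ,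
      (∑ j, (u x - ell S u) j * pd j (cut n) x) * v x i ^ 2) atTop (𝓝 0) := by
    refine squeeze_zero_norm' ?_ (tendsto_const_div_atTop_nhds_zero_nat K)
    filter_upwards [hpos] with n hn using hK n hn.2
  have hl2 : Tendsto (fun n : ℕ => ∫ x in Sᶜ, cut n x * convection S (fun x => u x - ell S u) v x)
      atTop (𝓝 (rot S u * c)) := by
    have := (tendsto_const_nhds (x := rot S u * c)).sub (hq.const_mul 2⁻¹)
    rw [mul_zero, sub_zero] at this
    refine this.congr' ?_
    filter_upwards [hpos] with n hn using (hid n hn.1 hn.2).symm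
  have hl1 : Tendsto (fun n : ℕ => ∫ x in Sᶜ, cut n x * convection S (fun x => u x - ell S u) v x)
      atTop (𝓝 (∫ x in Sᶜ, convection S (fun x => u x - ell S u) v x)) := by
    refine tendsto_integral_of_dominated_convergence
      (fun x => ‖convection S (fun x => u x - ell S u) v x‖) (fun n => (hEc n).1) hE.norm
      (fun n => ae_of_all _ fun x => ?_) (ae_of_all _ fun x => ?_)
    · rw [norm_mul, Real.norm_of_nonneg (cut_nonneg _ x)]
      exact mul_le_of_le_one_left (norm_nonneg _) (cut_le_one _ x)
    · refine tendsto_const_nhds.congr' ?_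
      filter_upwards [hpos, tendsto_natCast_atTop_atTop.eventually_ge_atTop ‖x‖] with n hn hx
      rw [cut_eq_one hn.2 hx, one_mul]
  exact tendsto_nhds_unique hl1 hl2

/-- On large discs the rotational contribution has already reached its final value, which is the
limit of the translated contribution. The term with the mass vanishes on the diagonal by
orthogonality. -/
theorem IsBody.bForm_diagonal (hS : IsBody S) {u v : L2} (hu : u ∈ spaceVlow S)
    (hv : v ∈ spaceVlow S) :
    (∀ R : ℝ, IntegrableOn (bIntegrand S u v v) (Sᶜ ∩ Metric.ball 0 R)) ∧
      Tendsto (fun R : ℝ => bOn S (Sᶜ ∩ Metric.ball 0 R) m u v v) atTop (𝓝 0) ∧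
      (IntegrableOn (bIntegrand S u v v) Sᶜ → bForm S m u v v = 0) := by
  obtain ⟨R₀, hR₀, hSR⟩ := hS.isBounded.exists_pos_norm_lt
  have hE := hS.integrable_convection_translated hu hv (ell S u)
  have hP := hS.integrableOn_convection_perp hv
  have hcov : AECover (volume.restrict Sᶜ) atTop fun R : ℝ => Metric.ball (0 : Plane) R :=
    aecover_ball tendsto_id
  have hset : ∀ (f : Plane → ℝ) R, ∫ x in Metric.ball (0 : Plane) R, f x ∂volume.restrict Sᶜ
      = ∫ x in Sᶜ ∩ Metric.ball 0 R, f x := fun f R => by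
    rw [Measure.restrict_restrict measurableSet_ball, inter_comm]
  have hbOn : ∀ A, bOn S A m u v v = ∫ x in A, bIntegrand S u v v x := fun A => by
    rw [bOn, inner_perp_self, mul_zero, sub_zero]
  have hlim : Tendsto (fun R : ℝ => bOn S (Sᶜ ∩ Metric.ball 0 R) m u v v) atTop (𝓝 0) := by
    have h1 := (hcov.integral_tendsto_of_countably_generated hE).sub_const
      (rot S u * ∫ x in Sᶜ, cut R₀ x * convection S perp v x)
    rw [hS.integral_convection_translated hu hv hR₀ hSR, sub_self] at h1
    refine h1.congr' ?_
    filter_upwards [eventually_gt_atTop R₀] with R hR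
    rw [hbOn, bIntegrand_diagonal, integral_sub (hE.mono_set inter_subset_left) ((hP R).const_mul _),
      integral_const_mul, hS.setIntegral_convection_perp hv hR₀ hR hSR, hset]
  refine ⟨fun R => ?_, hlim, fun hi => ?_⟩
  · rw [bIntegrand_diagonal]
    exact (hE.mono_set inter_subset_left).sub ((hP R).const_mul _)
  · have h2 := hcov.integral_tendsto_of_countably_generated hi
    simp only [hset, ← hbOn] at h2
    exact tendsto_nhds_unique h2 hlim

end Vanishing

section Traces
variable {S : Set Plane} {m J : ℝ}

/-- Polarization of the vanishing on the diagonal, evaluated at v + w. With v and w in 𝓥 all the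
integrands are integrable. -/
theorem IsBody.bForm_antisymm (hS : IsBody S) (hm : 0 < m) {u v w : L2}
    (hu : u ∈ spaceVlow S) (hv : v ∈ spaceV S) (hw : w ∈ spaceV S) :
    bForm S m u v w = -bForm S m u w v := by
  have hle := spaceV_le_spaceVlow S
  -- Only integrability is taken from the bound, and J enters only the norms; J = 1 serves.
  obtain ⟨C, -, hC⟩ := hS.exists_bForm_bound hm one_pos
  obtain ⟨B, hB⟩ := hS.exists_trilinear (m := m) (U := spaceVlow S) (V := spaceV S) (W := spaceV S)
    (fun _ h => h.1) (fun _ h => h.1) (fun _ h => h.1) (fun _ h => ⟨_, h.2.choose_spec.1⟩)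
    fun u hu v hv w hw => (hC u hu v (hle hv) w hw).1
  have h0 : ∀ z : spaceV S, B ⟨u, hu⟩ z z = 0 := fun z => by
    rw [hB]
    exact (hS.bForm_diagonal hu (hle z.2)).2.2 (hC u hu z (hle z.2) z z.2).1
  have h := h0 (⟨v, hv⟩ + ⟨w, hw⟩)
  simp only [map_add, LinearMap.add_apply, h0, zero_add, add_zero, hB] at h
  linarith

/-! ### Traces -/

/-- `γ` is the trace of the scalar function `φ` with weak gradient `G`. -/
def IsScalarTrace (S : Set Plane) (φ : Plane → ℝ) (G : Fin 2 → Plane → ℝ) (γ : Plane → ℝ) : Prop :=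
  AEStronglyMeasurable γ (arcLength S) ∧ ∃ f, SmoothLimit Sᶜ f φ G ∧
    Tendsto (fun n => eLpNorm (f n - γ) 2 (arcLength S)) atTop (𝓝 0)

theorem IsScalarTrace.add {φ φ' γ γ' : Plane → ℝ} {G G' : Fin 2 → Plane → ℝ}
    (h : IsScalarTrace S φ G γ) (h' : IsScalarTrace S φ' G' γ') :
    IsScalarTrace S (φ + φ') (G + G') (γ + γ') := by
  obtain ⟨hm, f, hf, ht⟩ := h
  obtain ⟨hm', f', hf', ht'⟩ := h'
  refine ⟨hm.add hm', _, hf.add hf', ?_⟩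
  have hl := ht.add ht'
  rw [add_zero] at hl
  refine tendsto_of_tendsto_of_tendsto_of_le_of_le tendsto_const_nhds hl (fun _ => zero_le)
    fun n => ?_
  dsimp only
  rw [add_sub_add_comm]
  exact eLpNorm_add_le ((hf.smooth n).continuous.aestronglyMeasurable.sub hm)
    ((hf'.smooth n).continuous.aestronglyMeasurable.sub hm') (by norm_num)

theorem IsScalarTrace.smul {φ γ : Plane → ℝ} {G : Fin 2 → Plane → ℝ}
    (h : IsScalarTrace S φ G γ) (c : ℝ) : IsScalarTrace S (c • φ) (c • G) (c • γ) := by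
  obtain ⟨hm, f, hf, ht⟩ := h
  refine ⟨hm.const_smul c, _, hf.smul c, ?_⟩
  have hl := ENNReal.Tendsto.const_mul ht (a := ‖c‖ₑ) (Or.inr enorm_ne_top)
  rw [mul_zero] at hl
  refine hl.congr fun n => ?_
  rw [← smul_sub, eLpNorm_const_smul]

theorem IsScalarTrace.congr {φ φ' γ : Plane → ℝ} {G G' : Fin 2 → Plane → ℝ}
    (h : IsScalarTrace S φ G γ) (h1 : φ =ᵐ[volume.restrict Sᶜ] φ')
    (h2 : ∀ j, G j =ᵐ[volume.restrict Sᶜ] G' j) : IsScalarTrace S φ' G' γ := by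
  obtain ⟨hm, f, hf, ht⟩ := h
  exact ⟨hm, f, hf.congr h1 h2, ht⟩

theorem IsBody.exists_trace_bound (hS : IsBody S) : ∃ C : ℝ≥0∞, C ≠ ⊤ ∧
    ∀ φ G γ, IsScalarTrace S φ G γ → eLpNorm γ 2 (arcLength S) ≤ C * h1Norm Sᶜ φ G := by
  obtain ⟨C, hC, hb⟩ := hS.exists_bound_trace
  refine ⟨C, hC, fun φ G γ h => ?_⟩
  obtain ⟨hm, f, hf, ht⟩ := h
  exact hf.le_of_tendsto (by norm_num) hC hb hm ht

/-- The difference of two traces is a trace of the zero pair, and the trace inequality makes it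
vanish. -/
theorem IsBody.scalarTrace_unique (hS : IsBody S) {φ γ γ' : Plane → ℝ} {G : Fin 2 → Plane → ℝ}
    (h : IsScalarTrace S φ G γ) (h' : IsScalarTrace S φ G γ') : γ =ᵐ[arcLength S] γ' := by
  obtain ⟨C, hC, hb⟩ := hS.exists_trace_bound
  have h0 := hb _ _ _ (h.add (h'.smul (-1)))
  have hz : h1Norm Sᶜ (φ + (-1 : ℝ) • φ) (G + (-1 : ℝ) • G) = 0 := by
    simp [h1Norm]
  rw [hz, mul_zero, nonpos_iff_eq_zero, eLpNorm_eq_zero_iff (h.1.add (h'.1.const_smul _))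
    (by norm_num)] at h0
  filter_upwards [h0] with x hx
  simp only [Pi.add_apply, Pi.smul_apply, Pi.zero_apply, smul_eq_mul] at hx
  linarith

theorem eLpNorm_coord_le {μ : Measure Plane} (F : Plane → Plane) (i : Fin 2) :
    eLpNorm (fun x => F x i) 2 μ ≤ eLpNorm F 2 μ :=
  eLpNorm_mono fun x => PiLp.norm_apply_le (F x) i

theorem norm_le_sum_coord (x : Plane) : ‖x‖ ≤ |x 0| + |x 1| := by
  rw [EuclideanSpace.norm_eq, Fin.sum_univ_two, Real.norm_eq_abs, Real.norm_eq_abs]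
  refine Real.sqrt_le_iff.2 ⟨by positivity, ?_⟩
  nlinarith [mul_nonneg (abs_nonneg (x 0)) (abs_nonneg (x 1))]

theorem eLpNorm_le_sum_coord {μ : Measure Plane} (F : Plane → Plane)
    (h : ∀ i, AEStronglyMeasurable (fun x => F x i) μ) :
    eLpNorm F 2 μ ≤ eLpNorm (fun x => F x 0) 2 μ + eLpNorm (fun x => F x 1) 2 μ := by
  rw [← eLpNorm_norm (fun x => F x 0), ← eLpNorm_norm (fun x => F x 1)]
  have h1 : eLpNorm F 2 μ ≤ eLpNorm ((fun x => ‖F x 0‖) + fun x => ‖F x 1‖) 2 μ :=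
    eLpNorm_mono_real fun x => norm_le_sum_coord (F x)
  exact h1.trans (eLpNorm_add_le (h 0).norm (h 1).norm (by norm_num))

/-- The vector with given coordinates. -/
noncomputable def ofCoords (a : Fin 2 → ℝ) : Plane :=
  a 0 • EuclideanSpace.single 0 1 + a 1 • EuclideanSpace.single 1 1

@[simp] theorem ofCoords_apply (a : Fin 2 → ℝ) (i : Fin 2) : ofCoords a i = a i := by
  fin_cases i <;> simp [ofCoords]

theorem memLp_ofCoords {μ : Measure Plane} {p : ℝ≥0∞} {γ : Fin 2 → Plane → ℝ}
    (h : ∀ i, MemLp (γ i) p μ) : MemLp (fun x => ofCoords fun i => γ i x) p μ :=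
  ((ContinuousLinearMap.toSpanSingleton ℝ (EuclideanSpace.single 0 1 : Plane)).comp_memLp' (h 0)).add
    ((ContinuousLinearMap.toSpanSingleton ℝ (EuclideanSpace.single 1 1 : Plane)).comp_memLp' (h 1))

theorem contDiff_ofCoords {f : Fin 2 → Plane → ℝ} (h : ∀ i, ContDiff ℝ ∞ (f i)) :
    ContDiff ℝ ∞ fun x => ofCoords fun i => f i x :=
  ((h 0).smul contDiff_const).add ((h 1).smul contDiff_const)

theorem hasCompactSupport_ofCoords {f : Fin 2 → Plane → ℝ} (h : ∀ i, HasCompactSupport (f i)) :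
    HasCompactSupport fun x => ofCoords fun i => f i x :=
  HasCompactSupport.add (f := fun x => f 0 x • (EuclideanSpace.single 0 1 : Plane))
    (h 0).smul_right (h 1).smul_right

/-- By the trace inequality the boundary values of an H¹ approximating sequence are Cauchy in L² of
the boundary. The components are treated separately and reassembled. -/
theorem IsBody.exists_isTrace (hS : IsBody S) {u : L2} (hu : u ∈ spaceVlow S) :
    ∃ γ, IsTrace S u γ := by
  obtain ⟨C, hC, hb⟩ := hS.exists_bound_trace
  have := hS.isFiniteMeasure_arcLength
  choose f hf using hS.exists_smoothLimit hu
  choose γ hγ ht using fun i => (hf i).exists_limit hC hb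
  have hm : ∀ i n, AEStronglyMeasurable (f i n) (arcLength S) := fun i n =>
    ((hf i).smooth n).continuous.aestronglyMeasurable
  refine ⟨fun x => ofCoords fun i => γ i x, memLp_ofCoords hγ, fun n x => ofCoords fun i => f i n x,
    fun n => ⟨contDiff_ofCoords fun i => (hf i).smooth n,
      hasCompactSupport_ofCoords fun i => (hf i).compact n⟩, ?_, ?_, ?_⟩
  · have hl := (hf 0).tendsto_fun.add (hf 1).tendsto_fun
    rw [add_zero] at hl
    refine tendsto_of_tendsto_of_tendsto_of_le_of_le tendsto_const_nhds hl (fun _ => zero_le)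
      fun n => (eLpNorm_le_sum_coord _ fun i => ?_).trans (le_of_eq ?_)
    · simp only [PiLp.sub_apply, ofCoords_apply]
      exact ((hf i).smooth n).continuous.aestronglyMeasurable.sub (hf i).meas
    · simp only [PiLp.sub_apply, ofCoords_apply]; rfl
  · intro i j
    simp only [ofCoords_apply]
    exact (hf i).tendsto_pd j
  · have hl := (ht 0).add (ht 1)
    rw [add_zero] at hl
    refine tendsto_of_tendsto_of_tendsto_of_le_of_le tendsto_const_nhds hl (fun _ => zero_le)
      fun n => (eLpNorm_le_sum_coord _ fun i => ?_).trans (le_of_eq ?_)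
    · simp only [PiLp.sub_apply, ofCoords_apply]
      exact (hm i n).sub (hγ i).1
    · simp only [PiLp.sub_apply, ofCoords_apply]; rfl

theorem IsBody.isTrace_trace (hS : IsBody S) {u : L2} (hu : u ∈ spaceVlow S) :
    IsTrace S u (trace S u) := by
  have h := hS.exists_isTrace hu
  rw [trace, dif_pos h]
  exact h.choose_spec

theorem IsBody.isScalarTrace_trace (hS : IsBody S) {u : L2} (hu : u ∈ spaceVlow S) (i : Fin 2) :
    IsScalarTrace S (fun x => u x i) (fun j x => weakGrad Sᶜ u x i j) (fun x => trace S u x i) := by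
  obtain ⟨hm, f, hf, h1, h2, h3⟩ := hS.isTrace_trace hu
  refine ⟨((EuclideanSpace.proj i : Plane →L[ℝ] ℝ).comp_memLp' hm).1, fun n x => f n x i,
    .of_tendsto (fun n => ?_) (fun n => ?_) ?_ (fun j => h2 i j) (memLp_coord S u i).1
      fun j => (memLp_grad_of_mem_spaceVlow hS.isClosed hu i j).1, ?_⟩
  · exact (EuclideanSpace.proj i : Plane →L[ℝ] ℝ).contDiff.comp (hf n).1
  · exact (hf n).2.comp_left (g := fun x : Plane => x i) rfl
  · exact tendsto_of_tendsto_of_tendsto_of_le_of_le tendsto_const_nhds h1 (fun _ => zero_le)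
      fun n => eLpNorm_coord_le (fun x => f n x - u x) i
  · exact tendsto_of_tendsto_of_tendsto_of_le_of_le tendsto_const_nhds h3 (fun _ => zero_le)
      fun n => eLpNorm_coord_le (fun x => f n x - trace S u x) i

/-- Both sides are traces of the same function with the same weak gradient, so uniqueness applies
despite the choice in `trace`. -/
theorem IsBody.trace_combination (hS : IsBody S) {u v : L2} (hu : u ∈ spaceVlow S)
    (hv : v ∈ spaceVlow S) (c : ℝ) :
    ∀ᵐ x ∂arcLength S, trace S (c • u + v : L2) x = c • trace S u x + trace S v x := by
  have huv := (spaceVlow S).add_mem ((spaceVlow S).smul_mem c hu) hv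
  have h : ∀ i, ∀ᵐ x ∂arcLength S,
      trace S (c • u + v : L2) x i = c * trace S u x i + trace S v x i := fun i => by
    refine hS.scalarTrace_unique (hS.isScalarTrace_trace huv i)
      ((((hS.isScalarTrace_trace hu i).smul c).add (hS.isScalarTrace_trace hv i)).congr ?_
        fun j => ?_)
    · filter_upwards [ae_restrict_of_ae (coeFn_combination c u v)] with x hx
      simp only [Pi.add_apply, Pi.smul_apply, smul_eq_mul, hx, PiLp.add_apply, PiLp.smul_apply]
    · filter_upwards [weakGrad_combination hS.isClosed.isOpen_compl ⟨_, hu.2.choose_spec.1⟩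
        ⟨_, hv.2.choose_spec.1⟩ c] with x hx
      simp only [Pi.add_apply, Pi.smul_apply, smul_eq_mul, hx]
  filter_upwards [h 0, h 1] with x h0 h1
  ext i
  fin_cases i
  · simpa using h0
  · simpa using h1

end Traces

section FormA
variable {S : Set Plane} {m J : ℝ}

/-! ### The form `a` -/

theorem IsBody.ae_norm_le_arcLength (hS : IsBody S) :
    ∃ R, 0 < R ∧ ∀ᵐ x ∂arcLength S, ‖x‖ ≤ R := by
  obtain ⟨R, hR, hSR⟩ := hS.isBounded.exists_pos_norm_lt
  refine ⟨R, hR, ?_⟩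
  filter_upwards [ae_restrict_mem isClosed_frontier.measurableSet] with x hx
  exact (hSR x (hS.isClosed.frontier_subset hx)).le

theorem IsBody.memLp_sqrt_weight_arcLength (hS : IsBody S) :
    MemLp (fun x => Real.sqrt (1 + ‖x‖ ^ 2)) 2 (arcLength S) := by
  have := hS.isFiniteMeasure_arcLength
  obtain ⟨R, hR, hx⟩ := hS.ae_norm_le_arcLength
  refine MemLp.of_bound (Continuous.aestronglyMeasurable (by fun_prop)) (Real.sqrt (1 + R ^ 2)) ?_
  filter_upwards [hx] with x hx
  rw [Real.norm_of_nonneg (Real.sqrt_nonneg _)]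
  gcongr

/-- The slip velocity on the boundary is square integrable, with a bound. -/
theorem IsBody.exists_slip_bound (hS : IsBody S) (hm : 0 < m) (hJ : 0 < J) :
    ∃ C : ℝ, 0 < C ∧ ∀ u ∈ spaceVlow S, ∀ i,
      MemLp (fun x => (trace S u x - solidPart S u x) i) 2 (arcLength S) ∧
      lp 2 (arcLength S) (fun x => (trace S u x - solidPart S u x) i) ≤ C * normVlow S m J u := by
  obtain ⟨c, hc, hcb⟩ := exists_rigid_bound S hm hJ
  obtain ⟨D, hD, hDb⟩ := hS.exists_trace_bound
  have hW := hS.memLp_sqrt_weight_arcLength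
  set W := lp 2 (arcLength S) fun x => Real.sqrt (1 + ‖x‖ ^ 2)
  have hW0 : 0 ≤ W := lp_nonneg _ _ _
  have hD0 : 0 ≤ D.toReal := ENNReal.toReal_nonneg
  -- Trace inequality plus the bound for the rigid part against the weight on the boundary; the
  -- summand 1 only makes the constant positive.
  refine ⟨D.toReal * 3 + 2 * c * W + 1, by positivity, fun u hu i => ?_⟩
  have hn := normVlow_nonneg S m J u
  have ht := hS.isScalarTrace_trace hu i
  have hbt := (hDb _ _ _ ht).trans
    (mul_le_mul_right (h1Norm_le_normVlow (m := m) (J := J) hS.isClosed hm hJ hu i) _)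
  have hfin : D * ENNReal.ofReal (3 * normVlow S m J u) ≠ ⊤ :=
    ENNReal.mul_ne_top hD ENNReal.ofReal_ne_top
  have h1 : MemLp (fun x => trace S u x i) 2 (arcLength S) := ⟨ht.1, hbt.trans_lt hfin.lt_top⟩
  have b1 : lp 2 (arcLength S) (fun x => trace S u x i) ≤ D.toReal * (3 * normVlow S m J u) := by
    have := ENNReal.toReal_mono hfin hbt
    rwa [ENNReal.toReal_mul, ENNReal.toReal_ofReal (by positivity)] at this
  have hle : ∀ x, |-solidPart S u x i|
      ≤ (‖ell S u‖ + |rot S u|) * |Real.sqrt (1 + ‖x‖ ^ 2)| := fun x => by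
    rw [abs_neg, abs_of_nonneg (Real.sqrt_nonneg (1 + ‖x‖ ^ 2))]
    exact abs_solidPart_le S u x i
  have h2 : MemLp (fun x => -solidPart S u x i) 2 (arcLength S) :=
    hW.of_le_mul (continuous_solidPart_coord S u i).neg.aestronglyMeasurable (ae_of_all _ hle)
  have b2 : lp 2 (arcLength S) (fun x => -solidPart S u x i) ≤ 2 * c * normVlow S m J u * W := by
    refine (lp_le_of_abs_le (by positivity) (ae_of_all _ hle) hW).trans ?_
    have h3 := (hcb u).1
    have h4 := (hcb u).2
    have h5 : c * normH S m J u ≤ c * normVlow S m J u := by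
      gcongr; exact normH_le_normVlow _ _ _ _
    gcongr
    linarith
  have e : ∀ x, (trace S u x - solidPart S u x) i = trace S u x i + -solidPart S u x i :=
    fun x => sub_eq_add_neg _ _
  simp only [e]
  refine ⟨h1.add h2, (lp_add_le (by norm_num) h1 h2).trans ?_⟩
  calc _ ≤ D.toReal * (3 * normVlow S m J u) + 2 * c * normVlow S m J u * W := add_le_add b1 b2
    _ ≤ D.toReal * (3 * normVlow S m J u) + 2 * c * normVlow S m J u * W + normVlow S m J u :=
        le_add_of_nonneg_right hn
    _ = _ := by ring

theorem aBoundary_eq (S : Set Plane) (u v : Plane → Plane) (x : Plane) : aBoundary S u v x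
    = (trace S u x - solidPart S u x) 0 * (trace S v x - solidPart S v x) 0
      + (trace S u x - solidPart S u x) 1 * (trace S v x - solidPart S v x) 1 := inner_eq_sum _ _

theorem IsBody.exists_boundary_bound (hS : IsBody S) (hm : 0 < m) (hJ : 0 < J) :
    ∃ C : ℝ, 0 < C ∧ ∀ u ∈ spaceVlow S, ∀ v ∈ spaceVlow S,
      Integrable (aBoundary S u v) (arcLength S) ∧
      |∫ x, aBoundary S u v x ∂arcLength S| ≤ C * (normVlow S m J u * normVlow S m J v) := by
  obtain ⟨C, hC, hb⟩ := hS.exists_slip_bound hm hJ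
  refine ⟨2 * C ^ 2, by positivity, fun u hu v hv => ?_⟩
  have hi := fun i => memLp_one_iff_integrable.1 (memLp_one_mul (hb u hu i).1 (hb v hv i).1)
  have hbd : ∀ i, |∫ x, (trace S u x - solidPart S u x) i * (trace S v x - solidPart S v x) i
      ∂arcLength S| ≤ (C * normVlow S m J u) * (C * normVlow S m J v) := fun i =>
    (abs_integral_mul_le (hb u hu i).1 (hb v hv i).1).trans
      (mul_le_mul (hb u hu i).2 (hb v hv i).2 (lp_nonneg _ _ _)
        (mul_nonneg hC.le (normVlow_nonneg _ _ _ _)))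
  have e : aBoundary S u v = fun x =>
      (trace S u x - solidPart S u x) 0 * (trace S v x - solidPart S v x) 0
      + (trace S u x - solidPart S u x) 1 * (trace S v x - solidPart S v x) 1 :=
    funext fun x => aBoundary_eq S u v x
  rw [e]
  refine ⟨(hi 0).add (hi 1), ?_⟩
  rw [integral_add (hi 0) (hi 1)]
  refine (abs_add_le _ _).trans ?_
  linarith [hbd 0, hbd 1]

theorem strain_bound (hS : IsClosed S) {u : L2} (hu : u ∈ spaceVlow S) (i j : Fin 2) :
    MemLp (fun x => strain S u x i j) 2 (volume.restrict Sᶜ) ∧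
      lp 2 (volume.restrict Sᶜ) (fun x => strain S u x i j) ≤ normVlow S m J u := by
  have hG := memLp_grad_of_mem_spaceVlow hS hu
  have hb := lp_grad_le_normVlow (m := m) (J := J) hS hu
  have h := (hG i j).add (hG j i)
  have e : (fun x => strain S u x i j)
      = fun x => 2⁻¹ * (weakGrad Sᶜ u x i j + weakGrad Sᶜ u x j i) := by
    ext x; rw [strain]; ring
  rw [e]
  refine ⟨h.const_mul _, ?_⟩
  refine (lp_le_of_abs_le (B := 2⁻¹) (by norm_num) (ae_of_all _ fun x => ?_) h).trans ?_
  · rw [abs_mul, abs_of_pos (by norm_num : (0 : ℝ) < 2⁻¹)]; rfl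
  · have := lp_add_le (by norm_num) (hG i j) (hG j i)
    change 2⁻¹ * lp 2 _ (fun x => weakGrad Sᶜ u x i j + weakGrad Sᶜ u x j i) ≤ _
    linarith [hb i j, hb j i]

theorem aInterior_bound (hS : IsClosed S) {u v : L2} (hu : u ∈ spaceVlow S)
    (hv : v ∈ spaceVlow S) : IntegrableOn (aInterior S u v) Sᶜ ∧
      |∫ x in Sᶜ, aInterior S u v x| ≤ 4 * (normVlow S m J u * normVlow S m J v) := by
  have hbu := strain_bound (m := m) (J := J) hS hu
  have hbv := strain_bound (m := m) (J := J) hS hv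
  have hi := fun i j => memLp_one_iff_integrable.1 (memLp_one_mul (hbu i j).1 (hbv i j).1)
  refine ⟨integrable_finsetSum _ fun i _ => integrable_finsetSum _ fun j _ => hi i j, ?_⟩
  have e : ∫ x in Sᶜ, aInterior S u v x
      = ∑ i, ∑ j, ∫ x in Sᶜ, strain S u x i j * strain S v x i j := by
    calc _ = ∑ i, ∫ x in Sᶜ, ∑ j, strain S u x i j * strain S v x i j :=
          integral_finsetSum _ fun i _ => integrable_finsetSum _ fun j _ => hi i j
      _ = _ := Finset.sum_congr rfl fun i _ => integral_finsetSum _ fun j _ => hi i j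
  rw [e]
  calc _ ≤ ∑ i : Fin 2, ∑ j : Fin 2, normVlow S m J u * normVlow S m J v := by
        refine (Finset.abs_sum_le_sum_abs _ _).trans (Finset.sum_le_sum fun i _ => ?_)
        refine (Finset.abs_sum_le_sum_abs _ _).trans (Finset.sum_le_sum fun j _ => ?_)
        exact (abs_integral_mul_le (hbu i j).1 (hbv i j).1).trans (mul_le_mul (hbu i j).2
          (hbv i j).2 (lp_nonneg _ _ _) (normVlow_nonneg _ _ _ _))
    _ = _ := by simp; ring

theorem aForm_comm (S : Set Plane) (α : ℝ) (u v : Plane → Plane) :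
    aForm S α u v = aForm S α v u := by
  simp only [aForm, aBoundary, aInterior, real_inner_comm, mul_comm]

theorem IsBody.aForm_combination (hS : IsBody S) {α : ℝ} {u u' v : L2} (hu : u ∈ spaceVlow S)
    (hu' : u' ∈ spaceVlow S) (hv : v ∈ spaceVlow S) (c : ℝ) :
    aForm S α (c • u + u' : L2) v = c * aForm S α u v + aForm S α u' v := by
  -- Again only integrability is used, so m = J = 1 is an arbitrary choice.
  obtain ⟨C, -, hb⟩ := hS.exists_boundary_bound (m := 1) (J := 1) one_pos one_pos
  have hi := fun {u : L2} (hu : u ∈ spaceVlow S) =>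
    (aInterior_bound (m := 1) (J := 1) hS.isClosed hu hv).1
  have e1 : ∫ x, aBoundary S (c • u + u' : L2) v x ∂arcLength S
      = c * (∫ x, aBoundary S u v x ∂arcLength S) + ∫ x, aBoundary S u' v x ∂arcLength S := by
    rw [← integral_const_mul, ← integral_add ((hb u hu v hv).1.const_mul c) (hb u' hu' v hv).1]
    refine integral_congr_ae ?_
    filter_upwards [hS.trace_combination hu hu' c] with x hx
    rw [aBoundary, aBoundary, aBoundary, hx, hS.solidPart_combination hu.1 hu'.1 c x,
      ← real_inner_smul_left, ← inner_add_left]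
    congr 1
    rw [smul_sub]; abel
  have e2 : ∫ x in Sᶜ, aInterior S (c • u + u' : L2) v x
      = c * (∫ x in Sᶜ, aInterior S u v x) + ∫ x in Sᶜ, aInterior S u' v x := by
    rw [← integral_const_mul, ← integral_add ((hi hu).const_mul c) (hi hu')]
    refine integral_congr_ae ?_
    filter_upwards [weakGrad_combination hS.isClosed.isOpen_compl ⟨_, hu.2.choose_spec.1⟩
        ⟨_, hu'.2.choose_spec.1⟩ c] with x hx
    simp only [aInterior, strain, hx, Pi.add_apply, Pi.smul_apply, smul_eq_mul, Fin.sum_univ_two]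
    ring
  rw [aForm, aForm, aForm, e1, e2]
  ring

theorem IsBody.exists_aForm (hS : IsBody S) (hm : 0 < m) (hJ : 0 < J) {α : ℝ} (hα : 0 ≤ α) :
    ∃ A : spaceVlow S →ₗ[ℝ] spaceVlow S →ₗ[ℝ] ℝ,
      (∀ u v : spaceVlow S, Integrable (aBoundary S u v) (arcLength S) ∧
        IntegrableOn (aInterior S u v) Sᶜ ∧ A u v = aForm S α u v) ∧
      ∃ C : ℝ, 0 < C ∧ ∀ u v, |A u v| ≤ C * normVlow S m J u * normVlow S m J v := by
  obtain ⟨C, hC, hb⟩ := hS.exists_boundary_bound hm hJ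
  refine ⟨linearOfCombination (fun u : spaceVlow S => linearOfCombination
    (fun v : spaceVlow S => aForm S α u v) fun c v v' => ?_) fun c u u' => ?_, fun u v =>
    ⟨(hb u u.2 v v.2).1, (aInterior_bound (m := m) (J := J) hS.isClosed u.2 v.2).1, rfl⟩,
    α * C + 4, by positivity, fun u v => ?_⟩
  · rw [aForm_comm S α u v, aForm_comm S α u v', aForm_comm]
    exact hS.aForm_combination v.2 v'.2 u.2 c
  · ext v
    exact hS.aForm_combination u.2 u'.2 v.2 c
  · change |aForm S α u v| ≤ _
    rw [aForm]
    refine (abs_sub _ _).trans ?_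
    rw [abs_mul, abs_neg, abs_of_nonneg hα]
    calc _ ≤ α * (C * (normVlow S m J u * normVlow S m J v))
          + 4 * (normVlow S m J u * normVlow S m J v) := by
          gcongr
          · exact (hb u u.2 v v.2).2
          · exact (aInterior_bound hS.isClosed u.2 v.2).2
      _ = _ := by ring

end FormA

end FluidBody


/-! ### Assembly of the three statements -/

theorem mainTheorem5 (S : Set FluidBody.Plane) (hS : FluidBody.IsBody S) (m J α : ℝ)
    (hm : 0 < m) (hJ : 0 < J) (hα : 0 ≤ α) :
    -- (i) `b` is a continuous trilinear form on `Vlow × Vlow × V`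
    (∃ B : FluidBody.spaceVlow S →ₗ[ℝ] FluidBody.spaceVlow S →ₗ[ℝ] FluidBody.spaceV S →ₗ[ℝ] ℝ,
      (∀ (u v : FluidBody.spaceVlow S) (w : FluidBody.spaceV S), IntegrableOn (FluidBody.bIntegrand S u v w) Sᶜ ∧
        B u v w = FluidBody.bForm S m u v w) ∧
      ∃ C : ℝ, 0 < C ∧ ∀ u v w,
        |B u v w| ≤ C * FluidBody.normVlow S m J u * FluidBody.normVlow S m J v
          * FluidBody.normV S m J w) ∧
    -- `b(u, v, v) = 0` for `u, v` in `Vlow`: the integral is the limit of the integrals over large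
    -- balls, and the plain integral whenever the integrand is integrable
    (∀ u ∈ FluidBody.spaceVlow S, ∀ v ∈ FluidBody.spaceVlow S,
      (∀ R : ℝ, IntegrableOn (FluidBody.bIntegrand S u v v) (Sᶜ ∩ Metric.ball 0 R)) ∧
      Tendsto (fun R : ℝ => FluidBody.bOn S (Sᶜ ∩ Metric.ball 0 R) m u v v) atTop (𝓝 0) ∧
      (IntegrableOn (FluidBody.bIntegrand S u v v) Sᶜ → FluidBody.bForm S m u v v = 0)) ∧
    -- antisymmetry in the last two arguments
    (∀ u ∈ FluidBody.spaceVlow S, ∀ v ∈ FluidBody.spaceV S, ∀ w ∈ FluidBody.spaceV S,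
      FluidBody.bForm S m u v w = -FluidBody.bForm S m u w v) ∧
    -- (ii) the same formula gives a continuous trilinear form on `H × H × Vhat`
    (∃ B : FluidBody.spaceH S →ₗ[ℝ] FluidBody.spaceH S →ₗ[ℝ] FluidBody.spaceVhat S →ₗ[ℝ] ℝ,
      (∀ (u v : FluidBody.spaceH S) (w : FluidBody.spaceVhat S), IntegrableOn (FluidBody.bIntegrand S u v w) Sᶜ ∧
        B u v w = FluidBody.bForm S m u v w) ∧
      ∃ C : ℝ, 0 < C ∧ ∀ u v w,
        |B u v w| ≤ C * FluidBody.normH S m J u * FluidBody.normH S m J v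
          * FluidBody.normVhat S m J w) ∧
    -- (iii) `a` is a continuous bilinear form on `Vlow × Vlow`
    (∀ u ∈ FluidBody.spaceVlow S, FluidBody.IsTrace S u (FluidBody.trace S u)) ∧
    (∃ A : FluidBody.spaceVlow S →ₗ[ℝ] FluidBody.spaceVlow S →ₗ[ℝ] ℝ,
      (∀ u v : FluidBody.spaceVlow S, Integrable (FluidBody.aBoundary S u v) (FluidBody.arcLength S) ∧
        IntegrableOn (FluidBody.aInterior S u v) Sᶜ ∧
        A u v = FluidBody.aForm S α u v) ∧
      ∃ C : ℝ, 0 < C ∧ ∀ u v,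
        |A u v| ≤ C * FluidBody.normVlow S m J u * FluidBody.normVlow S m J v) := by
  have hle := FluidBody.spaceV_le_spaceVlow S
  obtain ⟨C₁, hC₁, h₁⟩ := hS.exists_bForm_bound hm hJ
  obtain ⟨C₂, hC₂, h₂⟩ := hS.exists_bForm_bound_lip hm hJ
  obtain ⟨B₁, hB₁⟩ := hS.exists_trilinear (m := m) (U := FluidBody.spaceVlow S)
    (V := FluidBody.spaceVlow S) (W := FluidBody.spaceV S) (fun _ h => h.1) (fun _ h => h.1)
    (fun _ h => h.1) (fun _ h => ⟨_, h.2.choose_spec.1⟩)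
    fun u hu v hv w hw => (h₁ u hu v hv w hw).1
  obtain ⟨B₂, hB₂⟩ := hS.exists_trilinear (m := m) (U := FluidBody.spaceH S)
    (V := FluidBody.spaceH S) (W := FluidBody.spaceVhat S) le_rfl le_rfl
    (fun _ h => h.1.1) (fun _ h => ⟨_, h.1.2.choose_spec.1⟩)
    fun u _ v _ w hw => (h₂ u v w hw).1
  refine ⟨⟨B₁, fun u v w => ⟨(h₁ u u.2 v v.2 w w.2).1, hB₁ u v w⟩, C₁, hC₁, fun u v w => ?_⟩,
    fun u hu v hv => hS.bForm_diagonal hu hv, fun u hu v hv w hw => hS.bForm_antisymm hm hu hv hw,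
    ⟨B₂, fun u v w => ⟨(h₂ u v w w.2).1, hB₂ u v w⟩, C₂, hC₂, fun u v w => ?_⟩,
    fun u hu => hS.isTrace_trace hu, hS.exists_aForm hm hJ hα⟩
  · rw [hB₁]; exact (h₁ u u.2 v v.2 w w.2).2
  · rw [hB₂]; exact (h₂ u v w w.2).2
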